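/- **Proposition 4.2.** Let $n\in\mathbb N_0$, $1\le p\le\infty$ and $\tfrac12\le\alpha\le1$. *Notation.* Let $d\mu(z)=e^{-\pi|z|^2}d^2z$ on $\mathbb C$, with $d^2z$ Lebesgue measure. Let $\mathbf F^n(\mathbb C)$ be the set of all $F\in L^2(\mathbb C,d\mu)$ that are (a.e. equal to) smooth functions with $\partial_{\bar z}^{\,n+1}F=0$. For $j\ge0$ let $\mathcal F^j(\mathbb C)\subset L^2(\mathbb C,d\mu)$ be the closed subspace of all functions $\frac1{\sqrt{j!}}\big(\sqrt\pi\,\bar z-\tfrac1{\sqrt\pi}\partial_z\big)^j\Phi$ in $L^2(\mathbb C,d\mu)$ with $\Phi\in L^2(\mathbb C,d\mu)$ entire, and let $P^j$ be the orthogonal projection of $L^2(\mathbb C,d\mu)$ onto it. For $a>0$ let $\mathcal W^{p,n}_{a,\alpha}$ be the space of all $\sigma\in\mathbf F^n(\mathbb C)$ with $$\|\sigma\|_{\mathcal W^{p,n}_{a,\alpha}}=\sum_{j=0}^n\Big\|e^{a|\cdot|^{1/\alpha}}e^{-\frac\pi2|\cdot|^2}P^j\sigma\Big\|_{L^p(\mathbb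 C)}<\infty ,$$ and put $\mathcal G^{\{\alpha\}}_n=\bigcup_{a>0}\mathcal W^{p,n}_{a,\alpha}$, with the locally convex inductive limit topology, and $\mathcal G^{(\alpha)}_n=\bigcap_{a>0}\mathcal W^{p,n}_{a,\alpha}$, with the projective limit topology. For $A>0$ and $f\in C^\infty(\mathbb R)$ let $\|f\|_A=\sup_{k,l\in\mathbb N_0,\,x\in\mathbb R}\dfrac{|x^kf^{(l)}(x)|}{A^{k+l}(k!)^\alpha(l!)^\alpha}$. The Gel'fand–Shilov space $\mathcal S^\alpha_\alpha(\mathbb R)$ consists of the $f$ with $\|f\|_A<\infty$ for some $A>0$ (inductive limit topology), and $\Sigma^\alpha_\alpha(\mathbb R)$ of the $f$ with $\|f\|_A<\infty$ for every $A>0$ (projective limit topology). A prime denotes the space of continuous linear functionals with the strong dual topology, and finite products carry the product topology. Let $h_j(t)=\frac{2^{1/4}}{\sqrt{j!}}\big(-\frac1{2\sqrt\pi}\big)^je^{\pi t^2}\frac{d^j}{dt^j}e^{-2\pi t^2}$ be the $L^2$-normalized Hermite functions, $(V_{h_j}f)(x,\omega)=\int_{\mathbb R}f(t)\overline{h_j(t-x)}e^{-2\pi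 it\omega}dt$, and $$(\mathcal B^jf)(x+i\omega)=e^{-i\pi x\omega}e^{\frac\pi2(x^2+\omega^2)}(V_{h_j}f)(x,-\omega),\qquad \mathbf B^n(f_0,\dots,f_n)=\sum_{j=0}^n\mathcal B^jf_j .$$ For $a>0$ let $|f|_{a,j}=\big\|e^{a(x^2+\omega^2)^{1/(2\alpha)}}(V_{h_j}f)(x,\omega)\big\|_{L^p(\mathbb R^2)}\in[0,\infty]$. *Statement.* Let $(\mathcal G,\mathcal S)$ be either $(\mathcal G^{\{\alpha\}}_n,\mathcal S^\alpha_\alpha(\mathbb R))$ or $(\mathcal G^{(\alpha)}_n,\Sigma^\alpha_\alpha(\mathbb R))$. Then: 1. The vector-valued poly-Bargmann transform $\mathbf B^n$ is a linear homeomorphism of $\mathcal S^{n+1}=\prod_{j=0}^n\mathcal S$ onto $\mathcal G$. 2. It is isometric in the following senses: $\langle\mathbf B^n\vec f,\mathbf B^n\vec g\rangle_{d\mu}=\sum_{j=0}^n\langle f_j,g_j\rangle_{L^2(\mathbb R)}$ for all $\vec f,\vec g\in\mathcal S^{n+1}$, and $\|\mathbf B^n\vec f\|_{\mathcal W^{p,n}_{a,\alpha}}=\sum_{j=0}^n|f_j|_{a,j}$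 for all $a>0$ and $\vec f\in\mathcal S^{n+1}$ (both sides may be $+\infty$). 3. The formula $\langle \mathbf B'(T_0,\dots,T_n),\mathbf B^n\vec f\,\rangle=\sum_{j=0}^n T_j(f_j)$ (for $\vec f\in\mathcal S^{n+1}$) defines a linear homeomorphism $\mathbf B'$ of $\prod_{j=0}^n\mathcal S'$ onto $\mathcal G'$, and $\mathbf B'$ is isometric for the dual norms: for every $a>0$, $$\sup\{|\mathbf B'(\vec T)(\sigma)|:\sigma\in\mathcal G,\ \|\sigma\|_{\mathcal W^{p,n}_{a,\alpha}}\le1\}=\max_{0\le j\le n}\ \sup\{|T_j(f)|:f\in\mathcal S,\ |f|_{a,j}\le1\}$$ (values in $[0,\infty]$). -/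

import Mathlib

open MeasureTheory
open scoped ENNReal NNReal ContDiff

noncomputable section

namespace PolyGS

/-! ### Polyanalytic Fock spaces -/

/-- The Gaussian measure `dμ(z) = e^{-π|z|²} d²z` on `ℂ`, where `d²z` is Lebesgue measure. -/
def gaussMeasure : Measure ℂ :=
  volume.withDensity fun z => ENNReal.ofReal (Real.exp (-Real.pi * ‖z‖ ^ 2))

/-- The Hilbert space `L²(ℂ, dμ)`. -/
abbrev L2Gauss : Type := Lp ℂ 2 gaussMeasure

/-- `∂_{z̄} = (∂_x + i ∂_ω) / 2`. -/
def dbar (Ψ : ℂ → ℂ) (z : ℂ) : ℂ :=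
  (1 / 2) * (fderiv ℝ Ψ z 1 + Complex.I * fderiv ℝ Ψ z Complex.I)

/-- `∂_z = (∂_x - i ∂_ω) / 2`. -/
def dz (Ψ : ℂ → ℂ) (z : ℂ) : ℂ :=
  (1 / 2) * (fderiv ℝ Ψ z 1 - Complex.I * fderiv ℝ Ψ z Complex.I)

/-- The creation operator `Ψ ↦ √π z̄ Ψ - (1/√π) ∂_z Ψ`. -/
def creation (Ψ : ℂ → ℂ) (z : ℂ) : ℂ :=
  (Real.sqrt Real.pi : ℂ) * (starRingEnd ℂ) z * Ψ z - (1 / (Real.sqrt Real.pi : ℂ)) * dz Ψ z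

theorem dbar_smooth {Ψ : ℂ → ℂ} (h : ContDiff ℝ ∞ Ψ) : ContDiff ℝ ∞ (dbar Ψ) := by
  have h' : ContDiff ℝ ∞ (fderiv ℝ Ψ) := h.fderiv_right (by simp)
  unfold dbar
  fun_prop

theorem creation_smooth {Ψ : ℂ → ℂ} (h : ContDiff ℝ ∞ Ψ) : ContDiff ℝ ∞ (creation Ψ) := by
  have h' : ContDiff ℝ ∞ (fderiv ℝ Ψ) := h.fderiv_right (by simp)
  have hc : ContDiff ℝ ∞ (fun z : ℂ => (starRingEnd ℂ) z) := Complex.conjCLE.contDiff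
  unfold creation dz
  fun_prop

theorem dbar_iter_lin {Ψ Θ : ℂ → ℂ} (hΨ : ContDiff ℝ ∞ Ψ) (hΘ : ContDiff ℝ ∞ Θ) (c : ℂ) (k : ℕ) :
    dbar^[k] (Ψ + c • Θ) = dbar^[k] Ψ + c • dbar^[k] Θ := by
  induction k generalizing Ψ Θ with
  | zero => rfl
  | succ k ih =>
    have key : dbar (Ψ + c • Θ) = dbar Ψ + c • dbar Θ := by
      funext z
      have h1 : DifferentiableAt ℝ Ψ z := (hΨ.differentiable (by simp)) z
      have h2 : DifferentiableAt ℝ Θ z := (hΘ.differentiable (by simp)) z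
      simp only [dbar, Pi.add_apply, Pi.smul_apply, smul_eq_mul]
      rw [fderiv_add h1 (h2.const_smul c), fderiv_const_smul h2 c]
      simp only [add_apply, smul_apply, smul_eq_mul]
      ring
    simp only [Function.iterate_succ, Function.comp_apply, key]
    exact ih (dbar_smooth hΨ) (dbar_smooth hΘ)

theorem creation_iter_lin {Ψ Θ : ℂ → ℂ} (hΨ : ContDiff ℝ ∞ Ψ) (hΘ : ContDiff ℝ ∞ Θ) (c : ℂ)
    (k : ℕ) : creation^[k] (Ψ + c • Θ) = creation^[k] Ψ + c • creation^[k] Θ := by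
  induction k generalizing Ψ Θ with
  | zero => rfl
  | succ k ih =>
    have key : creation (Ψ + c • Θ) = creation Ψ + c • creation Θ := by
      funext z
      have h1 : DifferentiableAt ℝ Ψ z := (hΨ.differentiable (by simp)) z
      have h2 : DifferentiableAt ℝ Θ z := (hΘ.differentiable (by simp)) z
      simp only [creation, dz, Pi.add_apply, Pi.smul_apply, smul_eq_mul]
      rw [fderiv_add h1 (h2.const_smul c), fderiv_const_smul h2 c]
      simp only [add_apply, smul_apply, smul_eq_mul]
      ring
    simp only [Function.iterate_succ, Function.comp_apply, key]
    exact ih (creation_smooth hΨ) (creation_smooth hΘ)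

theorem dbar_iter_zero (k : ℕ) : dbar^[k] (0 : ℂ → ℂ) = 0 := by
  have h := dbar_iter_lin (Ψ := 0) (Θ := 0) contDiff_const contDiff_const 1 k
  simpa using h

theorem creation_iter_zero (k : ℕ) : creation^[k] (0 : ℂ → ℂ) = 0 := by
  have h := creation_iter_lin (Ψ := 0) (Θ := 0) contDiff_const contDiff_const 1 k
  simpa using h

/-- The polyanalytic Fock space `𝐅ⁿ(ℂ) = L²(ℂ, dμ) ∩ ker (∂_{z̄})^{n+1}`. -/
def polyFock (n : ℕ) : Submodule ℂ L2Gauss where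
  carrier := {F | ∃ Ψ : ℂ → ℂ, ContDiff ℝ ∞ Ψ ∧ dbar^[n + 1] Ψ = 0 ∧ F =ᵐ[gaussMeasure] Ψ}
  zero_mem' := ⟨0, contDiff_const, dbar_iter_zero _, Lp.coeFn_zero _ _ _⟩
  add_mem' := by
    rintro F G ⟨Ψ, h1, h2, h3⟩ ⟨Θ, g1, g2, g3⟩
    refine ⟨Ψ + Θ, h1.add g1, ?_, (Lp.coeFn_add F G).trans (h3.add g3)⟩
    have h := dbar_iter_lin h1 g1 1 (n + 1)
    rw [one_smul] at h
    rw [h, h2, g2]; simp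
  smul_mem' := by
    rintro c G ⟨Θ, g1, g2, g3⟩
    refine ⟨c • Θ, contDiff_const.smul g1, ?_, (Lp.coeFn_smul c G).trans (g3.const_smul c)⟩
    have h := dbar_iter_lin (Ψ := 0) contDiff_const g1 c (n + 1)
    rw [zero_add] at h
    rw [h, g2, dbar_iter_zero]; simp

/-- The true polyanalytic Fock space `ℱʲ(ℂ)`: the functions `(j!)^{-1/2} (Z̄†)ʲ Φ`, where `Z̄†` is
the creation operator and `Φ` is an entire function in `L²(ℂ, dμ)`. -/
def trueFock (j : ℕ) : Submodule ℂ L2Gauss where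
  carrier := {F | ∃ Φ : ℂ → ℂ, Differentiable ℂ Φ ∧ MemLp Φ 2 gaussMeasure ∧
    F =ᵐ[gaussMeasure] (1 / (Real.sqrt (j.factorial : ℝ) : ℂ)) • creation^[j] Φ}
  zero_mem' := by
    refine ⟨0, differentiable_const _, MemLp.zero, ?_⟩
    rw [creation_iter_zero, smul_zero]
    exact Lp.coeFn_zero _ _ _
  add_mem' := by
    rintro F G ⟨Ψ, h1, h2, h3⟩ ⟨Θ, g1, g2, g3⟩
    refine ⟨Ψ + Θ, h1.add g1, h2.add g2, (Lp.coeFn_add F G).trans ?_⟩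
    have h := creation_iter_lin (h1.contDiff.restrict_scalars ℝ) (g1.contDiff.restrict_scalars ℝ) 1 j
    rw [one_smul, one_smul] at h
    rw [h, smul_add]
    exact h3.add g3
  smul_mem' := by
    rintro c G ⟨Θ, g1, g2, g3⟩
    refine ⟨c • Θ, g1.const_smul c, g2.const_smul c, (Lp.coeFn_smul c G).trans ?_⟩
    have h := creation_iter_lin (Ψ := 0) contDiff_const (g1.contDiff.restrict_scalars ℝ) c j
    rw [zero_add, creation_iter_zero, zero_add] at h
    rw [h, smul_comm]
    exact g3.const_smul c

/-- The orthogonal projection `Pʲ : L²(ℂ, dμ) → ℱʲ(ℂ)`.  (The space `ℱʲ(ℂ)` is closed; the closure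
is only taken so that Mathlib's orthogonal projection applies.) -/
def polyProj (j : ℕ) : L2Gauss →L[ℂ] L2Gauss :=
  (trueFock j).topologicalClosure.starProjection

/-! ### The weighted spaces and the complex Gel'fand–Shilov type spaces -/

/-- The function `z ↦ e^{a|z|^{1/α}} e^{-(π/2)|z|²} (Pʲσ)(z)`. -/
def weighted (α a : ℝ) (j : ℕ) (σ : L2Gauss) (z : ℂ) : ℂ :=
  ((Real.exp (a * ‖z‖ ^ (1 / α)) * Real.exp (-(Real.pi / 2) * ‖z‖ ^ 2) : ℝ) : ℂ) * polyProj j σ z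

/-- The norm `∑_{j ≤ n} ‖ e^{a|·|^{1/α}} e^{-(π/2)|·|²} Pʲσ ‖_{Lᵖ(ℂ)}`, with values in `[0, ∞]`. -/
def polyNorm (n : ℕ) (p : ℝ≥0∞) (α a : ℝ) (σ : L2Gauss) : ℝ≥0∞ :=
  ∑ j : Fin (n + 1), eLpNorm (weighted α a j σ) p volume

theorem volume_ac : (volume : Measure ℂ) ≪ gaussMeasure := by
  refine withDensity_absolutelyContinuous' ?_ ?_
  · fun_prop
  · exact Filter.Eventually.of_forall fun z => by simp [Real.exp_pos]

theorem weighted_add (α a : ℝ) (j : ℕ) (σ τ : L2Gauss) :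
    weighted α a j (σ + τ) =ᵐ[volume] weighted α a j σ + weighted α a j τ := by
  have h := volume_ac.ae_le (Lp.coeFn_add (polyProj j σ) (polyProj j τ))
  filter_upwards [h] with z hz
  simp only [weighted, map_add, Pi.add_apply] at hz ⊢
  rw [hz]; ring

theorem weighted_smul (α a : ℝ) (j : ℕ) (c : ℂ) (σ : L2Gauss) :
    weighted α a j (c • σ) =ᵐ[volume] c • weighted α a j σ := by
  have h := volume_ac.ae_le (Lp.coeFn_smul c (polyProj j σ))
  filter_upwards [h] with z hz
  simp only [weighted, map_smul, Pi.smul_apply, smul_eq_mul] at hz ⊢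
  rw [hz]; ring

theorem weighted_aesm (α a : ℝ) (j : ℕ) (σ : L2Gauss) :
    AEStronglyMeasurable (weighted α a j σ) volume := by
  have h : AEStronglyMeasurable (polyProj j σ : ℂ → ℂ) volume :=
    (Lp.aestronglyMeasurable (polyProj j σ)).mono_ac volume_ac
  have hw : Measurable fun z : ℂ => ((Real.exp (a * ‖z‖ ^ (1 / α)) *
      Real.exp (-(Real.pi / 2) * ‖z‖ ^ 2) : ℝ) : ℂ) := by fun_prop
  exact hw.aestronglyMeasurable.mul h

/-- The space `𝒲^{p,n}_{a,α}` of all `σ ∈ 𝐅ⁿ(ℂ)` such that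
`e^{a|·|^{1/α}} e^{-(π/2)|·|²} Pʲσ ∈ Lᵖ(ℂ)` for `0 ≤ j ≤ n`. -/
def weightedSpace (n : ℕ) (p : ℝ≥0∞) (α a : ℝ) : Submodule ℂ L2Gauss where
  carrier := {σ | σ ∈ polyFock n ∧ ∀ j : Fin (n + 1), MemLp (weighted α a j σ) p volume}
  zero_mem' := by
    refine ⟨zero_mem _, fun j => ?_⟩
    have h := weighted_smul α a j 0 0
    rw [zero_smul, zero_smul] at h
    exact (memLp_congr_ae h).2 MemLp.zero
  add_mem' := fun {σ τ} hσ hτ => ⟨add_mem hσ.1 hτ.1, fun j =>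
    (memLp_congr_ae (weighted_add α a j σ τ)).2 ((hσ.2 j).add (hτ.2 j))⟩
  smul_mem' := fun c σ hσ => ⟨Submodule.smul_mem _ c hσ.1, fun j =>
    (memLp_congr_ae (weighted_smul α a j c σ)).2 ((hσ.2 j).const_smul c)⟩

theorem weightedSpace_mono (n : ℕ) (p : ℝ≥0∞) (α : ℝ) {a b : ℝ} (hab : a ≤ b) :
    weightedSpace n p α b ≤ weightedSpace n p α a := by
  rintro σ ⟨h1, h2⟩
  refine ⟨h1, fun j => (h2 j).mono (weighted_aesm α a j σ) (Filter.Eventually.of_forall fun z => ?_)⟩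
  simp only [weighted, norm_mul, Complex.norm_real, Real.norm_eq_abs, Real.abs_exp]
  gcongr

/-- The complex space `𝒢^{α}_n = ⋃_{a>0} 𝒲^{p,n}_{a,α}` as a subspace of `L²(ℂ, dμ)`. -/
def polyRoumieuSub (n : ℕ) (p : ℝ≥0∞) (α : ℝ) : Submodule ℂ L2Gauss where
  carrier := {σ | ∃ a : ℝ, 0 < a ∧ σ ∈ weightedSpace n p α a}
  zero_mem' := ⟨1, one_pos, zero_mem _⟩
  add_mem' := by
    rintro σ τ ⟨a, ha, hσ⟩ ⟨b, hb, hτ⟩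
    exact ⟨min a b, lt_min ha hb, add_mem (weightedSpace_mono n p α (min_le_left _ _) hσ)
      (weightedSpace_mono n p α (min_le_right _ _) hτ)⟩
  smul_mem' := by
    rintro c σ ⟨a, ha, hσ⟩
    exact ⟨a, ha, Submodule.smul_mem _ c hσ⟩

/-- The complex space `𝒢^{(α)}_n = ⋂_{a>0} 𝒲^{p,n}_{a,α}` as a subspace of `L²(ℂ, dμ)`. -/
def polyBeurlingSub (n : ℕ) (p : ℝ≥0∞) (α : ℝ) : Submodule ℂ L2Gauss where
  carrier := {σ | ∀ a : ℝ, 0 < a → σ ∈ weightedSpace n p α a}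
  zero_mem' := fun _ _ => zero_mem _
  add_mem' := fun hσ hτ a ha => add_mem (hσ a ha) (hτ a ha)
  smul_mem' := fun c _ hσ a ha => Submodule.smul_mem _ c (hσ a ha)

/-! ### The Gel'fand–Shilov spaces on the line -/

/-- The Gel'fand–Shilov norm
`sup_{k,l,x} |x|^k |f^{(l)}(x)| / (A^{k+l} (k!)^α (l!)^α)`, with values in `[0, ∞]`. -/
def gsNorm (α A : ℝ) (f : ℝ → ℂ) : ℝ≥0∞ :=
  ⨆ (k : ℕ) (l : ℕ) (x : ℝ), ENNReal.ofReal (|x| ^ k * ‖iteratedDeriv l f x‖ /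
    (A ^ (k + l) * (k.factorial : ℝ) ^ α * (l.factorial : ℝ) ^ α))

theorem gsNorm_zero (α A : ℝ) : gsNorm α A 0 = 0 := by
  have h : ∀ (l : ℕ) (x : ℝ), iteratedDeriv l (0 : ℝ → ℂ) x = 0 := by
    intro l x
    have := iteratedDeriv_const_smul_field (n := l) (x := x) (0 : ℂ) (0 : ℝ → ℂ)
    rw [zero_smul, zero_smul] at this
    exact this
  simp [gsNorm, h]

theorem gsNorm_add (α : ℝ) {A : ℝ} (hA : 0 < A) {f g : ℝ → ℂ} (hf : ContDiff ℝ ∞ f)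
    (hg : ContDiff ℝ ∞ g) : gsNorm α A (f + g) ≤ gsNorm α A f + gsNorm α A g := by
  refine iSup_le fun k => iSup_le fun l => iSup_le fun x => ?_
  have e : iteratedDeriv l (f + g) x = iteratedDeriv l f x + iteratedDeriv l g x :=
    iteratedDeriv_add ((hf.of_le (by exact_mod_cast le_top)).contDiffAt)
      ((hg.of_le (by exact_mod_cast le_top)).contDiffAt)
  set D : ℝ := A ^ (k + l) * (k.factorial : ℝ) ^ α * (l.factorial : ℝ) ^ α with hD
  have hD0 : 0 < D := by positivity
  have h1 : ENNReal.ofReal (|x| ^ k * ‖iteratedDeriv l f x‖ / D) ≤ gsNorm α A f :=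
    le_iSup_of_le k (le_iSup_of_le l (le_iSup_of_le x le_rfl))
  have h2 : ENNReal.ofReal (|x| ^ k * ‖iteratedDeriv l g x‖ / D) ≤ gsNorm α A g :=
    le_iSup_of_le k (le_iSup_of_le l (le_iSup_of_le x le_rfl))
  refine le_trans ?_ (add_le_add h1 h2)
  rw [← ENNReal.ofReal_add (by positivity) (by positivity), e, ← add_div, ← mul_add]
  refine ENNReal.ofReal_le_ofReal ?_
  gcongr
  exact norm_add_le _ _

theorem gsNorm_smul (α : ℝ) (A : ℝ) (c : ℂ) (f : ℝ → ℂ) :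
    gsNorm α A (c • f) ≤ ENNReal.ofReal ‖c‖ * gsNorm α A f := by
  refine iSup_le fun k => iSup_le fun l => iSup_le fun x => ?_
  have h1 : ENNReal.ofReal (|x| ^ k * ‖iteratedDeriv l f x‖ /
      (A ^ (k + l) * (k.factorial : ℝ) ^ α * (l.factorial : ℝ) ^ α)) ≤ gsNorm α A f :=
    le_iSup_of_le k (le_iSup_of_le l (le_iSup_of_le x le_rfl))
  refine le_trans (le_of_eq ?_) (mul_le_mul_right h1 _)
  rw [← ENNReal.ofReal_mul (norm_nonneg c)]
  have e := iteratedDeriv_const_smul_field (n := l) (x := x) c f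
  rw [e, norm_smul]
  congr 1
  ring

theorem gsNorm_anti (α : ℝ) {A B : ℝ} (hA : 0 < A) (hAB : A ≤ B) (f : ℝ → ℂ) :
    gsNorm α B f ≤ gsNorm α A f := by
  refine iSup_mono fun k => iSup_mono fun l => iSup_mono fun x => ENNReal.ofReal_le_ofReal ?_
  gcongr

/-- The Gel'fand–Shilov space `𝒮^α_α(ℝ)` as a set of functions: for some `A > 0` there is `C` with
`|x^k f^{(l)}(x)| ≤ C A^{k+l} (k!)^α (l!)^α` for all `k`, `l`, `x`. -/
def gsRoumieuSub (α : ℝ) : Submodule ℂ (ℝ → ℂ) where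
  carrier := {f | ContDiff ℝ ∞ f ∧ ∃ A : ℝ, 0 < A ∧ gsNorm α A f < ⊤}
  zero_mem' := ⟨contDiff_const, 1, one_pos, by rw [gsNorm_zero]; exact ENNReal.zero_lt_top⟩
  add_mem' := by
    rintro f g ⟨hf, A, hA, fA⟩ ⟨hg, B, hB, gB⟩
    refine ⟨hf.add hg, max A B, lt_max_of_lt_left hA, ?_⟩
    refine (gsNorm_add α (lt_max_of_lt_left hA) hf hg).trans_lt (ENNReal.add_lt_top.2 ⟨?_, ?_⟩)
    · exact (gsNorm_anti α hA (le_max_left _ _) f).trans_lt fA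
    · exact (gsNorm_anti α hB (le_max_right _ _) g).trans_lt gB
  smul_mem' := by
    rintro c f ⟨hf, A, hA, fA⟩
    exact ⟨contDiff_const.smul hf, A, hA,
      (gsNorm_smul α A c f).trans_lt (ENNReal.mul_lt_top ENNReal.ofReal_lt_top fA)⟩

/-- The Gel'fand–Shilov space `Σ^α_α(ℝ)` as a set of functions: for every `A > 0` there is `C` with
`|x^k f^{(l)}(x)| ≤ C A^{k+l} (k!)^α (l!)^α` for all `k`, `l`, `x`. -/
def gsBeurlingSub (α : ℝ) : Submodule ℂ (ℝ → ℂ) where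
  carrier := {f | ContDiff ℝ ∞ f ∧ ∀ A : ℝ, 0 < A → gsNorm α A f < ⊤}
  zero_mem' := ⟨contDiff_const, fun A _ => by rw [gsNorm_zero]; exact ENNReal.zero_lt_top⟩
  add_mem' := by
    rintro f g ⟨hf, fA⟩ ⟨hg, gA⟩
    exact ⟨hf.add hg, fun A hA =>
      (gsNorm_add α hA hf hg).trans_lt (ENNReal.add_lt_top.2 ⟨fA A hA, gA A hA⟩)⟩
  smul_mem' := by
    rintro c f ⟨hf, fA⟩
    exact ⟨contDiff_const.smul hf, fun A hA =>
      (gsNorm_smul α A c f).trans_lt (ENNReal.mul_lt_top ENNReal.ofReal_lt_top (fA A hA))⟩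

/-! ### Inductive and projective limit topologies

For a one-parameter family of `[0, ∞]`-valued norms `N a` (`a > 0`), the step with parameter `a` is
the space of all `x` with `N a x < ∞`. -/

/-- The topology generated by all seminorms satisfying `P`. -/
@[reducible] def seminormTopology {E : Type*} [AddCommGroup E] [Module ℂ E] (P : Seminorm ℂ E → Prop) :
    TopologicalSpace E :=
  ⨅ q : {q : Seminorm ℂ E // P q},
    q.1.toSeminormedAddCommGroup.toPseudoMetricSpace.toUniformSpace.toTopologicalSpace

/-- The locally convex inductive limit topology: it is generated by all seminorms that are
continuous on each step. -/
@[reducible] def inductiveTopology {E : Type*} [AddCommGroup E] [Module ℂ E] (N : ℝ → E → ℝ≥0∞) :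
    TopologicalSpace E :=
  seminormTopology fun q => ∀ a : ℝ, 0 < a → ∃ C : ℝ≥0, ∀ x, ENNReal.ofReal (q x) ≤ C * N a x

/-- The projective limit topology: it is generated by all seminorms that are continuous with
respect to one of the norms `N a`. -/
@[reducible] def projectiveTopology {E : Type*} [AddCommGroup E] [Module ℂ E] (N : ℝ → E → ℝ≥0∞) :
    TopologicalSpace E :=
  seminormTopology fun q => ∃ a : ℝ, 0 < a ∧ ∃ C : ℝ≥0, ∀ x, ENNReal.ofReal (q x) ≤ C * N a x

/-- `𝒮^α_α(ℝ)` as a topological vector space. -/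
def GSRoumieu (α : ℝ) : Type := gsRoumieuSub α
/-- `Σ^α_α(ℝ)` as a topological vector space. -/
def GSBeurling (α : ℝ) : Type := gsBeurlingSub α
/-- `𝒢^{α}_n` as a topological vector space. -/
def PolyRoumieu (n : ℕ) (p : ℝ≥0∞) (α : ℝ) : Type := polyRoumieuSub n p α
/-- `𝒢^{(α)}_n` as a topological vector space. -/
def PolyBeurling (n : ℕ) (p : ℝ≥0∞) (α : ℝ) : Type := polyBeurlingSub n p α

instance (α : ℝ) : AddCommGroup (GSRoumieu α) := inferInstanceAs (AddCommGroup (gsRoumieuSub α))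
instance (α : ℝ) : Module ℂ (GSRoumieu α) := inferInstanceAs (Module ℂ (gsRoumieuSub α))
instance (α : ℝ) : AddCommGroup (GSBeurling α) := inferInstanceAs (AddCommGroup (gsBeurlingSub α))
instance (α : ℝ) : Module ℂ (GSBeurling α) := inferInstanceAs (Module ℂ (gsBeurlingSub α))
instance (n : ℕ) (p : ℝ≥0∞) (α : ℝ) : AddCommGroup (PolyRoumieu n p α) :=
  inferInstanceAs (AddCommGroup (polyRoumieuSub n p α))
instance (n : ℕ) (p : ℝ≥0∞) (α : ℝ) : Module ℂ (PolyRoumieu n p α) :=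
  inferInstanceAs (Module ℂ (polyRoumieuSub n p α))
instance (n : ℕ) (p : ℝ≥0∞) (α : ℝ) : AddCommGroup (PolyBeurling n p α) :=
  inferInstanceAs (AddCommGroup (polyBeurlingSub n p α))
instance (n : ℕ) (p : ℝ≥0∞) (α : ℝ) : Module ℂ (PolyBeurling n p α) :=
  inferInstanceAs (Module ℂ (polyBeurlingSub n p α))

/-- The function underlying an element of `𝒮^α_α(ℝ)`. -/
def GSRoumieu.toFun {α : ℝ} (f : GSRoumieu α) : ℝ → ℂ := Subtype.val f
/-- The function underlying an element of `Σ^α_α(ℝ)`. -/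
def GSBeurling.toFun {α : ℝ} (f : GSBeurling α) : ℝ → ℂ := Subtype.val f
/-- The element of `L²(ℂ, dμ)` underlying an element of `𝒢^{α}_n`. -/
def PolyRoumieu.toL2 {n : ℕ} {p : ℝ≥0∞} {α : ℝ} (σ : PolyRoumieu n p α) : L2Gauss := Subtype.val σ
/-- The element of `L²(ℂ, dμ)` underlying an element of `𝒢^{(α)}_n`. -/
def PolyBeurling.toL2 {n : ℕ} {p : ℝ≥0∞} {α : ℝ} (σ : PolyBeurling n p α) : L2Gauss :=
  Subtype.val σ

instance (α : ℝ) : TopologicalSpace (GSRoumieu α) :=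
  inductiveTopology fun A f => gsNorm α A f.toFun
instance (α : ℝ) : TopologicalSpace (GSBeurling α) :=
  projectiveTopology fun A f => gsNorm α A f.toFun
instance (n : ℕ) (p : ℝ≥0∞) (α : ℝ) : TopologicalSpace (PolyRoumieu n p α) :=
  inductiveTopology fun a σ => polyNorm n p α a σ.toL2
instance (n : ℕ) (p : ℝ≥0∞) (α : ℝ) : TopologicalSpace (PolyBeurling n p α) :=
  projectiveTopology fun a σ => polyNorm n p α a σ.toL2

/-! ### Short-time Fourier transform and poly-Bargmann transforms -/

/-- The normalized Hermite function
`h_j(t) = 2^{1/4} (j!)^{-1/2} (-1/(2√π))^j e^{πt²} (d/dt)^j e^{-2πt²}`, of norm one in `L²(ℝ)`. -/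
def hermiteFn (j : ℕ) (t : ℝ) : ℝ :=
  (2 : ℝ) ^ (1 / 4 : ℝ) / Real.sqrt (j.factorial : ℝ) * (-1 / (2 * Real.sqrt Real.pi)) ^ j *
    Real.exp (Real.pi * t ^ 2) * iteratedDeriv j (fun s : ℝ => Real.exp (-2 * Real.pi * s ^ 2)) t

/-- The short-time Fourier transform `(V_ψ f)(x, w) = ∫ f(t) conj(ψ(t - x)) e^{-2πitw} dt`. -/
def stft (ψ f : ℝ → ℂ) (x w : ℝ) : ℂ :=
  ∫ t : ℝ, f t * (starRingEnd ℂ) (ψ (t - x)) *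
    Complex.exp (-2 * (Real.pi : ℂ) * Complex.I * (t : ℂ) * (w : ℂ))

/-- The true poly-Bargmann transform of order `j`:
`(𝓑ʲ f)(x + iω) = e^{-iπxω} e^{π(x²+ω²)/2} (V_{h_j} f)(x, -ω)`. -/
def trueBargmann (j : ℕ) (f : ℝ → ℂ) (z : ℂ) : ℂ :=
  Complex.exp (-Complex.I * (Real.pi : ℂ) * (z.re : ℂ) * (z.im : ℂ)) *
    Complex.exp ((Real.pi : ℂ) * ((z.re : ℂ) ^ 2 + (z.im : ℂ) ^ 2) / 2) *
    stft (fun t => (hermiteFn j t : ℂ)) f z.re (-z.im)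

/-- The vector-valued poly-Bargmann transform `𝐁ⁿ (f_0, …, f_n) = ∑_{j ≤ n} 𝓑ʲ f_j`. -/
def polyBargmann (n : ℕ) (f : Fin (n + 1) → ℝ → ℂ) (z : ℂ) : ℂ :=
  ∑ j : Fin (n + 1), trueBargmann j (f j) z

/-- The weighted norm `‖ e^{a(x²+ω²)^{1/(2α)}} (V_{h_j} f)(x, ω) ‖_{Lᵖ(ℝ²)}`, in `[0, ∞]`. -/
def modNorm (p : ℝ≥0∞) (α a : ℝ) (j : ℕ) (f : ℝ → ℂ) : ℝ≥0∞ :=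
  eLpNorm (fun y : ℝ × ℝ => (Real.exp (a * (y.1 ^ 2 + y.2 ^ 2) ^ (1 / (2 * α))) : ℂ) *
    stft (fun t => (hermiteFn j t : ℂ)) f y.1 y.2) p volume

/-- The norm of a linear functional that is dual to the norm `N`:
`sup { |T x| : N x ≤ 1 }`, in `[0, ∞]`. -/
def dualNorm {E : Type*} [TopologicalSpace E] [AddCommGroup E] [Module ℂ E] (N : E → ℝ≥0∞)
    (T : StrongDual ℂ E) : ℝ≥0∞ :=
  ⨆ (x : E) (_ : N x ≤ 1), ENNReal.ofReal ‖T x‖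

end PolyGS

end

open PolyGS

namespace PolyGS

/-! ### Calculus of `∂_z`, `∂_{z̄}` and the creation operator -/

/-! The transform of order j is the classical Bargmann transform B followed by a power of the
creation operator Z̄†: 𝓑ʲf = ((-1)ʲ/√(j!)) (Z̄†)ʲ Bf. The reason is that the raising recursion
producing Hermite polynomials under the integral sign is exactly the action of Z̄† outside it
(`creation_polyBarg`, `trueBargmann_eq`). In L²(dμ) the operator Z̄† is adjoint to ∂_{z̄}/√π and
their commutator is the identity. Hence (Z̄†)ʲ/√(j!) is isometric on the Fock space and the ranges
for different j are orthogonal (`gaussInner_creation_iter`). Stripping off the top component with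
the highest nonvanishing power of ∂_{z̄} shows that 𝐅ⁿ is the sum of these ranges
(`polyFock_decompose`). So Pʲ𝐁ⁿf = 𝓑ʲf_j. Since |𝓑ʲf(z)| e^{-π|z|²/2} = |V_{h_j}f(x,-ω)|, the norm
identity is immediate, and the inner product identity reduces to the isometry of B.

The analytic core is that the Gel'fand–Shilov norms of f and the weighted Fock norms of 𝓑ʲf control
each other after a change of parameters. From f to Bf: factorial bounds on moments and derivatives
give decay e^{-b|t|^{1/α}} of f and of its Fourier transform. The first yields decay of Bf in Re z,
and the second, because the Fourier transform becomes rotation by i, decay in Im z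
(`bargmann_decay`). Backwards, f is the adjoint Bargmann transform of Φ = Bf, a superposition of
time-frequency shifted Gaussians, and the estimates for the Gaussian are integrated against the
decay of Φ (`gsBound_bargmannAdj`). Between Φ and (Z̄†)ʲΦ one passes by local estimates: both Z̄†
and ∂_{z̄} commute with Weyl translations, so it suffices to bound (Z̄†)ʲΦ(0) and ∂_{z̄}ʲσ(0) by
integrals over the unit disc (`creation_iter_le_ballMean`, `dbar_iter_le_ballMean`). This also makes
the argument independent of p.

The condition α ≥ 1/2 means 1/α ≤ 2, so a Gaussian absorbs e^{c|u|^{1/α}}: for all c if α > 1/2,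
only for small c if α = 1/2. Small c suffice in the inductive limit. In the projective limit with α
= 1/2 both spaces are {0}, which is proved separately (`GSBound.eq_zero`,
`entire_eq_zero_of_fock_decay`).

Such parameter-shifting inequalities are precisely continuity for the limit topologies.
Transposition then gives the dual map, and the dual norm identity is the duality between ℓ¹ sums and
maxima (`dualNorm_eq_iSup`). -/

theorem smooth_of_entire {Φ : ℂ → ℂ} (h : Differentiable ℂ Φ) : ContDiff ℝ ∞ Φ :=
  h.contDiff.restrict_scalars ℝ

theorem smooth_conj : ContDiff ℝ ∞ (fun z : ℂ => (starRingEnd ℂ) z) :=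
  Complex.conjCLE.contDiff

theorem smooth_differentiable {Ψ : ℂ → ℂ} (h : ContDiff ℝ ∞ Ψ) : Differentiable ℝ Ψ :=
  h.differentiable (by simp)

theorem smooth_smul {Ψ : ℂ → ℂ} (h : ContDiff ℝ ∞ Ψ) (c : ℂ) : ContDiff ℝ ∞ (c • Ψ) :=
  h.const_smul c

theorem dz_smooth {Ψ : ℂ → ℂ} (h : ContDiff ℝ ∞ Ψ) : ContDiff ℝ ∞ (dz Ψ) := by
  have h' : ContDiff ℝ ∞ (fderiv ℝ Ψ) := h.fderiv_right (by simp)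
  unfold dz
  fun_prop

theorem dz_mul {f g : ℂ → ℂ} {z : ℂ} (hf : DifferentiableAt ℝ f z) (hg : DifferentiableAt ℝ g z) :
    dz (fun w => f w * g w) z = dz f z * g z + f z * dz g z := by
  simp only [dz]
  rw [fderiv_fun_mul hf hg]
  simp only [add_apply, smul_apply, smul_eq_mul]
  ring

theorem dbar_mul {f g : ℂ → ℂ} {z : ℂ} (hf : DifferentiableAt ℝ f z)
    (hg : DifferentiableAt ℝ g z) :
    dbar (fun w => f w * g w) z = dbar f z * g z + f z * dbar g z := by
  simp only [dbar]
  rw [fderiv_fun_mul hf hg]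
  simp only [add_apply, smul_apply, smul_eq_mul]
  ring

theorem dz_of_hasDerivAt {f : ℂ → ℂ} {f' z : ℂ} (h : HasDerivAt f f' z) : dz f z = f' := by
  have h1 := (h.hasFDerivAt.restrictScalars ℝ).fderiv
  simp only [dz, h1]
  simp
  ring_nf
  simp
  ring

theorem dbar_of_hasDerivAt {f : ℂ → ℂ} {f' z : ℂ} (h : HasDerivAt f f' z) : dbar f z = 0 := by
  have h1 := (h.hasFDerivAt.restrictScalars ℝ).fderiv
  simp only [dbar, h1]
  simp
  rw [← mul_assoc, Complex.I_mul_I]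
  ring

theorem dbar_entire {Φ : ℂ → ℂ} (h : Differentiable ℂ Φ) : dbar Φ = 0 := by
  funext z
  exact dbar_of_hasDerivAt (h z).hasDerivAt

theorem entire_of_dbar {Ψ : ℂ → ℂ} (hs : ContDiff ℝ ∞ Ψ) (h : dbar Ψ = 0) :
    Differentiable ℂ Ψ := by
  intro z
  rw [differentiableAt_complex_iff_differentiableAt_real]
  refine ⟨smooth_differentiable hs z, ?_⟩
  have h1 : dbar Ψ z = 0 := by rw [h]; rfl
  simp only [dbar] at h1
  have h2 : fderiv ℝ Ψ z 1 + Complex.I * fderiv ℝ Ψ z Complex.I = 0 := by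
    simpa using h1
  rw [smul_eq_mul]
  linear_combination (-Complex.I) * h2 + fderiv ℝ Ψ z Complex.I * Complex.I_mul_I

theorem hasFDerivAt_conj (z : ℂ) :
    HasFDerivAt (fun w : ℂ => (starRingEnd ℂ) w) (Complex.conjCLE : ℂ →L[ℝ] ℂ) z :=
  Complex.conjCLE.hasFDerivAt

theorem dz_conj (z : ℂ) : dz (fun w => (starRingEnd ℂ) w) z = 0 := by
  simp only [dz, (hasFDerivAt_conj z).fderiv]
  simp

theorem dbar_conj (z : ℂ) : dbar (fun w => (starRingEnd ℂ) w) z = 1 := by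
  simp only [dbar, (hasFDerivAt_conj z).fderiv]
  simp
  norm_num

theorem dz_conj_comp {f : ℂ → ℂ} {z : ℂ} (hf : DifferentiableAt ℝ f z) :
    dz (fun w => (starRingEnd ℂ) (f w)) z = (starRingEnd ℂ) (dbar f z) := by
  have h := ((hasFDerivAt_conj (f z)).comp z hf.hasFDerivAt).fderiv
  simp only [dz, dbar]
  have h' : fderiv ℝ (fun w => (starRingEnd ℂ) (f w)) z
    = (Complex.conjCLE : ℂ →L[ℝ] ℂ).comp (fderiv ℝ f z) := h
  rw [h']
  simp [map_ofNat]
  ring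

theorem dbar_conj_comp {f : ℂ → ℂ} {z : ℂ} (hf : DifferentiableAt ℝ f z) :
    dbar (fun w => (starRingEnd ℂ) (f w)) z = (starRingEnd ℂ) (dz f z) := by
  have h := ((hasFDerivAt_conj (f z)).comp z hf.hasFDerivAt).fderiv
  simp only [dz, dbar]
  have h' : fderiv ℝ (fun w => (starRingEnd ℂ) (f w)) z
    = (Complex.conjCLE : ℂ →L[ℝ] ℂ).comp (fderiv ℝ f z) := h
  rw [h']
  simp [map_ofNat]

theorem dbar_conj_pow (m : ℕ) (z : ℂ) :
    dbar (fun w => (starRingEnd ℂ) w ^ m) z = m * (starRingEnd ℂ) z ^ (m - 1) := by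
  induction m with
  | zero => simpa using dbar_of_hasDerivAt (hasDerivAt_const z (1 : ℂ))
  | succ m ih =>
    have h := dbar_mul (f := fun w => (starRingEnd ℂ) w ^ m) (g := fun w => (starRingEnd ℂ) w)
      (z := z) (smooth_differentiable (smooth_conj.pow m) z) (smooth_differentiable smooth_conj z)
    simp only [← pow_succ] at h
    rw [h, ih, dbar_conj]
    cases m with
    | zero => simp
    | succ m => simp; ring

theorem dz_conj_pow (m : ℕ) (z : ℂ) : dz (fun w => (starRingEnd ℂ) w ^ m) z = 0 := by
  induction m with
  | zero => simpa using dz_of_hasDerivAt (hasDerivAt_const z (1 : ℂ))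
  | succ m ih =>
    have h := dz_mul (f := fun w => (starRingEnd ℂ) w ^ m) (g := fun w => (starRingEnd ℂ) w)
      (z := z) (smooth_differentiable (smooth_conj.pow m) z) (smooth_differentiable smooth_conj z)
    simp only [← pow_succ] at h
    rw [h, ih, dz_conj]
    simp

/-- Both sides are combinations of second derivatives; symmetry of the second derivative makes the
mixed terms agree. -/
theorem dz_dbar_comm {Ψ : ℂ → ℂ} (h : ContDiff ℝ ∞ Ψ) : dz (dbar Ψ) = dbar (dz Ψ) := by
  funext z
  have h' : ContDiff ℝ ∞ (fderiv ℝ Ψ) := h.fderiv_right (by simp)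
  have hd : DifferentiableAt ℝ (fderiv ℝ Ψ) z := (h'.differentiable (by simp)) z
  have e : ∀ v u : ℂ, fderiv ℝ (fun w => fderiv ℝ Ψ w v) z u = fderiv ℝ (fderiv ℝ Ψ) z u v := by
    intro v u
    rw [fderiv_clm_apply hd (differentiableAt_const v)]
    simp
  have d : ∀ v : ℂ, DifferentiableAt ℝ (fun w => fderiv ℝ Ψ w v) z := fun v =>
    hd.clm_apply (differentiableAt_const v)
  have sym : ∀ u v : ℂ, fderiv ℝ (fderiv ℝ Ψ) z u v = fderiv ℝ (fderiv ℝ Ψ) z v u := fun u v =>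
    (h.contDiffAt (x := z)).isSymmSndFDerivAt
      (by simp only [minSmoothness_of_isRCLikeNormedField]; exact (WithTop.coe_le_coe.2 le_top : ((2 : ℕ∞) : WithTop ℕ∞) ≤ _)) u v
  have e1 : ∀ u, fderiv ℝ (dbar Ψ) z u = (1 / 2) * (fderiv ℝ (fderiv ℝ Ψ) z u 1 +
      Complex.I * fderiv ℝ (fderiv ℝ Ψ) z u Complex.I) := by
    intro u
    unfold dbar
    have d1 := d 1
    have d2 := (d Complex.I).const_mul Complex.I
    have d3 : DifferentiableAt ℝ (fun w => fderiv ℝ Ψ w 1 + Complex.I * fderiv ℝ Ψ w Complex.I)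
      z := d1.add d2
    rw [fderiv_const_mul d3,
      fderiv_fun_add d1 d2, fderiv_const_mul (d Complex.I)]
    simp [e]
    ring
  have e2 : ∀ u, fderiv ℝ (dz Ψ) z u = (1 / 2) * (fderiv ℝ (fderiv ℝ Ψ) z u 1 -
      Complex.I * fderiv ℝ (fderiv ℝ Ψ) z u Complex.I) := by
    intro u
    unfold dz
    have d1 := d 1
    have d2 := (d Complex.I).const_mul Complex.I
    have d3 : DifferentiableAt ℝ (fun w => fderiv ℝ Ψ w 1 - Complex.I * fderiv ℝ Ψ w Complex.I)
      z := d1.sub d2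
    rw [fderiv_const_mul d3,
      fderiv_fun_sub d1 d2, fderiv_const_mul (d Complex.I)]
    simp [e]
  rw [dz, dbar, e1, e1, e2, e2, sym 1 Complex.I]
  ring

theorem dbar_linear {Ψ Θ : ℂ → ℂ} (hΨ : ContDiff ℝ ∞ Ψ) (hΘ : ContDiff ℝ ∞ Θ) (c : ℂ) :
    dbar (Ψ + c • Θ) = dbar Ψ + c • dbar Θ := dbar_iter_lin hΨ hΘ c 1

theorem creation_linear {Ψ Θ : ℂ → ℂ} (hΨ : ContDiff ℝ ∞ Ψ) (hΘ : ContDiff ℝ ∞ Θ) (c : ℂ) :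
    creation (Ψ + c • Θ) = creation Ψ + c • creation Θ := creation_iter_lin hΨ hΘ c 1

theorem creation_iter_smul {Θ : ℂ → ℂ} (hΘ : ContDiff ℝ ∞ Θ) (c : ℂ) (k : ℕ) :
    creation^[k] (c • Θ) = c • creation^[k] Θ := by
  have h := creation_iter_lin (Ψ := 0) contDiff_const hΘ c k
  rwa [zero_add, creation_iter_zero, zero_add] at h

theorem dbar_iter_smul {Θ : ℂ → ℂ} (hΘ : ContDiff ℝ ∞ Θ) (c : ℂ) (k : ℕ) :
    dbar^[k] (c • Θ) = c • dbar^[k] Θ := by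
  have h := dbar_iter_lin (Ψ := 0) contDiff_const hΘ c k
  rwa [zero_add, dbar_iter_zero, zero_add] at h

theorem creation_iter_smooth {Ψ : ℂ → ℂ} (h : ContDiff ℝ ∞ Ψ) (k : ℕ) :
    ContDiff ℝ ∞ (creation^[k] Ψ) := by
  induction k with
  | zero => exact h
  | succ k ih => rw [Function.iterate_succ_apply']; exact creation_smooth ih

theorem dbar_iter_smooth {Ψ : ℂ → ℂ} (h : ContDiff ℝ ∞ Ψ) (k : ℕ) :
    ContDiff ℝ ∞ (dbar^[k] Ψ) := by
  induction k with
  | zero => exact h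
  | succ k ih => rw [Function.iterate_succ_apply']; exact dbar_smooth ih

theorem sqrt_pi_ne : (Real.sqrt Real.pi : ℂ) ≠ 0 := by
  have := Real.sqrt_pos.2 Real.pi_pos
  exact_mod_cast this.ne'

theorem sqrt_pi_mul : (Real.sqrt Real.pi : ℂ) * (Real.sqrt Real.pi : ℂ) = (Real.pi : ℂ) := by
  exact_mod_cast Real.mul_self_sqrt Real.pi_pos.le

/-- The commutation relation `[∂_{z̄}, Z̄†] = √π`. -/
theorem dbar_creation {Ψ : ℂ → ℂ} (h : ContDiff ℝ ∞ Ψ) :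
    dbar (creation Ψ) = creation (dbar Ψ) + (Real.sqrt Real.pi : ℂ) • Ψ := by
  have hc : ContDiff ℝ ∞ (fun z => (starRingEnd ℂ) z * Ψ z) := smooth_conj.mul h
  have e : creation Ψ = (Real.sqrt Real.pi : ℂ) • (fun z => (starRingEnd ℂ) z * Ψ z)
      + (-(1 / (Real.sqrt Real.pi : ℂ))) • dz Ψ := by
    funext z
    simp only [creation, Pi.add_apply, Pi.smul_apply, smul_eq_mul]
    ring
  rw [e, dbar_linear (smooth_smul hc _) (dz_smooth h)]
  have e2 := dbar_iter_smul hc (Real.sqrt Real.pi : ℂ) 1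
  simp only [Function.iterate_one] at e2
  rw [e2, ← dz_dbar_comm h]
  funext z
  simp only [creation, Pi.add_apply, Pi.smul_apply, smul_eq_mul]
  rw [dbar_mul (smooth_differentiable smooth_conj z) (smooth_differentiable h z), dbar_conj]
  ring

/-- The commutator of ∂_{z̄} with Z̄† is a scalar and ∂_{z̄} annihilates Φ, so each of the k factors
contributes √π. For k = 0 the truncated exponent is harmless because the coefficient vanishes. -/
theorem dbar_creation_iter {Φ : ℂ → ℂ} (h : Differentiable ℂ Φ) (k : ℕ) :
    dbar (creation^[k] Φ) = ((k : ℂ) * (Real.sqrt Real.pi : ℂ)) • creation^[k - 1] Φ := by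
  have hs := smooth_of_entire h
  induction k with
  | zero => simp [dbar_entire h]
  | succ k ih =>
    rw [Function.iterate_succ_apply', dbar_creation (creation_iter_smooth hs k), ih]
    have e2 := creation_iter_smul (creation_iter_smooth hs (k - 1))
      ((k : ℂ) * (Real.sqrt Real.pi : ℂ)) 1
    simp only [Function.iterate_one] at e2
    rw [e2, ← Function.iterate_succ_apply' creation]
    cases k with
    | zero => simp
    | succ k =>
      simp only [Nat.succ_eq_add_one, Nat.add_sub_cancel]
      rw [← add_smul]
      congr 1
      push_cast
      ring

/-- This is what recovers the entire function Φ from (Z̄†)ᵏΦ, both in the decomposition of 𝐅ⁿ and in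
the norm estimates. -/
theorem dbar_iter_creation_iter {Φ : ℂ → ℂ} (h : Differentiable ℂ Φ) (k : ℕ) :
    dbar^[k] (creation^[k] Φ) =
      ((k.factorial : ℂ) * (Real.sqrt Real.pi : ℂ) ^ k) • Φ := by
  induction k with
  | zero => simp
  | succ k ih =>
    rw [Function.iterate_succ_apply, dbar_creation_iter h]
    simp only [Nat.add_sub_cancel]
    rw [dbar_iter_smul (creation_iter_smooth (smooth_of_entire h) k), ih, smul_smul]
    congr 1
    rw [Nat.factorial_succ]
    push_cast
    ring

theorem dbar_iter_creation_iter_zero {Φ : ℂ → ℂ} (h : Differentiable ℂ Φ) {k m : ℕ}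
    (hm : k < m) : dbar^[m] (creation^[k] Φ) = 0 := by
  obtain ⟨r, rfl⟩ := Nat.exists_eq_add_of_lt hm
  rw [show k + r + 1 = r + (1 + k) by ring, Function.iterate_add_apply,
    Function.iterate_add_apply dbar 1, dbar_iter_creation_iter h, Function.iterate_one]
  have e := dbar_iter_smul (smooth_of_entire h) ((k.factorial : ℂ) * (Real.sqrt Real.pi : ℂ) ^ k) 1
  simp only [Function.iterate_one] at e
  rw [e, dbar_entire h, smul_zero, dbar_iter_zero]

/-- The weighted translation `(W_z Ψ)(w) = Ψ(z + w) e^{-π w z̄}`. -/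
noncomputable def weylShift (z : ℂ) (Ψ : ℂ → ℂ) (w : ℂ) : ℂ :=
  Ψ (z + w) * Complex.exp (-(Real.pi : ℂ) * w * (starRingEnd ℂ) z)

theorem hasDerivAt_weylFactor (z w : ℂ) :
    HasDerivAt (fun w : ℂ => Complex.exp (-(Real.pi : ℂ) * w * (starRingEnd ℂ) z))
      (-(Real.pi : ℂ) * (starRingEnd ℂ) z *
        Complex.exp (-(Real.pi : ℂ) * w * (starRingEnd ℂ) z)) w := by
  have h : HasDerivAt (fun w : ℂ => -(Real.pi : ℂ) * w * (starRingEnd ℂ) z)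
      (-(Real.pi : ℂ) * 1 * (starRingEnd ℂ) z) w :=
    ((hasDerivAt_id w).const_mul _).mul_const _
  exact h.cexp.congr_deriv (by ring)

theorem weylShift_smooth {Ψ : ℂ → ℂ} (h : ContDiff ℝ ∞ Ψ) (z : ℂ) :
    ContDiff ℝ ∞ (weylShift z Ψ) := by
  have h1 : ContDiff ℝ ∞ (fun w : ℂ => Complex.exp (-(Real.pi : ℂ) * w * (starRingEnd ℂ) z)) :=
    smooth_of_entire fun w => (hasDerivAt_weylFactor z w).differentiableAt
  exact (h.comp (contDiff_const.add contDiff_id)).mul h1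

theorem weylShift_entire {Φ : ℂ → ℂ} (h : Differentiable ℂ Φ) (z : ℂ) :
    Differentiable ℂ (weylShift z Φ) := by
  intro w
  refine DifferentiableAt.mul ?_ (hasDerivAt_weylFactor z w).differentiableAt
  exact (h (z + w)).comp w ((differentiableAt_const z).add differentiableAt_id)

theorem dz_comp_const_add (Ψ : ℂ → ℂ) (z w : ℂ) : dz (fun u => Ψ (z + u)) w = dz Ψ (z + w) := by
  simp only [dz, fderiv_comp_add_left]

theorem dbar_comp_const_add (Ψ : ℂ → ℂ) (z w : ℂ) :
    dbar (fun u => Ψ (z + u)) w = dbar Ψ (z + w) := by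
  simp only [dbar, fderiv_comp_add_left]

/-- The factor e^{-πwz̄} is holomorphic in w. -/
theorem dbar_weylShift {Ψ : ℂ → ℂ} (h : ContDiff ℝ ∞ Ψ) (z : ℂ) :
    dbar (weylShift z Ψ) = weylShift z (dbar Ψ) := by
  funext w
  have h1 : DifferentiableAt ℝ (fun u => Ψ (z + u)) w :=
    smooth_differentiable (h.comp (contDiff_const.add contDiff_id)) w
  have h2 := hasDerivAt_weylFactor z w
  have e := dbar_mul h1 (h2.differentiableAt.restrictScalars ℝ)
  rw [dbar_of_hasDerivAt h2, dbar_comp_const_add] at e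
  simp only [mul_zero, add_zero] at e
  exact e

/-- The twist e^{-πwz̄} is there for this identity: its ∂_w derivative contributes √π z̄, which is
the difference between the conjugates of z + w and w in the multiplication term. -/
theorem creation_weylShift {Ψ : ℂ → ℂ} (h : ContDiff ℝ ∞ Ψ) (z : ℂ) :
    creation (weylShift z Ψ) = weylShift z (creation Ψ) := by
  funext w
  have h1 : DifferentiableAt ℝ (fun u => Ψ (z + u)) w :=
    smooth_differentiable (h.comp (contDiff_const.add contDiff_id)) w
  have h2 := hasDerivAt_weylFactor z w
  have e := dz_mul h1 (h2.differentiableAt.restrictScalars ℝ)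
  rw [dz_of_hasDerivAt h2, dz_comp_const_add] at e
  have e' : dz (weylShift z Ψ) w = _ := e
  simp only [creation]
  rw [e']
  simp only [weylShift, creation, map_add]
  have h3 := sqrt_pi_mul
  have h4 := sqrt_pi_ne
  rw [← h3]
  field_simp
  ring

theorem creation_iter_weylShift {Ψ : ℂ → ℂ} (h : ContDiff ℝ ∞ Ψ) (z : ℂ) (k : ℕ) :
    creation^[k] (weylShift z Ψ) = weylShift z (creation^[k] Ψ) := by
  induction k with
  | zero => rfl
  | succ k ih =>
    rw [Function.iterate_succ_apply', ih, creation_weylShift (creation_iter_smooth h k),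
      ← Function.iterate_succ_apply' creation]

theorem dbar_iter_weylShift {Ψ : ℂ → ℂ} (h : ContDiff ℝ ∞ Ψ) (z : ℂ) (k : ℕ) :
    dbar^[k] (weylShift z Ψ) = weylShift z (dbar^[k] Ψ) := by
  induction k with
  | zero => rfl
  | succ k ih =>
    rw [Function.iterate_succ_apply', ih, dbar_weylShift (dbar_iter_smooth h k),
      ← Function.iterate_succ_apply' dbar]

/-- Applied to w̄ᵐg, the operator Z̄† either raises m or differentiates g. The power of w̄ never
drops, so at 0 only the term that always differentiates survives. Carrying general m makes the
induction close. -/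
theorem creation_iter_at_zero_aux (j : ℕ) : ∀ (m : ℕ) (g : ℂ → ℂ), Differentiable ℂ g →
    creation^[j] (fun w => (starRingEnd ℂ) w ^ m * g w) 0 =
      if m = 0 then (-(1 / (Real.sqrt Real.pi : ℂ))) ^ j * iteratedDeriv j g 0 else 0 := by
  induction j with
  | zero =>
    intro m g hg
    rcases Nat.eq_zero_or_pos m with rfl | hm
    · simp
    · simp [hm.ne']
  | succ j ih =>
    intro m g hg
    have hg' : Differentiable ℂ (deriv g) := (hg.contDiff (n := 2)).differentiable_deriv_two
    have e : creation (fun w => (starRingEnd ℂ) w ^ m * g w) =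
        (Real.sqrt Real.pi : ℂ) • (fun w => (starRingEnd ℂ) w ^ (m + 1) * g w) +
        (-(1 / (Real.sqrt Real.pi : ℂ))) • (fun w => (starRingEnd ℂ) w ^ m * deriv g w) := by
      funext w
      simp only [creation, Pi.add_apply, Pi.smul_apply, smul_eq_mul]
      rw [dz_mul (smooth_differentiable (smooth_conj.pow m) w)
        (smooth_differentiable (smooth_of_entire hg) w), dz_conj_pow,
        dz_of_hasDerivAt (hg w).hasDerivAt]
      ring
    have s1 : ContDiff ℝ ∞ (fun w => (starRingEnd ℂ) w ^ (m + 1) * g w) :=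
      (smooth_conj.pow _).mul (smooth_of_entire hg)
    have s2 : ContDiff ℝ ∞ (fun w => (starRingEnd ℂ) w ^ m * deriv g w) :=
      (smooth_conj.pow _).mul (smooth_of_entire hg')
    rw [Function.iterate_succ_apply, e, creation_iter_lin (smooth_smul s1 _) s2,
      creation_iter_smul s1]
    simp only [Pi.add_apply, Pi.smul_apply, smul_eq_mul]
    rw [ih (m + 1) g hg, ih m _ hg', iteratedDeriv_succ']
    have h1 : m + 1 ≠ 0 := Nat.succ_ne_zero m
    rw [if_neg h1]
    split_ifs
    · rw [pow_succ]; ring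
    · ring

theorem creation_iter_at_zero {g : ℂ → ℂ} (hg : Differentiable ℂ g) (j : ℕ) :
    creation^[j] g 0 = (-(1 / (Real.sqrt Real.pi : ℂ))) ^ j * iteratedDeriv j g 0 := by
  simpa using creation_iter_at_zero_aux j 0 g hg

/-! ### Mean value properties and local estimates -/

theorem integral_rotate (f : ℂ → ℂ) (c : Circle) : ∫ w : ℂ, f ((c : ℂ) * w) = ∫ w, f w := by
  have h := (rotation c).measurePreserving
  have := h.integral_comp (rotation c).toHomeomorph.measurableEmbedding f
  simpa [rotation_apply] using this

theorem circle_mean_value {H : ℂ → ℂ} (hH : Differentiable ℂ H) (w : ℂ) :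
    ∫ θ in (0 : ℝ)..2 * Real.pi, H (circleMap 0 1 θ * w) = 2 * Real.pi * H 0 := by
  have hd : Differentiable ℂ (fun ζ : ℂ => H (ζ * w)) :=
    hH.comp (differentiable_id.mul_const w)
  have h := (hd.diffContOnCl (s := Metric.ball (0 : ℂ) |1|)).circleAverage
  rw [Real.circleAverage, zero_mul, Complex.real_smul] at h
  have hp : (Real.pi : ℂ) ≠ 0 := by exact_mod_cast Real.pi_pos.ne'
  rw [← h]
  set J := ∫ θ in (0 : ℝ)..2 * Real.pi, H (circleMap 0 1 θ * w)
  push_cast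
  field_simp

/-- Rotating the variable leaves the integral unchanged. Averaging over all rotations and exchanging
integrals replaces H(w) by its mean over a circle, which is H(0). The hypothesis `hb` compares
points of equal modulus so that one majorant serves all rotations. -/
theorem integral_radial_mul_entire {H : ℂ → ℂ} (hH : Differentiable ℂ H) {ρ : ℝ → ℝ}
    (hρ : Measurable ρ) {m : ℂ → ℝ} (hm : Integrable m)
    (hb : ∀ w u : ℂ, ‖u‖ = ‖w‖ → ‖ρ ‖w‖‖ * ‖H u‖ ≤ m w) :
    ∫ w : ℂ, (ρ ‖w‖ : ℂ) * H w = (∫ w : ℂ, (ρ ‖w‖ : ℂ)) * H 0 := by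
  have hcirc : ∀ θ : ℝ, ‖circleMap 0 1 θ‖ = 1 := fun θ => by simp
  have hpi : (0 : ℝ) ≤ 2 * Real.pi := by positivity
  have hrot : ∀ θ : ℝ, ∫ w : ℂ, (ρ ‖w‖ : ℂ) * H (circleMap 0 1 θ * w) =
      ∫ w : ℂ, (ρ ‖w‖ : ℂ) * H w := by
    intro θ
    have := integral_rotate (fun w => (ρ ‖w‖ : ℂ) * H w) (Circle.exp θ)
    simpa [circleMap] using this
  have hmeas : Measurable (fun x : ℝ × ℂ => (ρ ‖x.2‖ : ℂ) * H (circleMap 0 1 x.1 * x.2)) := by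
    have h1 : Measurable (fun x : ℝ × ℂ => (ρ ‖x.2‖ : ℂ)) :=
      Complex.measurable_ofReal.comp (hρ.comp measurable_snd.norm)
    have h2 : Continuous (fun x : ℝ × ℂ => H (circleMap 0 1 x.1 * x.2)) :=
      hH.continuous.comp (((continuous_circleMap 0 1).comp continuous_fst).mul continuous_snd)
    exact h1.mul h2.measurable
  have hint : Integrable (fun x : ℝ × ℂ => (ρ ‖x.2‖ : ℂ) * H (circleMap 0 1 x.1 * x.2))
      ((volume.restrict (Set.Ioc 0 (2 * Real.pi))).prod volume) := by
    refine (hm.comp_snd (volume.restrict (Set.Ioc 0 (2 * Real.pi)))).mono'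
      hmeas.aestronglyMeasurable (Filter.Eventually.of_forall fun x => ?_)
    rw [norm_mul, Complex.norm_real]
    exact hb _ _ (by simp)
  have hswap := integral_integral_swap
    (f := fun (θ : ℝ) (w : ℂ) => (ρ ‖w‖ : ℂ) * H (circleMap 0 1 θ * w)) hint
  simp only [hrot] at hswap
  have e1 : ∀ w : ℂ, ∫ θ in Set.Ioc 0 (2 * Real.pi), (ρ ‖w‖ : ℂ) * H (circleMap 0 1 θ * w) =
      (2 * Real.pi) * ((ρ ‖w‖ : ℂ) * H 0) := by
    intro w
    rw [integral_const_mul, ← intervalIntegral.integral_of_le hpi, circle_mean_value hH w]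
    ring
  simp only [e1] at hswap
  rw [integral_const, integral_const_mul, integral_mul_const] at hswap
  simp only [measureReal_restrict_apply_univ, Real.volume_real_Ioc_of_le hpi, sub_zero,
    Complex.real_smul] at hswap
  have hp : ((2 * Real.pi : ℝ) : ℂ) ≠ 0 := by
    exact_mod_cast (by positivity : (2 * Real.pi : ℝ) ≠ 0)
  push_cast at hswap hp
  exact mul_left_cancel₀ hp hswap

theorem integral_ball_radial {H : ℂ → ℂ} (hH : Differentiable ℂ H) (r : ℝ) {ρ : ℝ → ℝ}
    (hρ : Continuous ρ) :
    ∫ w in Metric.ball (0 : ℂ) r, (ρ ‖w‖ : ℂ) * H w =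
      (∫ w in Metric.ball (0 : ℂ) r, (ρ ‖w‖ : ℂ)) * H 0 := by
  obtain ⟨C, hC⟩ := (isCompact_closedBall (0 : ℂ) r).exists_bound_of_continuousOn
    hH.continuous.continuousOn
  have hcont : Continuous (fun w : ℂ => ‖ρ ‖w‖‖ * C) := (hρ.comp continuous_norm).norm.mul_const C
  have hm : Integrable ((Metric.ball (0 : ℂ) r).indicator (fun w => ‖ρ ‖w‖‖ * C)) := by
    rw [integrable_indicator_iff measurableSet_ball]
    exact (hcont.continuousOn.integrableOn_compact (isCompact_closedBall (0 : ℂ) r)).mono_set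
      Metric.ball_subset_closedBall
  have h := integral_radial_mul_entire hH (ρ := (Set.Iio r).indicator ρ)
    (hρ.measurable.indicator measurableSet_Iio) hm (by
      intro w u hu
      by_cases hw : ‖w‖ < r
      · have h1 : w ∈ Metric.ball (0 : ℂ) r := by simpa using hw
        rw [Set.indicator_of_mem h1, Set.indicator_of_mem (show ‖w‖ ∈ Set.Iio r from hw)]
        exact mul_le_mul_of_nonneg_left (hC u (by simpa [hu] using hw.le)) (norm_nonneg _)
      · have h1 : w ∉ Metric.ball (0 : ℂ) r := by simpa using hw
        rw [Set.indicator_of_notMem h1, Set.indicator_of_notMem (show ‖w‖ ∉ Set.Iio r from hw)]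
        simp)
  have e : ∀ G : ℂ → ℂ, ∫ w in Metric.ball (0 : ℂ) r, (ρ ‖w‖ : ℂ) * G w =
      ∫ w : ℂ, (((Set.Iio r).indicator ρ ‖w‖ : ℝ) : ℂ) * G w := by
    intro G
    rw [← integral_indicator measurableSet_ball]
    congr 1
    funext w
    by_cases hw : ‖w‖ < r
    · have h1 : w ∈ Metric.ball (0 : ℂ) r := by simpa using hw
      rw [Set.indicator_of_mem h1, Set.indicator_of_mem (show ‖w‖ ∈ Set.Iio r from hw)]
    · have h1 : w ∉ Metric.ball (0 : ℂ) r := by simpa using hw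
      rw [Set.indicator_of_notMem h1, Set.indicator_of_notMem (show ‖w‖ ∉ Set.Iio r from hw)]
      simp
  have e1 := e (fun _ => 1)
  simp only [mul_one] at e1
  rw [e, e1, h]

theorem integrableOn_ball {E : Type*} [NormedAddCommGroup E] {f : ℂ → E} (hf : Continuous f) (z : ℂ) (r : ℝ) :
    IntegrableOn f (Metric.ball z r) :=
  (hf.continuousOn.integrableOn_compact (isCompact_closedBall z r)).mono_set
    Metric.ball_subset_closedBall

theorem setIntegral_ball_translate {E : Type*} [NormedAddCommGroup E] [NormedSpace ℝ E]
    (f : ℂ → E) (z : ℂ) (r : ℝ) :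
    ∫ u in Metric.ball (0 : ℂ) r, f (z + u) = ∫ u in Metric.ball z r, f u := by
  have h := (measurePreserving_add_left (volume : Measure ℂ) z).setIntegral_preimage_emb
    (measurableEmbedding_addLeft z) f (Metric.ball z r)
  rw [← h]
  congr 3
  ext u
  simp

theorem norm_le_integral_ball {g : ℂ → ℂ} (hg : Differentiable ℂ g) (w : ℂ) (r : ℝ) :
    volume.real (Metric.ball (0 : ℂ) r) * ‖g w‖ ≤ ∫ u in Metric.ball w r, ‖g u‖ := by
  have hd : Differentiable ℂ (fun u => g (w + u)) :=
    hg.comp ((differentiable_const w).add differentiable_id)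
  have h := integral_ball_radial hd r (ρ := fun _ => 1) continuous_const
  simp only [Complex.ofReal_one, one_mul, add_zero] at h
  rw [setIntegral_ball_translate] at h
  have h2 := norm_integral_le_integral_norm (μ := volume.restrict (Metric.ball w r)) g
  rw [h] at h2
  rwa [integral_const, measureReal_restrict_apply_univ, norm_mul, Complex.real_smul, mul_one,
    Complex.norm_real, Real.norm_of_nonneg measureReal_nonneg] at h2

theorem iteratedDeriv_le_integral_ball (j : ℕ) : ∃ C : ℝ, 0 ≤ C ∧ ∀ g : ℂ → ℂ,
    Differentiable ℂ g → ‖iteratedDeriv j g 0‖ ≤ C * ∫ u in Metric.ball (0 : ℂ) 1, ‖g u‖ := by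
  have hv : 0 < volume.real (Metric.ball (0 : ℂ) (1 / 2)) :=
    ENNReal.toReal_pos (Metric.measure_ball_pos _ _ (by norm_num)).ne' measure_ball_lt_top.ne
  refine ⟨j.factorial * (volume.real (Metric.ball (0 : ℂ) (1 / 2)))⁻¹ / (1 / 2) ^ j,
    by positivity, fun g hg => ?_⟩
  have hI : IntegrableOn (fun u => ‖g u‖) (Metric.ball (0 : ℂ) 1) :=
    (integrableOn_ball hg.continuous 0 1).norm
  -- Discs of radius 1/2 centred on the circle of radius 1/2 stay inside the unit disc, so the mean
  -- value bound on them feeds the Cauchy estimate on that circle.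
  have hs : ∀ w ∈ Metric.sphere (0 : ℂ) (1 / 2), ‖g w‖ ≤
      (volume.real (Metric.ball (0 : ℂ) (1 / 2)))⁻¹ * ∫ u in Metric.ball (0 : ℂ) 1, ‖g u‖ := by
    intro w hw
    rw [le_inv_mul_iff₀ hv]
    refine (norm_le_integral_ball hg w (1 / 2)).trans ?_
    refine setIntegral_mono_set hI (Filter.Eventually.of_forall fun u => norm_nonneg _) ?_
    refine Filter.Eventually.of_forall (Metric.ball_subset_ball' ?_)
    rw [mem_sphere_iff_norm] at hw
    rw [dist_eq_norm, hw]
    norm_num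
  refine (Complex.norm_iteratedDeriv_le_of_forall_mem_sphere_norm_le j (by norm_num : (0:ℝ) < 1 / 2)
    hg.diffContOnCl hs).trans (le_of_eq ?_)
  ring

/-! ### Moments of polyanalytic functions over the unit disc -/

/-- Here w̄ᵐwᵏ = |w|^{2m}w^{k-m}, a radial factor times a holomorphic one. The right side vanishes
for k > m, and for k = m the convention 0⁰ = 1 retains φ(0). -/
theorem integral_ball_conj_pow {φ : ℂ → ℂ} (hφ : Differentiable ℂ φ) {m k : ℕ} (hk : m ≤ k) :
    ∫ w in Metric.ball (0 : ℂ) 1, (starRingEnd ℂ) w ^ m * φ w * w ^ k =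
      (∫ w in Metric.ball (0 : ℂ) 1, ((‖w‖ ^ (2 * m) : ℝ) : ℂ)) * ((0 : ℂ) ^ (k - m) * φ 0) := by
  have hd : Differentiable ℂ (fun w : ℂ => w ^ (k - m) * φ w) :=
    (differentiable_id.pow (k - m)).mul hφ
  rw [← integral_ball_radial hd 1 (ρ := fun t => t ^ (2 * m)) (by fun_prop)]
  congr 1
  funext w
  have h1 : ((‖w‖ ^ (2 * m) : ℝ) : ℂ) = (starRingEnd ℂ) w ^ m * w ^ m := by
    rw [← mul_pow, ← Complex.normSq_eq_conj_mul_self, Complex.normSq_eq_norm_sq, pow_mul]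
    push_cast
    ring
  rw [h1]
  obtain ⟨r, rfl⟩ := Nat.exists_eq_add_of_le hk
  simp only [Nat.add_sub_cancel_left]
  rw [pow_add]
  ring

theorem dbar_iter_conj_pow_mul {φ : ℂ → ℂ} (hφ : Differentiable ℂ φ) (m : ℕ) :
    dbar^[m] (fun w => (starRingEnd ℂ) w ^ m * φ w) = (m.factorial : ℂ) • φ := by
  induction m with
  | zero => simp
  | succ m ih =>
    have e : dbar (fun w => (starRingEnd ℂ) w ^ (m + 1) * φ w) =
        ((m + 1 : ℕ) : ℂ) • fun w => (starRingEnd ℂ) w ^ m * φ w := by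
      funext w
      rw [dbar_mul (smooth_differentiable (smooth_conj.pow (m + 1)) w)
        (smooth_differentiable (smooth_of_entire hφ) w), dbar_conj_pow, dbar_entire hφ]
      simp
      ring
    rw [Function.iterate_succ_apply, e,
      dbar_iter_smul ((smooth_conj.pow m).mul (smooth_of_entire hφ)), ih, smul_smul,
      Nat.factorial_succ]
    push_cast
    rfl

/-- Splitting off the top coefficient of a polyanalytic function. -/
theorem polyanalytic_split {n : ℕ} {σ : ℂ → ℂ} (hσ : ContDiff ℝ ∞ σ)
    (h : dbar^[n + 1] σ = 0) :
    Differentiable ℂ (dbar^[n] σ) ∧ ∃ τ : ℂ → ℂ, ContDiff ℝ ∞ τ ∧ dbar^[n] τ = 0 ∧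
      ∀ w, σ w = τ w + (1 / (n.factorial : ℂ)) * ((starRingEnd ℂ) w ^ n * dbar^[n] σ w) := by
  have hd : Differentiable ℂ (dbar^[n] σ) :=
    entire_of_dbar (dbar_iter_smooth hσ n) (by rw [← Function.iterate_succ_apply' dbar, h])
  have hs : ContDiff ℝ ∞ (fun w => (starRingEnd ℂ) w ^ n * dbar^[n] σ w) :=
    (smooth_conj.pow n).mul (smooth_of_entire hd)
  refine ⟨hd, σ + (-(1 / (n.factorial : ℂ))) • (fun w => (starRingEnd ℂ) w ^ n * dbar^[n] σ w),
    hσ.add (smooth_smul hs _), ?_, ?_⟩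
  · have hf : (n.factorial : ℂ) ≠ 0 := by exact_mod_cast n.factorial_ne_zero
    rw [dbar_iter_lin hσ hs, dbar_iter_conj_pow_mul hd, smul_smul]
    funext w
    simp [hf]
  · intro w
    simp

/-- In σ = ∑_{m<n} w̄ᵐφ_m with φ_m entire, every exponent m is below k, so each moment vanishes. The
induction removes one coefficient at a time. -/
theorem integral_ball_polyanalytic_eq_zero (n : ℕ) : ∀ σ : ℂ → ℂ, ContDiff ℝ ∞ σ →
    dbar^[n] σ = 0 → ∀ k, n ≤ k → ∫ w in Metric.ball (0 : ℂ) 1, σ w * w ^ k = 0 := by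
  induction n with
  | zero =>
    intro σ _ h k _
    simp only [Function.iterate_zero, id] at h
    simp [h]
  | succ n ih =>
    intro σ hσ h k hk
    obtain ⟨hd, τ, hτ, hτ0, hsum⟩ := polyanalytic_split hσ h
    have e : ∀ w, σ w * w ^ k = τ w * w ^ k +
        (1 / (n.factorial : ℂ)) * ((starRingEnd ℂ) w ^ n * dbar^[n] σ w * w ^ k) := by
      intro w; rw [hsum w]; ring
    have c1 : Continuous (fun w => τ w * w ^ k) := hτ.continuous.mul (continuous_id.pow k)
    have c2 : Continuous (fun w : ℂ => (starRingEnd ℂ) w ^ n * dbar^[n] σ w * w ^ k) :=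
      ((smooth_conj.pow n).continuous.mul hd.continuous).mul (continuous_id.pow k)
    simp only [e]
    rw [integral_add (integrableOn_ball c1 0 1)
      ((integrableOn_ball c2 0 1).const_mul _), integral_const_mul,
      ih τ hτ hτ0 k (by omega), integral_ball_conj_pow hd (by omega), zero_pow (by omega)]
    simp

/-- Testing σ against wⁿ over the disc kills all lower coefficients and leaves a positive multiple
of ∂_{z̄}ⁿσ(0). This bounds a derivative by the size of σ itself. -/
theorem dbar_iter_le_integral_ball (n : ℕ) : ∃ C : ℝ, 0 ≤ C ∧ ∀ σ : ℂ → ℂ, ContDiff ℝ ∞ σ →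
    dbar^[n + 1] σ = 0 → ‖dbar^[n] σ 0‖ ≤ C * ∫ u in Metric.ball (0 : ℂ) 1, ‖σ u‖ := by
  set I : ℝ := ∫ w in Metric.ball (0 : ℂ) 1, ‖w‖ ^ (2 * n) with hI
  have hIpos : 0 < I := by
    rw [hI, setIntegral_pos_iff_support_of_nonneg_ae
      (Filter.Eventually.of_forall fun w => by positivity)]
    · have : Metric.ball (0 : ℂ) 1 \ {0} ⊆
          Function.support (fun w : ℂ => ‖w‖ ^ (2 * n)) ∩ Metric.ball (0 : ℂ) 1 := by
        rintro w ⟨h1, h2⟩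
        exact ⟨pow_ne_zero _ (norm_ne_zero_iff.2 h2), h1⟩
      refine lt_of_lt_of_le ?_ (measure_mono this)
      rw [measure_sdiff_null (by simp)]
      exact Metric.measure_ball_pos _ _ one_pos
    · exact ((by fun_prop : Continuous fun w : ℂ => ‖w‖ ^ (2 * n)).continuousOn.integrableOn_compact
        (isCompact_closedBall (0 : ℂ) 1)).mono_set Metric.ball_subset_closedBall
  refine ⟨n.factorial * I⁻¹, by positivity, fun σ hσ h => ?_⟩
  obtain ⟨hd, τ, hτ, hτ0, hsum⟩ := polyanalytic_split hσ h
  have e : ∀ w, σ w * w ^ n = τ w * w ^ n +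
      (1 / (n.factorial : ℂ)) * ((starRingEnd ℂ) w ^ n * dbar^[n] σ w * w ^ n) := by
    intro w; rw [hsum w]; ring
  have c1 : Continuous (fun w => τ w * w ^ n) := hτ.continuous.mul (continuous_id.pow n)
  have c2 : Continuous (fun w : ℂ => (starRingEnd ℂ) w ^ n * dbar^[n] σ w * w ^ n) :=
    ((smooth_conj.pow n).continuous.mul hd.continuous).mul (continuous_id.pow n)
  have key : ∫ w in Metric.ball (0 : ℂ) 1, σ w * w ^ n =
      (1 / (n.factorial : ℂ)) * (I * dbar^[n] σ 0) := by
    simp only [e]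
    rw [integral_add (integrableOn_ball c1 0 1)
      ((integrableOn_ball c2 0 1).const_mul _), integral_const_mul,
      integral_ball_polyanalytic_eq_zero n τ hτ hτ0 n le_rfl, integral_ball_conj_pow hd le_rfl,
      integral_complex_ofReal]
    simp [hI]
  have hle : ‖∫ w in Metric.ball (0 : ℂ) 1, σ w * w ^ n‖ ≤
      ∫ u in Metric.ball (0 : ℂ) 1, ‖σ u‖ := by
    refine (norm_integral_le_integral_norm _).trans ?_
    refine setIntegral_mono_on (integrableOn_ball (hσ.continuous.mul (continuous_id.pow n)) 0 1).norm
      (integrableOn_ball hσ.continuous 0 1).norm measurableSet_ball fun w hw => ?_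
    rw [norm_mul, norm_pow]
    have : ‖w‖ ≤ 1 := by
      have := mem_ball_zero_iff.1 hw
      exact this.le
    exact mul_le_of_le_one_right (norm_nonneg _) (pow_le_one₀ (norm_nonneg _) this)
  rw [key] at hle
  simp only [norm_mul, norm_div, norm_one, Complex.norm_natCast, Complex.norm_real,
    Real.norm_of_nonneg hIpos.le] at hle
  have hf : (0 : ℝ) < n.factorial := by exact_mod_cast n.factorial_pos
  calc ‖dbar^[n] σ 0‖ = n.factorial * I⁻¹ * (1 / n.factorial * (I * ‖dbar^[n] σ 0‖)) := by
        field_simp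
    _ ≤ _ := by gcongr

/-- The integral of `|F| e^{-(π/2)|·|²}` over the unit disc around `z`. -/
noncomputable def ballMean (F : ℂ → ℂ) (z : ℂ) : ℝ :=
  ∫ u in Metric.ball z 1, ‖F u‖ * Real.exp (-(Real.pi / 2) * ‖u‖ ^ 2)

/-- The cross term in |z + w|² is 2 Re(wz̄), which is what the twist cancels. -/
theorem norm_weylShift (z : ℂ) (F : ℂ → ℂ) (w : ℂ) :
    ‖weylShift z F w‖ = ‖F (z + w)‖ * Real.exp (-(Real.pi / 2) * ‖z + w‖ ^ 2) *
      Real.exp (Real.pi / 2 * ‖w‖ ^ 2) * Real.exp (Real.pi / 2 * ‖z‖ ^ 2) := by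
  rw [weylShift, norm_mul, Complex.norm_exp]
  simp only [mul_assoc]
  rw [← Real.exp_add, ← Real.exp_add]
  congr 2
  simp only [← Complex.normSq_eq_norm_sq, Complex.normSq_apply]
  simp
  ring

theorem integral_ball_weylShift_le {F : ℂ → ℂ} (hF : Continuous F) (z : ℂ) :
    ∫ w in Metric.ball (0 : ℂ) 1, ‖weylShift z F w‖ ≤
      Real.exp (Real.pi / 2) * Real.exp (Real.pi / 2 * ‖z‖ ^ 2) * ballMean F z := by
  rw [ballMean, ← setIntegral_ball_translate
    (fun u => ‖F u‖ * Real.exp (-(Real.pi / 2) * ‖u‖ ^ 2)) z, ← integral_const_mul]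
  have c1 : Continuous (fun w => ‖weylShift z F w‖) := by unfold weylShift; fun_prop
  have c2 : Continuous (fun w => Real.exp (Real.pi / 2) * Real.exp (Real.pi / 2 * ‖z‖ ^ 2) *
    (‖F (z + w)‖ * Real.exp (-(Real.pi / 2) * ‖z + w‖ ^ 2))) := by fun_prop
  refine setIntegral_mono_on (integrableOn_ball c1 0 1) (integrableOn_ball c2 0 1) measurableSet_ball
    fun w hw => ?_
  rw [norm_weylShift]
  have h1 : ‖w‖ ^ 2 ≤ 1 := pow_le_one₀ (norm_nonneg _) (mem_ball_zero_iff.1 hw).le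
  have h2 : Real.exp (Real.pi / 2 * ‖w‖ ^ 2) ≤ Real.exp (Real.pi / 2) := by
    refine Real.exp_le_exp.2 (mul_le_of_le_one_right (by positivity) h1)
  calc _ ≤ ‖F (z + w)‖ * Real.exp (-(Real.pi / 2) * ‖z + w‖ ^ 2) *
      Real.exp (Real.pi / 2) * Real.exp (Real.pi / 2 * ‖z‖ ^ 2) := by gcongr
    _ = _ := by ring

/-- A Weyl translation moves z to the origin, where (Z̄†)ʲ is a multiple of the j-th complex
derivative and Cauchy's estimate applies. The Gaussian weights match, so the constant does not
depend on z. -/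
theorem creation_iter_le_ballMean (j : ℕ) : ∃ C : ℝ, 0 ≤ C ∧ ∀ Φ : ℂ → ℂ, Differentiable ℂ Φ →
    ∀ z, ‖creation^[j] Φ z‖ * Real.exp (-(Real.pi / 2) * ‖z‖ ^ 2) ≤ C * ballMean Φ z := by
  obtain ⟨C, hC, h⟩ := iteratedDeriv_le_integral_ball j
  set d : ℝ := ‖(-(1 / (Real.sqrt Real.pi : ℂ))) ^ j‖ with hd
  refine ⟨d * C * Real.exp (Real.pi / 2), by positivity, fun Φ hΦ z => ?_⟩
  have e : creation^[j] Φ z = creation^[j] (weylShift z Φ) 0 := by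
    rw [creation_iter_weylShift (smooth_of_entire hΦ), weylShift]
    simp
  rw [e, creation_iter_at_zero (weylShift_entire hΦ z), norm_mul, ← hd]
  have h1 := (h _ (weylShift_entire hΦ z)).trans
    (mul_le_mul_of_nonneg_left (integral_ball_weylShift_le hΦ.continuous z) hC)
  calc d * ‖iteratedDeriv j (weylShift z Φ) 0‖ * Real.exp (-(Real.pi / 2) * ‖z‖ ^ 2)
      ≤ d * (C * (Real.exp (Real.pi / 2) * Real.exp (Real.pi / 2 * ‖z‖ ^ 2) * ballMean Φ z)) *
        Real.exp (-(Real.pi / 2) * ‖z‖ ^ 2) := by gcongr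
    _ = d * C * Real.exp (Real.pi / 2) * ballMean Φ z *
        (Real.exp (Real.pi / 2 * ‖z‖ ^ 2) * Real.exp (-(Real.pi / 2) * ‖z‖ ^ 2)) := by ring
    _ = _ := by rw [← Real.exp_add]; simp

theorem dbar_iter_le_ballMean (n : ℕ) : ∃ C : ℝ, 0 ≤ C ∧ ∀ σ : ℂ → ℂ, ContDiff ℝ ∞ σ →
    dbar^[n + 1] σ = 0 →
    ∀ z, ‖dbar^[n] σ z‖ * Real.exp (-(Real.pi / 2) * ‖z‖ ^ 2) ≤ C * ballMean σ z := by
  obtain ⟨C, hC, h⟩ := dbar_iter_le_integral_ball n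
  refine ⟨C * Real.exp (Real.pi / 2), by positivity, fun σ hσ h0 z => ?_⟩
  have e : dbar^[n] σ z = dbar^[n] (weylShift z σ) 0 := by
    rw [dbar_iter_weylShift hσ, weylShift]
    simp
  have h0' : dbar^[n + 1] (weylShift z σ) = 0 := by
    rw [dbar_iter_weylShift hσ, h0]
    funext w
    simp [weylShift]
  rw [e]
  have h1 := (h _ (weylShift_smooth hσ z) h0').trans
    (mul_le_mul_of_nonneg_left (integral_ball_weylShift_le hσ.continuous z) hC)
  calc ‖dbar^[n] (weylShift z σ) 0‖ * Real.exp (-(Real.pi / 2) * ‖z‖ ^ 2)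
      ≤ (C * (Real.exp (Real.pi / 2) * Real.exp (Real.pi / 2 * ‖z‖ ^ 2) * ballMean σ z)) *
        Real.exp (-(Real.pi / 2) * ‖z‖ ^ 2) := by gcongr
    _ = C * Real.exp (Real.pi / 2) * ballMean σ z *
        (Real.exp (Real.pi / 2 * ‖z‖ ^ 2) * Real.exp (-(Real.pi / 2) * ‖z‖ ^ 2)) := by ring
    _ = _ := by rw [← Real.exp_add]; simp

/-! ### The Gaussian measure -/

theorem gaussDensity_measurable :
    Measurable (fun z : ℂ => ENNReal.ofReal (Real.exp (-Real.pi * ‖z‖ ^ 2))) := by fun_prop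

theorem integrable_gauss_iff {E : Type*} [NormedAddCommGroup E] [NormedSpace ℝ E] {g : ℂ → E} :
    Integrable g gaussMeasure ↔
      Integrable (fun z => Real.exp (-Real.pi * ‖z‖ ^ 2) • g z) volume := by
  rw [gaussMeasure, integrable_withDensity_iff_integrable_smul' gaussDensity_measurable
    (Filter.Eventually.of_forall fun z => ENNReal.ofReal_lt_top)]
  simp only [ENNReal.toReal_ofReal (Real.exp_pos _).le]

theorem integral_gauss {E : Type*} [NormedAddCommGroup E] [NormedSpace ℝ E] (g : ℂ → E) :
    ∫ z, g z ∂gaussMeasure = ∫ z, Real.exp (-Real.pi * ‖z‖ ^ 2) • g z := by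
  rw [gaussMeasure, integral_withDensity_eq_integral_toReal_smul gaussDensity_measurable
    (Filter.Eventually.of_forall fun z => ENNReal.ofReal_lt_top)]
  simp only [ENNReal.toReal_ofReal (Real.exp_pos _).le]

theorem exp_half_sq (z : ℂ) : Real.exp (-(Real.pi / 2) * ‖z‖ ^ 2) ^ 2 =
    Real.exp (-Real.pi * ‖z‖ ^ 2) := by
  rw [← Real.exp_nat_mul]
  congr 1
  push_cast
  ring

theorem memLp_gauss_iff {F : ℂ → ℂ} (hF : Continuous F) : MemLp F 2 gaussMeasure ↔
    Integrable (fun z => (‖F z‖ * Real.exp (-(Real.pi / 2) * ‖z‖ ^ 2)) ^ 2) volume := by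
  rw [memLp_two_iff_integrable_sq_norm (hF.aestronglyMeasurable), integrable_gauss_iff]
  simp only [mul_pow, exp_half_sq, smul_eq_mul]
  simp only [mul_comm]

theorem sq_setIntegral_ball_le {v : ℂ → ℝ} (hv : Continuous v) (z : ℂ) :
    (∫ u in Metric.ball z 1, v u) ^ 2 ≤
      volume.real (Metric.ball z 1) * ∫ u in Metric.ball z 1, v u ^ 2 := by
  have hV : 0 < volume.real (Metric.ball z 1) :=
    ENNReal.toReal_pos (Metric.measure_ball_pos _ _ (by norm_num)).ne' measure_ball_lt_top.ne
  set V := volume.real (Metric.ball z 1)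
  set J := ∫ u in Metric.ball z 1, v u with hJ
  -- The Cauchy–Schwarz inequality, obtained from nonnegativity of the variance of v on the disc.
  have h0 : 0 ≤ ∫ u in Metric.ball z 1, (v u - J / V) ^ 2 :=
    integral_nonneg fun u => sq_nonneg _
  have e : ∀ u, (v u - J / V) ^ 2 = v u ^ 2 - (2 * J / V * v u - (J / V) ^ 2) := by
    intro u; ring
  have i1 := integrableOn_ball (hv.pow 2) z 1
  have i2 := (integrableOn_ball hv z 1).const_mul (2 * J / V)
  have i3 : IntegrableOn (fun _ : ℂ => (J / V) ^ 2) (Metric.ball z 1) :=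
    integrableOn_ball continuous_const z 1
  simp only [e] at h0
  have i4 : IntegrableOn (fun u : ℂ => 2 * J / V * v u - (J / V) ^ 2) (Metric.ball z 1) :=
    i2.sub i3
  have i1' : Integrable (fun u : ℂ => v u ^ 2) (volume.restrict (Metric.ball z 1)) := i1
  rw [integral_sub i1' i4, integral_sub i2 i3, integral_const_mul, ← hJ, integral_const,
    measureReal_restrict_apply_univ, smul_eq_mul] at h0
  have h1 : J ^ 2 / V ≤ ∫ u in Metric.ball z 1, v u ^ 2 := by
    have : 2 * J / V * J - V * (J / V) ^ 2 = J ^ 2 / V := by field_simp; ring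
    linarith
  rwa [div_le_iff₀ hV, mul_comm] at h1

/-- Cauchy–Schwarz bounds the square of the local mean by the local mean of the square, and
averaging over unit discs preserves integrability by Fubini and translation invariance. -/
theorem memLp_gauss_of_le_ballMean {F H : ℂ → ℂ} (hF : Continuous F) (hH : Continuous H) {C : ℝ}
    (hL : MemLp F 2 gaussMeasure)
    (h : ∀ z, ‖H z‖ * Real.exp (-(Real.pi / 2) * ‖z‖ ^ 2) ≤ C * ballMean F z) :
    MemLp H 2 gaussMeasure := by
  rw [memLp_gauss_iff hF] at hL
  rw [memLp_gauss_iff hH]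
  set v : ℂ → ℝ := fun z => ‖F z‖ * Real.exp (-(Real.pi / 2) * ‖z‖ ^ 2) with hv
  have hvc : Continuous v := by rw [hv]; fun_prop
  have hprod : Integrable (fun x : ℂ × ℂ => v (x.1 + x.2) ^ 2)
      ((volume : Measure ℂ).prod (volume.restrict (Metric.ball (0 : ℂ) 1))) := by
    rw [integrable_prod_iff' (Continuous.aestronglyMeasurable (by fun_prop))]
    refine ⟨Filter.Eventually.of_forall fun u => hL.comp_add_right u, ?_⟩
    have : ∀ u : ℂ, ∫ z : ℂ, ‖v (z + u) ^ 2‖ = ∫ z : ℂ, ‖v z ^ 2‖ := fun u =>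
      integral_add_right_eq_self (fun z => ‖v z ^ 2‖) u
    simp only [this]
    exact integrableOn_ball continuous_const 0 1
  have hint := hprod.integral_prod_left
  simp only [setIntegral_ball_translate (fun u => v u ^ 2)] at hint
  refine (hint.const_mul (C ^ 2 * volume.real (Metric.ball (0 : ℂ) 1))).mono'
    (Continuous.aestronglyMeasurable (by fun_prop)) (Filter.Eventually.of_forall fun z => ?_)
  have hV : volume.real (Metric.ball z 1) = volume.real (Metric.ball (0 : ℂ) 1) := by
    simp only [measureReal_def, Measure.addHaar_ball_center]
  rw [Real.norm_of_nonneg (sq_nonneg _)]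
  calc _ ≤ (C * ballMean F z) ^ 2 := by
        refine pow_le_pow_left₀ (by positivity) (h z) 2
    _ = C ^ 2 * (∫ u in Metric.ball z 1, v u) ^ 2 := by rw [mul_pow]; rfl
    _ ≤ C ^ 2 * (volume.real (Metric.ball z 1) * ∫ u in Metric.ball z 1, v u ^ 2) :=
        mul_le_mul_of_nonneg_left (sq_setIntegral_ball_le hvc z) (sq_nonneg C)
    _ = _ := by rw [hV]; ring

theorem memLp_creation_iter {Φ : ℂ → ℂ} (hΦ : Differentiable ℂ Φ) (hL : MemLp Φ 2 gaussMeasure)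
    (j : ℕ) : MemLp (creation^[j] Φ) 2 gaussMeasure := by
  obtain ⟨C, -, h⟩ := creation_iter_le_ballMean j
  exact memLp_gauss_of_le_ballMean hΦ.continuous
    (creation_iter_smooth (smooth_of_entire hΦ) j).continuous hL (h Φ hΦ)

theorem memLp_dbar_iter {n : ℕ} {σ : ℂ → ℂ} (hσ : ContDiff ℝ ∞ σ) (h0 : dbar^[n + 1] σ = 0)
    (hL : MemLp σ 2 gaussMeasure) : MemLp (dbar^[n] σ) 2 gaussMeasure := by
  obtain ⟨C, -, h⟩ := dbar_iter_le_ballMean n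
  exact memLp_gauss_of_le_ballMean hσ.continuous (dbar_iter_smooth hσ n).continuous hL (h σ hσ h0)

/-! ### Integration by parts and orthogonality -/

theorem integral_dbar_eq_zero {u : ℂ → ℂ} (hu : ContDiff ℝ ∞ u) (h0 : Integrable u)
    (h1 : Integrable (dbar u)) (h2 : Integrable (dz u)) : ∫ z, dbar u z = 0 := by
  have e1 : ∀ z, fderiv ℝ u z 1 = dbar u z + dz u z := by
    intro z; simp only [dbar, dz]; ring
  have e2 : ∀ z, fderiv ℝ u z Complex.I = Complex.I * (dz u z - dbar u z) := by
    intro z; simp only [dbar, dz]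
    linear_combination (fderiv ℝ u z Complex.I) * Complex.I_mul_I
  have key : ∀ v : ℂ, Integrable (fun z => fderiv ℝ u z v) → ∫ z, fderiv ℝ u z v = 0 := by
    intro v hv
    have := integral_mul_fderiv_eq_neg_fderiv_mul_of_integrable (μ := (volume : Measure ℂ))
      (f := fun _ : ℂ => (1 : ℂ)) (g := u) (v := v) (by simp) (by simpa using hv) (by simpa using h0)
      (fun x _ => differentiableAt_const _) (fun x _ => smooth_differentiable hu x)
    simpa using this
  have k1 := key 1 (by simp only [e1]; exact h1.add h2)
  have k2 := key Complex.I (by simp only [e2]; exact (h2.sub h1).const_mul _)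
  simp only [dbar]
  rw [integral_const_mul, integral_add (by simp only [e1]; exact h1.add h2)
    (by simp only [e2]; exact ((h2.sub h1).const_mul _).const_mul _), k1, integral_const_mul, k2]
  simp

theorem norm_sq_eq_mul_conj (z : ℂ) : (((‖z‖ ^ 2 : ℝ)) : ℂ) = z * (starRingEnd ℂ) z := by
  rw [Complex.mul_conj, Complex.normSq_eq_norm_sq]

/-- The Gaussian density `e^{-π|z|²}` as a complex function. -/
noncomputable def gaussWeight (z : ℂ) : ℂ := Complex.exp (-(Real.pi : ℂ) * (z * (starRingEnd ℂ) z))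

theorem gaussWeight_eq (z : ℂ) : gaussWeight z = (Real.exp (-Real.pi * ‖z‖ ^ 2) : ℝ) := by
  rw [gaussWeight, ← norm_sq_eq_mul_conj]
  push_cast
  rfl

theorem gaussWeight_smooth : ContDiff ℝ ∞ gaussWeight := by
  unfold gaussWeight
  have := smooth_conj
  fun_prop

theorem fderiv_gaussWeight (z v : ℂ) : fderiv ℝ gaussWeight z v =
    -(Real.pi : ℂ) * (v * (starRingEnd ℂ) z + z * (starRingEnd ℂ) v) * gaussWeight z := by
  have h1 : HasFDerivAt (fun w : ℂ => w * (starRingEnd ℂ) w) _ z :=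
    (hasFDerivAt_id (𝕜 := ℝ) z).mul (hasFDerivAt_conj z)
  have h2 := (h1.const_mul (-(Real.pi : ℂ))).cexp
  have h3 : fderiv ℝ gaussWeight z = _ := h2.fderiv
  rw [h3]
  simp [gaussWeight]
  ring

theorem dz_gaussWeight (z : ℂ) :
    dz gaussWeight z = -(Real.pi : ℂ) * (starRingEnd ℂ) z * gaussWeight z := by
  simp only [dz, fderiv_gaussWeight]
  simp
  linear_combination (-(1/2 : ℂ) * (Real.pi : ℂ) * gaussWeight z * (z - (starRingEnd ℂ) z)) *
    Complex.I_mul_I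

theorem dbar_gaussWeight (z : ℂ) :
    dbar gaussWeight z = -(Real.pi : ℂ) * z * gaussWeight z := by
  simp only [dbar, fderiv_gaussWeight]
  simp
  linear_combination ((1/2 : ℂ) * (Real.pi : ℂ) * gaussWeight z * (z - (starRingEnd ℂ) z)) *
    Complex.I_mul_I

/-- The sesquilinear pairing of `L²(ℂ, dμ)` on functions. -/
noncomputable def gaussInner (F G : ℂ → ℂ) : ℂ := ∫ z, (starRingEnd ℂ) (F z) * G z ∂gaussMeasure

theorem integrable_conj_mul {F G : ℂ → ℂ} (hF : MemLp F 2 gaussMeasure)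
    (hG : MemLp G 2 gaussMeasure) :
    Integrable (fun z => (starRingEnd ℂ) (F z) * G z) gaussMeasure := by
  have h : MemLp (fun z => (starRingEnd ℂ) (F z)) 2 gaussMeasure := hF.star
  exact h.integrable_mul hG

theorem integrable_gaussWeight_mul {F G : ℂ → ℂ} (hF : MemLp F 2 gaussMeasure)
    (hG : MemLp G 2 gaussMeasure) :
    Integrable (fun z => gaussWeight z * ((starRingEnd ℂ) (F z) * G z)) volume := by
  have := integrable_gauss_iff.1 (integrable_conj_mul hF hG)
  simpa only [gaussWeight_eq, Complex.real_smul] using this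

theorem gaussInner_eq (F G : ℂ → ℂ) :
    gaussInner F G = ∫ z, gaussWeight z * ((starRingEnd ℂ) (F z) * G z) := by
  rw [gaussInner, integral_gauss]
  simp only [gaussWeight_eq, Complex.real_smul]

theorem gaussInner_conj (F G : ℂ → ℂ) : (starRingEnd ℂ) (gaussInner F G) = gaussInner G F := by
  rw [gaussInner, ← integral_conj, gaussInner]
  congr 1
  funext z
  simp [mul_comm]

theorem gaussInner_smul_right (F G : ℂ → ℂ) (c : ℂ) :
    gaussInner F (c • G) = c * gaussInner F G := by
  simp only [gaussInner, ← integral_const_mul, Pi.smul_apply, smul_eq_mul]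
  congr 1
  funext z
  ring

theorem gaussInner_smul_left (F G : ℂ → ℂ) (c : ℂ) :
    gaussInner (c • F) G = (starRingEnd ℂ) c * gaussInner F G := by
  rw [← gaussInner_conj, gaussInner_smul_right, map_mul, gaussInner_conj]

/-- The creation operator and `∂_{z̄}/√π` are adjoint to each other. -/
theorem gaussInner_creation {F G : ℂ → ℂ} (hF : ContDiff ℝ ∞ F) (hG : ContDiff ℝ ∞ G)
    (lF : MemLp F 2 gaussMeasure) (lG : MemLp G 2 gaussMeasure)
    (cF : MemLp (creation F) 2 gaussMeasure) (cG : MemLp (creation G) 2 gaussMeasure)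
    (dF : MemLp (dbar F) 2 gaussMeasure) (dG : MemLp (dbar G) 2 gaussMeasure) :
    (Real.sqrt Real.pi : ℂ) * gaussInner (creation F) G = gaussInner F (dbar G) := by
  have hFc : ContDiff ℝ ∞ (fun z => (starRingEnd ℂ) (F z)) := smooth_conj.comp hF
  have hFG : ContDiff ℝ ∞ (fun z => (starRingEnd ℂ) (F z) * G z) := hFc.mul hG
  have s := sqrt_pi_ne
  have s2 := sqrt_pi_mul
  have e1 : dbar (fun z => gaussWeight z * ((starRingEnd ℂ) (F z) * G z)) = fun z =>
      gaussWeight z * ((starRingEnd ℂ) (F z) * dbar G z) -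
      (Real.sqrt Real.pi : ℂ) * (gaussWeight z * ((starRingEnd ℂ) (creation F z) * G z)) := by
    funext z
    rw [dbar_mul (smooth_differentiable gaussWeight_smooth z) (smooth_differentiable hFG z),
      dbar_mul (smooth_differentiable hFc z) (smooth_differentiable hG z), dbar_gaussWeight,
      dbar_conj_comp (smooth_differentiable hF z), ← s2]
    simp only [creation, map_sub, map_mul, map_div₀, map_one, Complex.conj_conj, Complex.conj_ofReal]
    field_simp
    ring
  have e2 : dz (fun z => gaussWeight z * ((starRingEnd ℂ) (F z) * G z)) = fun z =>
      gaussWeight z * ((starRingEnd ℂ) (dbar F z) * G z) -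
      (Real.sqrt Real.pi : ℂ) * (gaussWeight z * ((starRingEnd ℂ) (F z) * creation G z)) := by
    funext z
    rw [dz_mul (smooth_differentiable gaussWeight_smooth z) (smooth_differentiable hFG z),
      dz_mul (smooth_differentiable hFc z) (smooth_differentiable hG z), dz_gaussWeight,
      dz_conj_comp (smooth_differentiable hF z), ← s2]
    simp only [creation]
    field_simp
    ring
  have i1 := integrable_gaussWeight_mul lF dG
  have i2 := (integrable_gaussWeight_mul cF lG).const_mul (Real.sqrt Real.pi : ℂ)
  -- The ∂_z derivative must be integrable as well, since the vanishing is proved for the real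
  -- partial derivatives. This is why membership of Z̄†G and ∂_{z̄}F in L² is needed although
  -- neither occurs in the conclusion.
  have h := integral_dbar_eq_zero (gaussWeight_smooth.mul hFG) (integrable_gaussWeight_mul lF lG)
    (by rw [e1]; exact i1.sub i2)
    (by
      rw [e2]
      exact (integrable_gaussWeight_mul dF lG).sub ((integrable_gaussWeight_mul lF cG).const_mul _))
  rw [e1, integral_sub i1 i2, integral_const_mul, ← gaussInner_eq, ← gaussInner_eq] at h
  exact (sub_eq_zero.1 h).symm

theorem memLp_dbar_creation_iter {Φ : ℂ → ℂ} (hΦ : Differentiable ℂ Φ)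
    (hL : MemLp Φ 2 gaussMeasure) (j : ℕ) : MemLp (dbar (creation^[j] Φ)) 2 gaussMeasure := by
  rw [dbar_creation_iter hΦ]
  exact (memLp_creation_iter hΦ hL _).const_smul _

theorem gaussInner_creation_iter_succ {Φ Ψ : ℂ → ℂ} (hΦ : Differentiable ℂ Φ)
    (lΦ : MemLp Φ 2 gaussMeasure) (hΨ : Differentiable ℂ Ψ) (lΨ : MemLp Ψ 2 gaussMeasure)
    (j k : ℕ) : gaussInner (creation^[j + 1] Φ) (creation^[k] Ψ) =
      k * gaussInner (creation^[j] Φ) (creation^[k - 1] Ψ) := by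
  have sΦ := smooth_of_entire hΦ
  have sΨ := smooth_of_entire hΨ
  have h := gaussInner_creation (creation_iter_smooth sΦ j) (creation_iter_smooth sΨ k)
    (memLp_creation_iter hΦ lΦ j) (memLp_creation_iter hΨ lΨ k)
    (by rw [← Function.iterate_succ_apply' creation]; exact memLp_creation_iter hΦ lΦ (j + 1))
    (by rw [← Function.iterate_succ_apply' creation]; exact memLp_creation_iter hΨ lΨ (k + 1))
    (memLp_dbar_creation_iter hΦ lΦ j) (memLp_dbar_creation_iter hΨ lΨ k)
  rw [← Function.iterate_succ_apply' creation, dbar_creation_iter hΨ, gaussInner_smul_right] at h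
  refine mul_left_cancel₀ sqrt_pi_ne (h.trans ?_)
  ring

/-- Moving one creation operator across lowers both exponents. If they differ, one side runs out
first and ∂_{z̄} hits an entire function. -/
theorem gaussInner_creation_iter {Φ Ψ : ℂ → ℂ} (hΦ : Differentiable ℂ Φ)
    (lΦ : MemLp Φ 2 gaussMeasure) (hΨ : Differentiable ℂ Ψ) (lΨ : MemLp Ψ 2 gaussMeasure)
    (j k : ℕ) : gaussInner (creation^[j] Φ) (creation^[k] Ψ) =
      if j = k then (j.factorial : ℂ) * gaussInner Φ Ψ else 0 := by
  induction j generalizing k with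
  | zero =>
    cases k with
    | zero => simp
    | succ k =>
      rw [← gaussInner_conj, gaussInner_creation_iter_succ hΨ lΨ hΦ lΦ]
      simp
  | succ j ih =>
    rw [gaussInner_creation_iter_succ hΦ lΦ hΨ lΨ, ih]
    cases k with
    | zero => simp
    | succ k =>
      simp only [Nat.add_sub_cancel, Nat.add_right_cancel_iff]
      split_ifs with h
      · rw [Nat.factorial_succ, h]
        push_cast
        ring
      · simp

theorem inner_toLp (F G : L2Gauss) {f g : ℂ → ℂ} (hf : F =ᵐ[gaussMeasure] f)
    (hg : G =ᵐ[gaussMeasure] g) : inner ℂ F G = gaussInner f g := by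
  rw [L2.inner_def, gaussInner]
  refine integral_congr_ae ?_
  filter_upwards [hf, hg] with z h1 h2
  rw [h1, h2]
  simp [mul_comm]

theorem trueFock_orthogonal {j k : ℕ} (hjk : j ≠ k) {F G : L2Gauss} (hF : F ∈ trueFock j)
    (hG : G ∈ trueFock k) : inner ℂ F G = 0 := by
  obtain ⟨Φ, h1, h2, h3⟩ := hF
  obtain ⟨Ψ, g1, g2, g3⟩ := hG
  rw [inner_toLp F G h3 g3, gaussInner_smul_right, gaussInner_smul_left,
    gaussInner_creation_iter h1 h2 g1 g2, if_neg hjk]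
  simp

theorem polyProj_self {j : ℕ} {F : L2Gauss} (hF : F ∈ trueFock j) : polyProj j F = F :=
  Submodule.starProjection_eq_self_iff.2 ((trueFock j).le_topologicalClosure hF)

theorem polyProj_of_ne {j k : ℕ} (hjk : j ≠ k) {F : L2Gauss} (hF : F ∈ trueFock k) :
    polyProj j F = 0 := by
  rw [polyProj, Submodule.starProjection_apply_eq_zero_iff, Submodule.orthogonal_closure,
    Submodule.mem_orthogonal]
  exact fun G hG => trueFock_orthogonal hjk hG hF

theorem polyProj_sum {n : ℕ} {F : Fin (n + 1) → L2Gauss} (hF : ∀ j : Fin (n + 1), F j ∈ trueFock j)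
    (j : Fin (n + 1)) : polyProj j (∑ k, F k) = F j := by
  rw [map_sum, Finset.sum_eq_single j, polyProj_self (hF j)]
  · intro k _ hk
    exact polyProj_of_ne (fun h => hk (Fin.ext h.symm)) (hF k)
  · simp

/-- A square integrable polyanalytic function is a sum of elements of the true polyanalytic
Fock spaces. -/
theorem polyFock_decompose (n : ℕ) : ∀ σ : L2Gauss, σ ∈ polyFock n →
    ∃ F : Fin (n + 1) → L2Gauss, (∀ j : Fin (n + 1), F j ∈ trueFock j) ∧ σ = ∑ j, F j := by
  induction n with
  | zero =>
    rintro σ ⟨Ψ, h1, h2, h3⟩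
    have hd : Differentiable ℂ Ψ := entire_of_dbar h1 (by simpa using h2)
    refine ⟨fun _ => σ, fun j => ?_, by simp⟩
    obtain rfl : j = 0 := Fin.fin_one_eq_zero j
    exact ⟨Ψ, hd, (memLp_congr_ae h3).1 (Lp.memLp σ), by simpa using h3⟩
  | succ n ih =>
    rintro σ ⟨Ψ, h1, h2, h3⟩
    have hd : Differentiable ℂ (dbar^[n + 1] Ψ) :=
      entire_of_dbar (dbar_iter_smooth h1 _) (by rw [← Function.iterate_succ_apply' dbar, h2])
    have lΨ : MemLp Ψ 2 gaussMeasure := (memLp_congr_ae h3).1 (Lp.memLp σ)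
    have hl := memLp_dbar_iter h1 h2 lΨ
    -- The number c is the scalar of ∂_{z̄}^{n+1}(Z̄†)^{n+1} on entire functions, and s is the
    -- normalization in the definition of `trueFock`. The factor s/c in Φ makes T and σ have the
    -- same image under ∂_{z̄}^{n+1}, so σ - T drops to 𝐅ⁿ.
    set c : ℂ := ((n + 1).factorial : ℂ) * (Real.sqrt Real.pi : ℂ) ^ (n + 1) with hc
    have hc0 : c ≠ 0 := mul_ne_zero (by exact_mod_cast (n + 1).factorial_ne_zero)
      (pow_ne_zero _ sqrt_pi_ne)
    set s : ℂ := (Real.sqrt ((n + 1).factorial : ℝ) : ℂ) with hs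
    have hs0 : s ≠ 0 := by
      have : (0 : ℝ) < (n + 1).factorial := by exact_mod_cast (n + 1).factorial_pos
      rw [hs]
      exact_mod_cast (Real.sqrt_pos.2 this).ne'
    set Φ : ℂ → ℂ := (s * c⁻¹) • dbar^[n + 1] Ψ with hΦ
    have dΦ : Differentiable ℂ Φ := hd.const_smul _
    have lΦ : MemLp Φ 2 gaussMeasure := hl.const_smul _
    have lT : MemLp ((1 / s) • creation^[n + 1] Φ) 2 gaussMeasure :=
      (memLp_creation_iter dΦ lΦ _).const_smul _
    set T : L2Gauss := lT.toLp _ with hT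
    have hTm : T ∈ trueFock (n + 1) := ⟨Φ, dΦ, lΦ, lT.coeFn_toLp⟩
    have hsub : σ - T ∈ polyFock n := by
      refine ⟨Ψ + (-(1 / s)) • creation^[n + 1] Φ,
        h1.add (smooth_smul (creation_iter_smooth (smooth_of_entire dΦ) _) _), ?_, ?_⟩
      · rw [dbar_iter_lin h1 (creation_iter_smooth (smooth_of_entire dΦ) _),
          dbar_iter_creation_iter dΦ, ← hc, hΦ, smul_smul, smul_smul]
        have : -(1 / s) * c * (s * c⁻¹) = -1 := by field_simp
        rw [this]
        simp
      · filter_upwards [Lp.coeFn_sub σ T, h3, lT.coeFn_toLp] with z e1 e2 e3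
        rw [e1, Pi.sub_apply, e2, hT, e3]
        simp [sub_eq_add_neg]
    obtain ⟨F, hF, hsum⟩ := ih _ hsub
    refine ⟨Fin.snoc F T, fun j => ?_, ?_⟩
    · refine Fin.lastCases ?_ (fun i => ?_) j
      · rw [Fin.snoc_last, Fin.val_last]; exact hTm
      · rw [Fin.snoc_castSucc]; exact hF i
    · rw [Fin.sum_univ_castSucc]
      simp only [Fin.snoc_castSucc, Fin.snoc_last]
      rw [← hsum]
      abel

/-! ### The Bargmann transform -/

/-- Continuous functions of at most exponential growth. -/
def ExpBounded (f : ℝ → ℂ) : Prop :=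
  Continuous f ∧ ∃ C R : ℝ, ∀ t, ‖f t‖ ≤ C * Real.exp (R * |t|)

theorem ExpBounded.mul {f g : ℝ → ℂ} (hf : ExpBounded f) (hg : ExpBounded g) :
    ExpBounded (fun t => f t * g t) := by
  obtain ⟨cf, C, R, h⟩ := hf
  obtain ⟨cg, D, S, k⟩ := hg
  refine ⟨cf.mul cg, C * D, R + S, fun t => ?_⟩
  rw [norm_mul, add_mul, Real.exp_add, mul_mul_mul_comm]
  exact mul_le_mul (h t) (k t) (norm_nonneg _) ((norm_nonneg _).trans (h t))

theorem ExpBounded.add {f g : ℝ → ℂ} (hf : ExpBounded f) (hg : ExpBounded g) :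
    ExpBounded (fun t => f t + g t) := by
  obtain ⟨cf, C, R, h⟩ := hf
  obtain ⟨cg, D, S, k⟩ := hg
  have hC : 0 ≤ C := by
    have := (norm_nonneg _).trans (h 0)
    simpa using this
  have hD : 0 ≤ D := by
    have := (norm_nonneg _).trans (k 0)
    simpa using this
  refine ⟨cf.add cg, C + D, max R S, fun t => (norm_add_le _ _).trans ?_⟩
  rw [add_mul]
  refine add_le_add ((h t).trans ?_) ((k t).trans ?_)
  · have := le_max_left R S
    gcongr
  · have := le_max_right R S
    gcongr

theorem ExpBounded.of_bounded {f : ℝ → ℂ} (hf : Continuous f) {C : ℝ} (h : ∀ t, ‖f t‖ ≤ C) :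
    ExpBounded f := ⟨hf, C, 0, by simpa using h⟩

theorem ExpBounded.const (c : ℂ) : ExpBounded (fun _ => c) :=
  .of_bounded continuous_const (C := ‖c‖) fun _ => le_rfl

theorem ExpBounded.id : ExpBounded (fun t => (t : ℂ)) := by
  refine ⟨by fun_prop, 1, 1, fun t => ?_⟩
  rw [Complex.norm_real, Real.norm_eq_abs, one_mul, one_mul]
  linarith [Real.add_one_le_exp |t|]

theorem ExpBounded.poly (p : Polynomial ℂ) (x : ℝ) :
    ExpBounded (fun t => p.eval ((t : ℂ) - (x : ℂ))) := by
  induction p using Polynomial.induction_on with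
  | C a => simpa using ExpBounded.const a
  | add p q hp hq => simpa using hp.add hq
  | monomial n a h =>
    have h2 := h.mul (ExpBounded.id.add (ExpBounded.const (-(x : ℂ))))
    convert h2 using 2
    simp
    ring

/-- Completing the square sacrifices half of the Gaussian exponent to absorb the linear term. -/
theorem neg_sq_add_le {b : ℝ} (hb : 0 < b) (S t : ℝ) :
    -b * t ^ 2 + S * |t| ≤ -(b / 2) * t ^ 2 + S ^ 2 / (2 * b) := by
  have h : 0 ≤ (b * |t| - S) ^ 2 / (2 * b) := by positivity
  have e : (b * |t| - S) ^ 2 / (2 * b) = b / 2 * |t| ^ 2 - S * |t| + S ^ 2 / (2 * b) := by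
    field_simp
    ring
  rw [e, sq_abs] at h
  linarith

theorem integrable_gaussian_exp {b : ℝ} (hb : 0 < b) (S : ℝ) :
    Integrable (fun t : ℝ => Real.exp (-b * t ^ 2 + S * |t|)) := by
  refine ((integrable_exp_neg_mul_sq (half_pos hb)).mul_const (Real.exp (S ^ 2 / (2 * b)))).mono'
    (Continuous.aestronglyMeasurable (by fun_prop)) (Filter.Eventually.of_forall fun t => ?_)
  rw [Real.norm_of_nonneg (Real.exp_pos _).le, ← Real.exp_add]
  exact Real.exp_le_exp.2 (neg_sq_add_le hb S t)

theorem norm_cexp_laplace_le (t : ℝ) (z : ℂ) :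
    ‖Complex.exp (-(Real.pi : ℂ) * t ^ 2 + 2 * Real.pi * t * z)‖ ≤
      Real.exp (-Real.pi * t ^ 2 + 2 * Real.pi * ‖z‖ * |t|) := by
  rw [Complex.norm_exp]
  refine Real.exp_le_exp.2 ?_
  have h1 : (-(Real.pi : ℂ) * t ^ 2 + 2 * Real.pi * t * z).re =
      -Real.pi * t ^ 2 + 2 * Real.pi * (t * z.re) := by
    have e : (-(Real.pi : ℂ) * t ^ 2 + 2 * Real.pi * t * z) =
        ((-Real.pi * t ^ 2 : ℝ) : ℂ) + ((2 * Real.pi * t : ℝ) : ℂ) * z := by push_cast; ring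
    rw [e, Complex.add_re, Complex.ofReal_re, Complex.re_ofReal_mul]
    ring
  have h2 : t * z.re ≤ ‖z‖ * |t| := by
    calc t * z.re ≤ |t * z.re| := le_abs_self _
      _ = |t| * |z.re| := abs_mul _ _
      _ ≤ |t| * ‖z‖ := mul_le_mul_of_nonneg_left (Complex.abs_re_le_norm z) (abs_nonneg _)
      _ = _ := mul_comm _ _
  rw [h1]
  have := mul_le_mul_of_nonneg_left h2 (by positivity : 0 ≤ 2 * Real.pi)
  linarith

theorem integrable_laplace {g : ℝ → ℂ} (hg : ExpBounded g) (z : ℂ) :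
    Integrable (fun t : ℝ => g t * Complex.exp (-(Real.pi : ℂ) * t ^ 2 + 2 * Real.pi * t * z)) := by
  obtain ⟨c, C, R, h⟩ := hg
  refine ((integrable_gaussian_exp Real.pi_pos (R + 2 * Real.pi * ‖z‖)).const_mul C).mono'
    (Continuous.aestronglyMeasurable (by fun_prop)) (Filter.Eventually.of_forall fun t => ?_)
  rw [norm_mul]
  refine (mul_le_mul (h t) (norm_cexp_laplace_le t z) (norm_nonneg _)
    ((norm_nonneg _).trans (h t))).trans (le_of_eq ?_)
  rw [mul_assoc, ← Real.exp_add]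
  congr 2
  ring

/-- The two-sided Laplace transform of `g(t) e^{-π t²}`, normalized as `∫ g(t) e^{-πt²+2πtz} dt`. -/
noncomputable def gaussLaplace (g : ℝ → ℂ) (z : ℂ) : ℂ :=
  ∫ t : ℝ, g t * Complex.exp (-(Real.pi : ℂ) * t ^ 2 + 2 * Real.pi * t * z)

theorem hasDerivAt_gaussLaplace {g : ℝ → ℂ} (hg : ExpBounded g) (z : ℂ) :
    HasDerivAt (gaussLaplace g) (2 * Real.pi * gaussLaplace (fun t => g t * t) z) z := by
  have hg' := hg.mul ExpBounded.id
  obtain ⟨c, C, R, h⟩ := hg'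
  have hC : 0 ≤ C := by
    have := (norm_nonneg _).trans (h 0)
    simpa using this
  have key := hasDerivAt_integral_of_dominated_loc_of_deriv_le (μ := (volume : Measure ℝ))
    (F := fun z t => g t * Complex.exp (-(Real.pi : ℂ) * t ^ 2 + 2 * Real.pi * t * z))
    (F' := fun z t => 2 * Real.pi *
      (g t * t * Complex.exp (-(Real.pi : ℂ) * t ^ 2 + 2 * Real.pi * t * z)))
    (x₀ := z) (s := Metric.ball z 1)
    (bound := fun t => 2 * Real.pi *
      (C * Real.exp (-Real.pi * t ^ 2 + (R + 2 * Real.pi * (‖z‖ + 1)) * |t|)))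
    (Metric.ball_mem_nhds z one_pos)
    (Filter.Eventually.of_forall fun w => (integrable_laplace hg w).aestronglyMeasurable)
    (integrable_laplace hg z)
    ((integrable_laplace ⟨c, C, R, h⟩ z).const_mul _).aestronglyMeasurable
    -- For w in the unit disc around z the growth rate in t is at most R + 2π(‖z‖ + 1), so one
    -- Gaussian majorant dominates all the derivatives.
    (Filter.Eventually.of_forall fun t w hw => ?_)
    (((integrable_gaussian_exp Real.pi_pos _).const_mul C).const_mul _)
    (Filter.Eventually.of_forall fun t w _ => ?_)
  · have := key.2
    rw [integral_const_mul] at this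
    exact this
  · have e : ‖(2 * Real.pi : ℂ)‖ = 2 * Real.pi := by
      rw [norm_mul, Complex.norm_real, Real.norm_of_nonneg Real.pi_pos.le]
      simp
    rw [norm_mul, e, norm_mul]
    refine mul_le_mul_of_nonneg_left ?_ (by positivity)
    refine (mul_le_mul (h t) (norm_cexp_laplace_le t w) (norm_nonneg _)
      ((norm_nonneg _).trans (h t))).trans ?_
    rw [mul_assoc, ← Real.exp_add]
    refine mul_le_mul_of_nonneg_left (Real.exp_le_exp.2 ?_) hC
    have hw' : ‖w‖ ≤ ‖z‖ + 1 := by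
      have h1 : ‖w - z‖ < 1 := by simpa [dist_eq_norm] using hw
      have h2 := norm_le_norm_add_norm_sub' w z
      linarith
    have : 2 * Real.pi * ‖w‖ * |t| ≤ 2 * Real.pi * (‖z‖ + 1) * |t| := by gcongr
    linarith
  · have h1 : HasDerivAt (fun w : ℂ => -(Real.pi : ℂ) * (t : ℂ) ^ 2 + 2 * Real.pi * (t : ℂ) * w)
        (2 * Real.pi * (t : ℂ) * 1) w := ((hasDerivAt_id w).const_mul _).const_add _
    exact (h1.cexp.const_mul (g t)).congr_deriv (by ring)

/-- The Bargmann kernel `2^{1/4} e^{-πt² + 2πtz - πz²/2}`. -/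
noncomputable def bargmannKernel (t : ℝ) (z : ℂ) : ℂ :=
  ((2 : ℝ) ^ (1 / 4 : ℝ) : ℝ) *
    Complex.exp (-(Real.pi : ℂ) * t ^ 2 + 2 * Real.pi * t * z - Real.pi * z ^ 2 / 2)

theorem bargmannKernel_eq (t : ℝ) (z : ℂ) : bargmannKernel t z =
    ((2 : ℝ) ^ (1 / 4 : ℝ) : ℝ) * Complex.exp (-Real.pi * z ^ 2 / 2) *
      Complex.exp (-(Real.pi : ℂ) * t ^ 2 + 2 * Real.pi * t * z) := by
  rw [bargmannKernel, mul_assoc (((2 : ℝ) ^ (1 / 4 : ℝ) : ℝ) : ℂ), ← Complex.exp_add]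
  congr 2
  ring

theorem integrable_mul_bargmannKernel {g : ℝ → ℂ} (hg : ExpBounded g) (z : ℂ) :
    Integrable (fun t : ℝ => g t * bargmannKernel t z) := by
  have h := (integrable_laplace hg z).const_mul
    (((2 : ℝ) ^ (1 / 4 : ℝ) : ℝ) * Complex.exp (-Real.pi * z ^ 2 / 2))
  refine h.congr (Filter.Eventually.of_forall fun t => ?_)
  simp only [bargmannKernel_eq]
  ring

/-- The Bargmann transform. -/
noncomputable def bargmann (f : ℝ → ℂ) (z : ℂ) : ℂ := ∫ t : ℝ, f t * bargmannKernel t z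

theorem bargmann_eq (f : ℝ → ℂ) (z : ℂ) : bargmann f z =
    ((2 : ℝ) ^ (1 / 4 : ℝ) : ℝ) * Complex.exp (-Real.pi * z ^ 2 / 2) * gaussLaplace f z := by
  rw [bargmann, gaussLaplace, ← integral_const_mul]
  congr 1
  funext t
  rw [bargmannKernel_eq]
  ring

theorem hasDerivAt_bargmann {f : ℝ → ℂ} (hf : ExpBounded f) (z : ℂ) :
    HasDerivAt (bargmann f)
      (2 * Real.pi * bargmann (fun t => f t * t) z - Real.pi * z * bargmann f z) z := by
  have e : bargmann f = fun z => ((2 : ℝ) ^ (1 / 4 : ℝ) : ℝ) *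
      Complex.exp (-Real.pi * z ^ 2 / 2) * gaussLaplace f z := funext (bargmann_eq f)
  have h1 : HasDerivAt (fun z : ℂ => -(Real.pi : ℂ) * z ^ 2 / 2) (-Real.pi * z) z := by
    have := ((hasDerivAt_pow 2 z).const_mul (-(Real.pi : ℂ))).div_const 2
    exact this.congr_deriv (by push_cast; ring)
  have h2 := (h1.cexp.const_mul ((((2 : ℝ) ^ (1 / 4 : ℝ) : ℝ) : ℂ))).mul
    (hasDerivAt_gaussLaplace hf z)
  rw [e]
  refine h2.congr_deriv ?_
  simp only [bargmann_eq]
  ring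

theorem bargmann_entire {f : ℝ → ℂ} (hf : ExpBounded f) : Differentiable ℂ (bargmann f) :=
  fun z => (hasDerivAt_bargmann hf z).differentiableAt

/-- The Bargmann transform with a polynomial factor `p(t - x)`, `x = Re z`, in the kernel. -/
noncomputable def polyBarg (p : Polynomial ℂ) (f : ℝ → ℂ) (z : ℂ) : ℂ :=
  ∫ t : ℝ, f t * p.eval ((t : ℂ) - (z.re : ℂ)) * bargmannKernel t z

theorem polyBarg_one (f : ℝ → ℂ) : polyBarg 1 f = bargmann f := by
  funext z
  simp [polyBarg, bargmann]

theorem polyBarg_C_mul (a : ℂ) (p : Polynomial ℂ) (f : ℝ → ℂ) :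
    polyBarg (Polynomial.C a * p) f = a • polyBarg p f := by
  funext z
  simp only [polyBarg, Pi.smul_apply, smul_eq_mul, ← integral_const_mul]
  congr 1
  funext t
  simp
  ring

theorem polyBarg_add (p q : Polynomial ℂ) {f : ℝ → ℂ} (hf : ExpBounded f) :
    polyBarg (p + q) f = polyBarg p f + polyBarg q f := by
  funext z
  simp only [polyBarg, Pi.add_apply]
  rw [← integral_add (integrable_mul_bargmannKernel (hf.mul (ExpBounded.poly p z.re)) z)
    (integrable_mul_bargmannKernel (hf.mul (ExpBounded.poly q z.re)) z)]
  congr 1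
  funext t
  simp
  ring

/-- In the factor t - Re z, the t is absorbed into f and Re z leaves the integral. This is why
inductions on p must keep f arbitrary. -/
theorem polyBarg_mul_X (p : Polynomial ℂ) {f : ℝ → ℂ} (hf : ExpBounded f) :
    polyBarg (p * Polynomial.X) f =
      polyBarg p (fun t => f t * t) + (-1 : ℂ) • (fun z : ℂ => (z.re : ℂ) * polyBarg p f z) := by
  funext z
  simp only [polyBarg, Pi.add_apply, Pi.smul_apply, smul_eq_mul]
  rw [← integral_const_mul, ← integral_const_mul,
    ← integral_add (integrable_mul_bargmannKernel
      ((hf.mul ExpBounded.id).mul (ExpBounded.poly p z.re)) z)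
    (((integrable_mul_bargmannKernel (hf.mul (ExpBounded.poly p z.re)) z).const_mul _).const_mul _)]
  congr 1
  funext t
  simp
  ring

/-- The operator `p ↦ (p' - 4πXp)/(2√π)` on polynomials. -/
noncomputable def polyRaise (p : Polynomial ℂ) : Polynomial ℂ :=
  Polynomial.C (1 / (2 * (Real.sqrt Real.pi : ℂ))) *
    (Polynomial.derivative p + Polynomial.C (-(4 * Real.pi : ℂ)) * (p * Polynomial.X))

theorem smooth_re : ContDiff ℝ ∞ (fun z : ℂ => (z.re : ℂ)) :=
  Complex.ofRealCLM.contDiff.comp Complex.reCLM.contDiff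

theorem dz_re (z : ℂ) : dz (fun w : ℂ => (w.re : ℂ)) z = 1 / 2 := by
  have h : HasFDerivAt (fun w : ℂ => (w.re : ℂ)) (Complex.ofRealCLM.comp Complex.reCLM) z :=
    (Complex.ofRealCLM.comp Complex.reCLM).hasFDerivAt
  rw [dz, h.fderiv]
  simp

theorem creation_re_mul {Ψ : ℂ → ℂ} (h : ContDiff ℝ ∞ Ψ) :
    creation (fun z : ℂ => (z.re : ℂ) * Ψ z) =
      (fun z : ℂ => (z.re : ℂ) * creation Ψ z) + (-(1 / (2 * (Real.sqrt Real.pi : ℂ)))) • Ψ := by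
  funext z
  simp only [creation, Pi.add_apply, Pi.smul_apply, smul_eq_mul]
  rw [dz_mul (smooth_differentiable smooth_re z) (smooth_differentiable h z), dz_re]
  have := sqrt_pi_ne
  field_simp
  ring

/-- Only Re z in the polynomial prevents `polyBarg` from being holomorphic. For constants the
identity comes from the derivative of B; multiplication by X adds a commutator of Z̄† with Re z,
equal to the term that the product rule adds in `polyRaise`. The latter is also (2√π)⁻¹ d/dt
conjugated by e^{-2πt²}, hence generates the Hermite polynomials. -/
theorem creation_polyBarg (p : Polynomial ℂ) : ∀ f : ℝ → ℂ, ExpBounded f →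
    ContDiff ℝ ∞ (polyBarg p f) ∧ creation (polyBarg p f) = polyBarg (polyRaise p) f := by
  have step : ∀ p : Polynomial ℂ, (∀ f : ℝ → ℂ, ExpBounded f →
      ContDiff ℝ ∞ (polyBarg p f) ∧ creation (polyBarg p f) = polyBarg (polyRaise p) f) →
      ∀ f : ℝ → ℂ, ExpBounded f → ContDiff ℝ ∞ (polyBarg (p * Polynomial.X) f) ∧
      creation (polyBarg (p * Polynomial.X) f) = polyBarg (polyRaise (p * Polynomial.X)) f := by
    intro p ih f hf
    obtain ⟨s1, c1⟩ := ih f hf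
    obtain ⟨s2, c2⟩ := ih _ (hf.mul ExpBounded.id)
    have s3 : ContDiff ℝ ∞ (fun z : ℂ => (z.re : ℂ) * polyBarg p f z) := smooth_re.mul s1
    have e : polyRaise (p * Polynomial.X) = polyRaise p * Polynomial.X +
        Polynomial.C (1 / (2 * (Real.sqrt Real.pi : ℂ))) * p := by
      simp only [polyRaise, Polynomial.derivative_mul, Polynomial.derivative_X]
      ring
    rw [e, polyBarg_add _ _ hf, polyBarg_C_mul, polyBarg_mul_X _ hf, polyBarg_mul_X _ hf]
    refine ⟨s2.add (smooth_smul s3 _), ?_⟩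
    rw [creation_linear s2 s3, c2, creation_re_mul s1, c1, smul_add, smul_smul, add_assoc]
    congr 3
    ring
  induction p using Polynomial.induction_on with
  | C a =>
    intro f hf
    have hd := bargmann_entire hf
    have e : ∀ g : ℝ → ℂ, polyBarg (Polynomial.C a) g = a • bargmann g := by
      intro g
      rw [← mul_one (Polynomial.C a), polyBarg_C_mul, polyBarg_one]
    refine ⟨by rw [e]; exact smooth_smul (smooth_of_entire hd) a, ?_⟩
    have e2 : polyRaise (Polynomial.C a) =
        Polynomial.C (-(2 * (Real.sqrt Real.pi : ℂ))) * (Polynomial.C a * Polynomial.X) := by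
      simp only [polyRaise, Polynomial.derivative_C, zero_add]
      rw [← mul_assoc, ← Polynomial.C_mul]
      congr 2
      rw [← sqrt_pi_mul]
      have := sqrt_pi_ne
      field_simp
      ring
    have e3 := creation_iter_smul (smooth_of_entire hd) a 1
    simp only [Function.iterate_one] at e3
    rw [e2, polyBarg_C_mul, polyBarg_mul_X _ hf, e, e, e3]
    funext z
    simp only [creation, Pi.add_apply, Pi.smul_apply, smul_eq_mul]
    rw [dz_of_hasDerivAt (hasDerivAt_bargmann hf z)]
    have h1 := sqrt_pi_ne
    -- The z̄ in Z̄† and the z in the derivative of B combine to 2 Re z, so that only t - Re z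
    -- appears.
    have h2 : (starRingEnd ℂ) z = 2 * (z.re : ℂ) - z := by
      linear_combination (Complex.add_conj z) + (by push_cast; ring :
        ((2 * z.re : ℝ) : ℂ) = 2 * (z.re : ℂ))
    rw [h2, ← sqrt_pi_mul]
    field_simp
    ring
  | add p q hp hq =>
    intro f hf
    have e : polyRaise (p + q) = polyRaise p + polyRaise q := by
      simp only [polyRaise, Polynomial.derivative_add]
      ring
    have hc := creation_linear (hp f hf).1 (hq f hf).1 1
    rw [one_smul, one_smul] at hc
    rw [e, polyBarg_add _ _ hf, polyBarg_add _ _ hf, hc, (hp f hf).2, (hq f hf).2]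
    exact ⟨(hp f hf).1.add (hq f hf).1, rfl⟩
  | monomial n a ih =>
    rw [pow_succ, ← mul_assoc]
    exact step _ ih

theorem creation_iter_bargmann {f : ℝ → ℂ} (hf : ExpBounded f) (j : ℕ) :
    creation^[j] (bargmann f) = polyBarg (polyRaise^[j] 1) f := by
  induction j with
  | zero => simp [polyBarg_one]
  | succ j ih =>
    rw [Function.iterate_succ_apply', ih, (creation_polyBarg _ f hf).2,
      Function.iterate_succ_apply' polyRaise]

theorem iteratedDeriv_gaussian (j : ℕ) (t : ℝ) :
    ((iteratedDeriv j (fun s : ℝ => Real.exp (-2 * Real.pi * s ^ 2)) t : ℝ) : ℂ) =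
      (2 * (Real.sqrt Real.pi : ℂ)) ^ j * (polyRaise^[j] 1).eval (t : ℂ) *
        Complex.exp (-2 * Real.pi * t ^ 2) := by
  have hs : ContDiff ℝ ∞ (fun s : ℝ => Real.exp (-2 * Real.pi * s ^ 2)) := by fun_prop
  induction j generalizing t with
  | zero => simp
  | succ j ih =>
    have h1 : HasDerivAt (iteratedDeriv j (fun s : ℝ => Real.exp (-2 * Real.pi * s ^ 2)))
        (iteratedDeriv (j + 1) (fun s : ℝ => Real.exp (-2 * Real.pi * s ^ 2)) t) t := by
      rw [iteratedDeriv_succ]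
      exact ((hs.differentiable_iteratedDeriv j
        (by exact_mod_cast WithTop.coe_lt_top _)) t).hasDerivAt
    have h2 := h1.ofReal_comp
    simp only [ih] at h2
    set q := polyRaise^[j] 1 with hq
    have h3 : HasDerivAt (fun y : ℝ => q.eval (y : ℂ)) ((Polynomial.derivative q).eval (t : ℂ)) t :=
      (q.hasDerivAt (t : ℂ)).comp_ofReal
    have h4 : HasDerivAt (fun y : ℝ => Complex.exp (-2 * Real.pi * (y : ℂ) ^ 2))
        (-4 * Real.pi * t * Complex.exp (-2 * Real.pi * (t : ℂ) ^ 2)) t := by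
      have h5 : HasDerivAt (fun w : ℂ => Complex.exp (-2 * Real.pi * w ^ 2))
          (-4 * Real.pi * t * Complex.exp (-2 * Real.pi * (t : ℂ) ^ 2)) (t : ℂ) := by
        have := ((hasDerivAt_pow 2 (t : ℂ)).const_mul (-2 * (Real.pi : ℂ))).cexp
        exact this.congr_deriv (by push_cast; ring)
      exact h5.comp_ofReal
    have h6 := (h3.const_mul ((2 * (Real.sqrt Real.pi : ℂ)) ^ j)).mul h4
    rw [h2.unique h6, Function.iterate_succ_apply', ← hq]
    have := sqrt_pi_ne
    simp only [polyRaise, Polynomial.eval_mul, Polynomial.eval_C, Polynomial.eval_add,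
      Polynomial.eval_X]
    rw [pow_succ]
    field_simp
    ring

theorem hermiteFn_eq (j : ℕ) (u : ℝ) : (hermiteFn j u : ℂ) =
    ((-1) ^ j / (Real.sqrt (j.factorial : ℝ) : ℂ)) * (polyRaise^[j] 1).eval (u : ℂ) *
      (((2 : ℝ) ^ (1 / 4 : ℝ) : ℝ) * Complex.exp (-Real.pi * u ^ 2)) := by
  have e : Complex.exp (Real.pi * (u : ℂ) ^ 2) * Complex.exp (-2 * Real.pi * (u : ℂ) ^ 2) =
      Complex.exp (-Real.pi * (u : ℂ) ^ 2) := by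
    rw [← Complex.exp_add]
    congr 1
    ring
  rw [← e]
  simp only [hermiteFn, Complex.ofReal_mul, iteratedDeriv_gaussian, Complex.ofReal_div,
    Complex.ofReal_pow, Complex.ofReal_neg, Complex.ofReal_one, Complex.ofReal_exp,
    Complex.ofReal_ofNat]
  have h1 := sqrt_pi_ne
  have h2 : (-1 / (2 * (Real.sqrt Real.pi : ℂ))) ^ j * (2 * (Real.sqrt Real.pi : ℂ)) ^ j =
      (-1) ^ j := by
    rw [← mul_pow]
    congr 1
    field_simp
  rw [← h2]
  ring

theorem hermiteFn_kernel (j : ℕ) (t : ℝ) (z : ℂ) :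
    Complex.exp (-Complex.I * (Real.pi : ℂ) * (z.re : ℂ) * (z.im : ℂ)) *
    Complex.exp ((Real.pi : ℂ) * ((z.re : ℂ) ^ 2 + (z.im : ℂ) ^ 2) / 2) *
    ((hermiteFn j (t - z.re) : ℂ) *
      Complex.exp (-2 * (Real.pi : ℂ) * Complex.I * (t : ℂ) * ((-z.im : ℝ) : ℂ))) =
    ((-1) ^ j / (Real.sqrt (j.factorial : ℝ) : ℂ)) *
      ((polyRaise^[j] 1).eval ((t : ℂ) - (z.re : ℂ)) * bargmannKernel t z) := by
  have e : Complex.exp (-Complex.I * (Real.pi : ℂ) * (z.re : ℂ) * (z.im : ℂ)) *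
      Complex.exp ((Real.pi : ℂ) * ((z.re : ℂ) ^ 2 + (z.im : ℂ) ^ 2) / 2) *
      Complex.exp (-Real.pi * ((t : ℂ) - (z.re : ℂ)) ^ 2) *
      Complex.exp (-2 * (Real.pi : ℂ) * Complex.I * (t : ℂ) * ((-z.im : ℝ) : ℂ)) =
      Complex.exp (-(Real.pi : ℂ) * t ^ 2 + 2 * Real.pi * t * z - Real.pi * z ^ 2 / 2) := by
    rw [← Complex.exp_add, ← Complex.exp_add, ← Complex.exp_add]
    congr 1
    have hz : z = (z.re : ℂ) + (z.im : ℂ) * Complex.I := (Complex.re_add_im z).symm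
    generalize (z.re : ℂ) = x at hz ⊢
    push_cast
    generalize (z.im : ℂ) = y at hz ⊢
    rw [hz]
    linear_combination ((Real.pi : ℂ) / 2 * y ^ 2) * Complex.I_mul_I
  rw [bargmannKernel, ← e, hermiteFn_eq]
  push_cast
  ring

/-- The phase and Gaussian prefactors turn the shifted, modulated Hermite function into the Bargmann
kernel times its polynomial, and that polynomial is j-fold raising of 1. -/
theorem trueBargmann_eq {f : ℝ → ℂ} (hf : ExpBounded f) (j : ℕ) : trueBargmann j f =
    ((-1) ^ j / (Real.sqrt (j.factorial : ℝ) : ℂ)) • creation^[j] (bargmann f) := by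
  funext z
  rw [creation_iter_bargmann hf, trueBargmann, stft, Pi.smul_apply, smul_eq_mul, polyBarg,
    ← integral_const_mul, ← integral_const_mul]
  congr 1
  funext t
  rw [Complex.conj_ofReal]
  have := hermiteFn_kernel j t z
  linear_combination (f t) * this

/-! ### Injectivity, adjoint and inversion of the Bargmann transform -/

open FourierTransform in
-- On the imaginary axis the Laplace integral is the Fourier transform of f e^{-πt²}, so Fourier
-- inversion applies.
theorem eq_zero_of_gaussLaplace_eq_zero {f : ℝ → ℂ} (hf : ExpBounded f)
    (h : ∀ ξ : ℝ, gaussLaplace f (-Complex.I * ξ) = 0) : f = 0 := by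
  set u : ℝ → ℂ := fun t => f t * Complex.exp (-(Real.pi : ℂ) * t ^ 2) with hu
  have hc : Continuous u := by
    have := hf.1
    rw [hu]
    fun_prop
  have hi : Integrable u := by simpa [hu] using integrable_laplace hf 0
  have hF : 𝓕 u = 0 := by
    funext ξ
    rw [Real.fourier_real_eq_integral_exp_smul, Pi.zero_apply, ← h ξ, gaussLaplace]
    congr 1
    funext t
    rw [hu, smul_eq_mul, mul_left_comm, ← Complex.exp_add]
    congr 2
    push_cast
    ring
  have hinv := hc.fourierInv_fourier_eq hi (by rw [hF]; exact integrable_zero _ _ _)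
  rw [hF] at hinv
  have h0 : u = 0 := by
    rw [← hinv]
    funext t
    simp [Real.fourierInv_eq']
  funext t
  have := congrFun h0 t
  simpa [hu] using this

theorem eq_zero_of_bargmann_eq_zero {f : ℝ → ℂ} (hf : ExpBounded f) (h : bargmann f = 0) :
    f = 0 := by
  refine eq_zero_of_gaussLaplace_eq_zero hf fun ξ => ?_
  have := congrFun h (-Complex.I * ξ)
  rw [bargmann_eq] at this
  have h2 : (((2 : ℝ) ^ (1 / 4 : ℝ) : ℝ) : ℂ) ≠ 0 := by
    exact_mod_cast (Real.rpow_pos_of_pos two_pos _).ne'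
  simpa [h2] using this

theorem bargmannKernel_continuous : Continuous (fun x : ℝ × ℂ => bargmannKernel x.1 x.2) := by
  unfold bargmannKernel
  fun_prop

theorem norm_bargmannKernel (t : ℝ) (z : ℂ) : ‖bargmannKernel t z‖ =
    (2 : ℝ) ^ (1 / 4 : ℝ) * Real.exp (-Real.pi * (t - z.re) ^ 2) *
      Real.exp (Real.pi / 2 * ‖z‖ ^ 2) := by
  rw [bargmannKernel, norm_mul, Complex.norm_exp, Complex.norm_real,
    Real.norm_of_nonneg (Real.rpow_nonneg zero_le_two _), mul_assoc ((2 : ℝ) ^ (1 / 4 : ℝ)), ← Real.exp_add]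
  congr 2
  have e : (-(Real.pi : ℂ) * t ^ 2 + 2 * Real.pi * t * z - Real.pi * z ^ 2 / 2) =
      ((-Real.pi * t ^ 2 : ℝ) : ℂ) + ((2 * Real.pi * t : ℝ) : ℂ) * z
        - ((Real.pi / 2 : ℝ) : ℂ) * (z * z) := by push_cast; ring
  rw [e, Complex.sub_re, Complex.add_re, Complex.ofReal_re, Complex.re_ofReal_mul,
    Complex.re_ofReal_mul, Complex.mul_re, ← Complex.normSq_eq_norm_sq, Complex.normSq_apply]
  ring

theorem norm_gaussWeight (z : ℂ) : ‖gaussWeight z‖ = Real.exp (-Real.pi * ‖z‖ ^ 2) := by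
  rw [gaussWeight_eq, Complex.norm_real, Real.norm_of_nonneg (Real.exp_pos _).le]

theorem exp_neg_pi_mul_exp_half (z : ℂ) : Real.exp (-Real.pi * ‖z‖ ^ 2) *
    Real.exp (Real.pi / 2 * ‖z‖ ^ 2) = Real.exp (-(Real.pi / 2) * ‖z‖ ^ 2) := by
  rw [← Real.exp_add]
  congr 1
  ring

/-- Continuous functions on `ℂ` whose product with `e^{-(π/2)|z|²}` is bounded and integrable. -/
structure FockDecay (Φ : ℂ → ℂ) : Prop where
  cont : Continuous Φ
  int : Integrable (fun z => ‖Φ z‖ * Real.exp (-(Real.pi / 2) * ‖z‖ ^ 2))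
  bdd : ∃ M : ℝ, ∀ z, ‖Φ z‖ * Real.exp (-(Real.pi / 2) * ‖z‖ ^ 2) ≤ M

/-- The integrand of the adjoint Bargmann transform. -/
noncomputable def adjKernel (Φ : ℂ → ℂ) (t : ℝ) (w : ℂ) : ℂ :=
  gaussWeight w * (Φ w * (starRingEnd ℂ) (bargmannKernel t w))

/-- The adjoint Bargmann transform `t ↦ ∫ Φ(w) conj(k(t, w)) dμ(w)`. -/
noncomputable def bargmannAdj (Φ : ℂ → ℂ) (t : ℝ) : ℂ := ∫ w : ℂ, adjKernel Φ t w

theorem norm_adjKernel (Φ : ℂ → ℂ) (t : ℝ) (w : ℂ) : ‖adjKernel Φ t w‖ =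
    (2 : ℝ) ^ (1 / 4 : ℝ) * Real.exp (-Real.pi * (t - w.re) ^ 2) *
      (‖Φ w‖ * Real.exp (-(Real.pi / 2) * ‖w‖ ^ 2)) := by
  rw [adjKernel, norm_mul, norm_mul, RCLike.norm_conj, norm_bargmannKernel, norm_gaussWeight,
    ← exp_neg_pi_mul_exp_half]
  ring

theorem adjKernel_continuous {Φ : ℂ → ℂ} (hΦ : Continuous Φ) :
    Continuous (fun x : ℝ × ℂ => adjKernel Φ x.1 x.2) := by
  unfold adjKernel
  have h1 := gaussWeight_smooth.continuous
  have h2 := Complex.continuous_conj.comp bargmannKernel_continuous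
  exact (h1.comp continuous_snd).mul ((hΦ.comp continuous_snd).mul h2)

theorem norm_adjKernel_le (Φ : ℂ → ℂ) (t : ℝ) (w : ℂ) : ‖adjKernel Φ t w‖ ≤
    (2 : ℝ) ^ (1 / 4 : ℝ) * (‖Φ w‖ * Real.exp (-(Real.pi / 2) * ‖w‖ ^ 2)) := by
  rw [norm_adjKernel]
  have : Real.exp (-Real.pi * (t - w.re) ^ 2) ≤ 1 := by
    refine Real.exp_le_one_iff.2 ?_
    have := mul_nonneg Real.pi_pos.le (sq_nonneg (t - w.re))
    linarith
  gcongr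
  exact mul_le_of_le_one_right (Real.rpow_nonneg zero_le_two _) this

theorem bargmannAdj_expBounded {Φ : ℂ → ℂ} (hΦ : FockDecay Φ) : ExpBounded (bargmannAdj Φ) := by
  have hc := adjKernel_continuous hΦ.cont
  refine ExpBounded.of_bounded (C := ∫ w : ℂ, (2 : ℝ) ^ (1 / 4 : ℝ) *
    (‖Φ w‖ * Real.exp (-(Real.pi / 2) * ‖w‖ ^ 2))) ?_ fun t => ?_
  · refine continuous_of_dominated (fun t => (hc.comp (by fun_prop :
      Continuous fun w : ℂ => (t, w))).aestronglyMeasurable)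
      (fun t => Filter.Eventually.of_forall fun w => norm_adjKernel_le Φ t w)
      (hΦ.int.const_mul _) (Filter.Eventually.of_forall fun w => hc.comp (by fun_prop :
      Continuous fun t : ℝ => (t, w)))
  · exact norm_integral_le_of_norm_le (hΦ.int.const_mul _)
      (Filter.Eventually.of_forall fun w => norm_adjKernel_le Φ t w)

/-- Fubini, with majorant e^{-π(t - Re w)²} times the weighted modulus of Φ: the t-integral of the
Gaussian is the same for every w. Only boundedness of u is needed, so u may be a Bargmann kernel. -/
theorem integral_mul_bargmannAdj {Φ : ℂ → ℂ} (hΦ : FockDecay Φ) {u : ℝ → ℂ} (hu : Continuous u)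
    {B : ℝ} (hB : ∀ t, ‖u t‖ ≤ B) : ∫ t, u t * bargmannAdj Φ t =
      ∫ w, gaussWeight w * (Φ w * ∫ t, u t * (starRingEnd ℂ) (bargmannKernel t w)) := by
  have hc := adjKernel_continuous hΦ.cont
  have hgi : Integrable (fun t : ℝ => Real.exp (-Real.pi * t ^ 2)) :=
    integrable_exp_neg_mul_sq Real.pi_pos
  have hmaj : Integrable (fun x : ℝ × ℂ => Real.exp (-Real.pi * (x.1 - x.2.re) ^ 2) *
      (‖Φ x.2‖ * Real.exp (-(Real.pi / 2) * ‖x.2‖ ^ 2)))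
      ((volume : Measure ℝ).prod (volume : Measure ℂ)) := by
    have hcΦ := hΦ.cont
    rw [integrable_prod_iff' (Continuous.aestronglyMeasurable (by fun_prop))]
    refine ⟨Filter.Eventually.of_forall fun w => by
      exact (hgi.comp_sub_right w.re).mul_const
        (‖Φ w‖ * Real.exp (-(Real.pi / 2) * ‖w‖ ^ 2)), ?_⟩
    have e : ∀ w : ℂ, ∫ t : ℝ, ‖Real.exp (-Real.pi * (t - w.re) ^ 2) *
        (‖Φ w‖ * Real.exp (-(Real.pi / 2) * ‖w‖ ^ 2))‖ =
        (∫ t : ℝ, Real.exp (-Real.pi * t ^ 2)) *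
        (‖Φ w‖ * Real.exp (-(Real.pi / 2) * ‖w‖ ^ 2)) := by
      intro w
      rw [← integral_sub_right_eq_self (fun t : ℝ => Real.exp (-Real.pi * t ^ 2)) w.re,
        ← integral_mul_const]
      congr 1
      funext t
      rw [Real.norm_of_nonneg (by positivity)]
    simp only [e]
    exact hΦ.int.const_mul _
  have hint : Integrable (fun x : ℝ × ℂ => u x.1 * adjKernel Φ x.1 x.2)
      ((volume : Measure ℝ).prod (volume : Measure ℂ)) := by
    refine (hmaj.const_mul (B * (2 : ℝ) ^ (1 / 4 : ℝ))).mono'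
      (((hu.comp continuous_fst).mul hc).aestronglyMeasurable)
      (Filter.Eventually.of_forall fun x => ?_)
    rw [norm_mul, norm_adjKernel]
    calc _ ≤ B * ((2 : ℝ) ^ (1 / 4 : ℝ) * Real.exp (-Real.pi * (x.1 - x.2.re) ^ 2) *
      (‖Φ x.2‖ * Real.exp (-(Real.pi / 2) * ‖x.2‖ ^ 2))) := by
          gcongr
          exact hB x.1
      _ = _ := by ring
  have hswap := integral_integral_swap (f := fun t w => u t * adjKernel Φ t w) hint
  simp only [bargmannAdj, ← integral_const_mul]
  rw [hswap]
  congr 1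
  funext w
  congr 1
  funext t
  rw [adjKernel]
  ring

theorem gaussInner_bargmann {Φ : ℂ → ℂ} (hΦ : FockDecay Φ) {f : ℝ → ℂ} (hf : Continuous f)
    {B : ℝ} (hB : ∀ t, ‖f t‖ ≤ B) :
    gaussInner (bargmann f) Φ = ∫ t, (starRingEnd ℂ) (f t) * bargmannAdj Φ t := by
  have h := integral_mul_bargmannAdj hΦ (u := fun t => (starRingEnd ℂ) (f t))
    (Complex.continuous_conj.comp hf) (B := B) (by simpa using hB)
  rw [h, gaussInner_eq]
  congr 1
  funext w
  have : ∫ t, (starRingEnd ℂ) (f t) * (starRingEnd ℂ) (bargmannKernel t w) =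
      (starRingEnd ℂ) (bargmann f w) := by
    rw [bargmann, ← integral_conj]
    simp only [map_mul]
  rw [this]
  ring

theorem conj_bargmannKernel (t : ℝ) (w : ℂ) :
    (starRingEnd ℂ) (bargmannKernel t w) = bargmannKernel t ((starRingEnd ℂ) w) := by
  simp only [bargmannKernel, map_mul, Complex.conj_ofReal, ← Complex.exp_conj, map_sub, map_add,
    map_neg, map_pow, map_div₀, map_ofNat]

/-- The kernels have the Fock reproducing kernel as Gram matrix. Conjugation turns the second kernel
into the kernel at w̄, leaving a quadratic Gaussian integral. -/
theorem integral_bargmannKernel_mul (z w : ℂ) :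
    ∫ t, bargmannKernel t z * (starRingEnd ℂ) (bargmannKernel t w) =
      Complex.exp (Real.pi * z * (starRingEnd ℂ) w) := by
  simp only [conj_bargmannKernel]
  generalize (starRingEnd ℂ) w = v
  have e : ∀ t : ℝ, bargmannKernel t z * bargmannKernel t v = (2 : ℂ) ^ (1 / 2 : ℂ) *
      Complex.exp (-(2 * Real.pi : ℂ) * t ^ 2 + 2 * Real.pi * (z + v) * t +
        (-(Real.pi * (z ^ 2 + v ^ 2) / 2))) := by
    intro t
    have h2 : (2 : ℂ) ^ (1 / 2 : ℂ) =
        (((2 : ℝ) ^ (1 / 4 : ℝ) : ℝ) : ℂ) * (((2 : ℝ) ^ (1 / 4 : ℝ) : ℝ) : ℂ) := by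
      rw [← Complex.ofReal_mul, ← Real.rpow_add two_pos, Complex.ofReal_cpow zero_le_two]
      norm_num
    rw [h2, bargmannKernel, bargmannKernel, mul_mul_mul_comm, ← Complex.exp_add]
    congr 2
    ring
  have hpi : (Real.pi : ℂ) ≠ 0 := by exact_mod_cast Real.pi_pos.ne'
  simp only [e]
  rw [integral_const_mul, integral_cexp_quadratic (by simp [Real.pi_pos]), ← mul_assoc]
  have h3 : (2 : ℂ) ^ (1 / 2 : ℂ) * ((Real.pi : ℂ) / -(-(2 * Real.pi : ℂ))) ^ (1 / 2 : ℂ) = 1 := by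
    have : (Real.pi : ℂ) / -(-(2 * Real.pi : ℂ)) = ((1 / 2 : ℝ) : ℂ) := by
      push_cast
      field_simp
    rw [this, show (2 : ℂ) = ((2 : ℝ) : ℂ) by norm_num, show (1 / ((2 : ℝ) : ℂ)) =
      ((1 / 2 : ℝ) : ℂ) by push_cast; rfl, ← Complex.ofReal_cpow (by norm_num),
      ← Complex.ofReal_cpow (by norm_num), ← Complex.ofReal_mul,
      ← Real.mul_rpow (by norm_num) (by norm_num)]
    norm_num
  rw [h3, one_mul]
  congr 1
  field_simp
  ring

theorem integrable_gauss_norm {b : ℝ} (hb : 0 < b) :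
    Integrable (fun z : ℂ => Real.exp (-b * ‖z‖ ^ 2)) := by
  have h := GaussianFourier.integrable_cexp_neg_mul_sq_norm_add (V := ℂ) (b := (b : ℂ))
    (by simpa using hb) 0 0
  refine h.norm.congr (Filter.Eventually.of_forall fun z => ?_)
  simp [Complex.norm_exp, ← Complex.ofReal_pow]

theorem integral_gaussWeight : ∫ w : ℂ, ((Real.exp (-Real.pi * ‖w‖ ^ 2) : ℝ) : ℂ) = 1 := by
  rw [integral_complex_ofReal, GaussianFourier.integral_rexp_neg_mul_sq_norm Real.pi_pos,
    Complex.finrank_real_complex]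
  simp [Real.pi_pos.ne']

/-- The reproducing formula of the Fock space. -/
theorem reproducing {Φ : ℂ → ℂ} (hd : Differentiable ℂ Φ) (hΦ : FockDecay Φ) (z : ℂ) :
    ∫ w, gaussWeight w * (Φ w * Complex.exp (Real.pi * z * (starRingEnd ℂ) w)) = Φ z := by
  obtain ⟨M, hM⟩ := hΦ.bdd
  -- After translation by z the integrand is a radial Gaussian times the entire function `weylShift
  -- z Φ`, whose value at 0 is Φ(z).
  rw [← integral_add_left_eq_self _ z]
  have e : ∀ u : ℂ, gaussWeight (z + u) * (Φ (z + u) *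
      Complex.exp (Real.pi * z * (starRingEnd ℂ) (z + u))) =
      ((Real.exp (-Real.pi * ‖u‖ ^ 2) : ℝ) : ℂ) * weylShift z Φ u := by
    intro u
    rw [← gaussWeight_eq, gaussWeight, gaussWeight, weylShift, mul_left_comm, ← Complex.exp_add,
      mul_left_comm _ (Φ (z + u)), ← Complex.exp_add]
    congr 2
    rw [map_add]
    ring
  simp only [e]
  have hi : Integrable (fun u : ℂ => M * Real.exp (Real.pi / 2 * ‖z‖ ^ 2) *
      Real.exp (-(Real.pi / 2) * ‖u‖ ^ 2)) :=
    (integrable_gauss_norm (by positivity)).const_mul _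
  rw [integral_radial_mul_entire (weylShift_entire hd z)
    (ρ := fun r => Real.exp (-Real.pi * r ^ 2)) (by fun_prop) hi, integral_gaussWeight, one_mul]
  · simp [weylShift]
  · intro w u hu
    rw [norm_weylShift, ← hu, Real.norm_of_nonneg (Real.exp_pos _).le]
    calc Real.exp (-Real.pi * ‖u‖ ^ 2) * (‖Φ (z + u)‖ *
          Real.exp (-(Real.pi / 2) * ‖z + u‖ ^ 2) * Real.exp (Real.pi / 2 * ‖u‖ ^ 2) *
          Real.exp (Real.pi / 2 * ‖z‖ ^ 2))
        = ‖Φ (z + u)‖ * Real.exp (-(Real.pi / 2) * ‖z + u‖ ^ 2) *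
          Real.exp (Real.pi / 2 * ‖z‖ ^ 2) * (Real.exp (-Real.pi * ‖u‖ ^ 2) *
          Real.exp (Real.pi / 2 * ‖u‖ ^ 2)) := by ring
      _ ≤ _ := by
        rw [exp_neg_pi_mul_exp_half]
        gcongr
        exact hM _

theorem bargmann_bargmannAdj {Φ : ℂ → ℂ} (hd : Differentiable ℂ Φ) (hΦ : FockDecay Φ) :
    bargmann (bargmannAdj Φ) = Φ := by
  funext z
  have hB : ∀ t : ℝ, ‖bargmannKernel t z‖ ≤ (2 : ℝ) ^ (1 / 4 : ℝ) *
      Real.exp (Real.pi / 2 * ‖z‖ ^ 2) := by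
    intro t
    rw [norm_bargmannKernel]
    have : Real.exp (-Real.pi * (t - z.re) ^ 2) ≤ 1 := by
      refine Real.exp_le_one_iff.2 ?_
      have := mul_nonneg Real.pi_pos.le (sq_nonneg (t - z.re))
      linarith
    gcongr
    exact mul_le_of_le_one_right (Real.rpow_nonneg zero_le_two _) this
  have h := integral_mul_bargmannAdj hΦ (bargmannKernel_continuous.comp
    (by fun_prop : Continuous fun t : ℝ => (t, z))) hB
  simp only [Function.comp_apply, integral_bargmannKernel_mul] at h
  rw [reproducing hd hΦ z] at h
  rw [← h, bargmann]
  congr 1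
  funext t
  ring

/-- A right inverse of an injective map is a left inverse on its domain: both sides have the same
Bargmann transform. -/
theorem bargmannAdj_bargmann {f : ℝ → ℂ} (hf : ExpBounded f) (hΦ : FockDecay (bargmann f)) :
    bargmannAdj (bargmann f) = f := by
  have h1 := bargmannAdj_expBounded hΦ
  have h2 := h1.add ((ExpBounded.const (-1)).mul hf)
  have h3 := eq_zero_of_bargmann_eq_zero h2 (by
    funext z
    have e := congrFun (bargmann_bargmannAdj (bargmann_entire hf) hΦ) z
    simp only [bargmann] at e ⊢
    simp only [add_mul, mul_assoc]
    rw [integral_add (integrable_mul_bargmannKernel h1 z)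
      ((integrable_mul_bargmannKernel hf z).const_mul _), integral_const_mul]
    simp only [Pi.zero_apply]
    linear_combination e)
  funext t
  have := congrFun h3 t
  simp only [Pi.zero_apply] at this
  linear_combination this

theorem gaussInner_bargmann_bargmann {f g : ℝ → ℂ} (hf : Continuous f) {B : ℝ}
    (hB : ∀ t, ‖f t‖ ≤ B) (hg : ExpBounded g) (hΦ : FockDecay (bargmann g)) :
    gaussInner (bargmann f) (bargmann g) = ∫ t, (starRingEnd ℂ) (f t) * g t := by
  rw [gaussInner_bargmann hΦ hf hB, bargmannAdj_bargmann hg hΦ]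

/-! ### Weights -/

/-- Convexity gives the factor 2^{q-1}, which is at most 2 because q ≤ 2. -/
theorem rpow_le_two_mul {q : ℝ} (h1 : 1 ≤ q) (h2 : q ≤ 2) {a b c : ℝ} (ha : 0 ≤ a) (hb : 0 ≤ b)
    (hc : 0 ≤ c) (h : a ≤ b + c) : a ^ q ≤ 2 * (b ^ q + c ^ q) := by
  refine (Real.rpow_le_rpow ha h (by linarith)).trans ?_
  have h4 : (b + c) ^ q ≤ 2 ^ (q - 1) * (b ^ q + c ^ q) := by
    exact_mod_cast NNReal.rpow_add_le_mul_rpow_add_rpow ⟨b, hb⟩ ⟨c, hc⟩ h1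
  refine h4.trans ?_
  have h3 : (2 : ℝ) ^ (q - 1) ≤ 2 := by
    calc (2 : ℝ) ^ (q - 1) ≤ 2 ^ (1 : ℝ) :=
          Real.rpow_le_rpow_of_exponent_le one_le_two (by linarith)
      _ = 2 := Real.rpow_one 2
  have := Real.rpow_nonneg hb q
  have := Real.rpow_nonneg hc q
  gcongr

theorem sub_one_le_rpow {q r : ℝ} (h1 : 1 ≤ q) (hr : 0 ≤ r) : r - 1 ≤ r ^ q := by
  rcases le_total r 1 with h | h
  · have := Real.rpow_nonneg hr q
    linarith
  · have : r ^ (1 : ℝ) ≤ r ^ q := Real.rpow_le_rpow_of_exponent_le h h1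
    rw [Real.rpow_one] at this
    linarith

/-- Exponential decay from factorial moment bounds. -/
theorem le_exp_of_moments {α : ℝ} (h1 : 1 / 2 ≤ α) (h2 : α ≤ 1) {s y N D : ℝ} (hs : 0 ≤ s)
    (hy : 0 ≤ y) (hN : 0 ≤ N) (hD : 0 < D)
    (h : ∀ k : ℕ, s ^ k * y ≤ N * D ^ k * (k.factorial : ℝ) ^ α) :
    y ≤ 2 * N * Real.exp (-(1 / 4 * (s / D) ^ (1 / α))) := by
  have hα : 0 < α := by linarith
  rcases hN.eq_or_lt with rfl | hN
  · have := h 0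
    simp at this
    simpa using this
  -- Taking powers 1/α turns (k!)^α into k!, so that the hypotheses can be summed against an
  -- exponential series.
  set X : ℝ := (s / D) ^ (1 / α) with hX
  have hsD : 0 ≤ s / D := div_nonneg hs hD.le
  have hX0 : 0 ≤ X := Real.rpow_nonneg hsD _
  set Y : ℝ := (y / N) ^ (1 / α) with hY
  have hyN : 0 ≤ y / N := div_nonneg hy hN.le
  have hY0 : 0 ≤ Y := Real.rpow_nonneg hyN _
  have hk : ∀ k : ℕ, X ^ k * Y ≤ k.factorial := by
    intro k
    have e1 : X ^ k * Y = ((s / D) ^ k * (y / N)) ^ (1 / α) := by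
      rw [Real.mul_rpow (pow_nonneg hsD k) hyN, hX, ← Real.rpow_natCast, ← Real.rpow_mul hsD,
        ← Real.rpow_natCast (s / D), ← Real.rpow_mul hsD, mul_comm (1 / α)]
    have e2 : (s / D) ^ k * (y / N) ≤ (k.factorial : ℝ) ^ α := by
      have := h k
      rw [div_pow, div_mul_div_comm, div_le_iff₀ (by positivity)]
      linarith
    rw [e1]
    refine (Real.rpow_le_rpow (by positivity) e2 (by positivity)).trans (le_of_eq ?_)
    rw [← Real.rpow_mul (by positivity), mul_one_div_cancel hα.ne', Real.rpow_one]
  -- Halving X leaves the geometric series ∑ 2⁻ᵏ as a majorant.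
  have hsum : Real.exp (X / 2) * Y ≤ 2 := by
    have e1 : HasSum (fun k : ℕ => (X / 2) ^ k / k.factorial * Y) (Real.exp (X / 2) * Y) := by
      rw [Real.exp_eq_exp_ℝ]
      exact (NormedSpace.expSeries_div_hasSum_exp (X / 2)).mul_right Y
    refine hasSum_le (fun k => ?_) e1 hasSum_geometric_two
    have hf : (0 : ℝ) < k.factorial := by exact_mod_cast k.factorial_pos
    rw [div_pow, div_div, div_mul_eq_mul_div, one_div_pow, div_le_div_iff₀ (by positivity)
      (by positivity), one_mul]
    nlinarith [hk k, pow_pos (two_pos : (0 : ℝ) < 2) k]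
  have h3 : Y ≤ 2 * Real.exp (-(X / 2)) := by
    rw [Real.exp_neg, ← div_eq_mul_inv, le_div_iff₀ (Real.exp_pos _)]
    linarith
  have h4 : y / N ≤ 2 * Real.exp (-(1 / 4 * X)) := by
    have e1 : y / N = Y ^ α := by
      rw [hY, ← Real.rpow_mul hyN, one_div_mul_cancel hα.ne', Real.rpow_one]
    rw [e1]
    refine (Real.rpow_le_rpow hY0 h3 hα.le).trans ?_
    rw [Real.mul_rpow zero_le_two (Real.exp_pos _).le, ← Real.exp_mul]
    -- α ≤ 1 gives 2^α ≤ 2, and α ≥ 1/2 gives αX/2 ≥ X/4.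
    refine mul_le_mul ?_ (Real.exp_le_exp.2 ?_) (Real.exp_pos _).le zero_le_two
    · calc (2 : ℝ) ^ α ≤ 2 ^ (1 : ℝ) := Real.rpow_le_rpow_of_exponent_le one_le_two h2
        _ = 2 := Real.rpow_one 2
    · nlinarith
  rw [div_le_iff₀ hN] at h4
  linarith

/-- The inequality xᵏ/k! ≤ eˣ at x = b s^{1/α}, raised to the power α. It trades polynomial factors
for a small part of the exponential weight. -/
theorem pow_le_factorial_mul_exp {α : ℝ} (hα : 0 < α) {b s : ℝ} (hb : 0 < b) (hs : 0 ≤ s)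
    (k : ℕ) : s ^ k ≤ (k.factorial : ℝ) ^ α * (b ^ (-α)) ^ k * Real.exp (α * b * s ^ (1 / α)) := by
  have hq : 0 ≤ s ^ (1 / α) := Real.rpow_nonneg hs _
  have h := Real.pow_div_factorial_le_exp (b * s ^ (1 / α)) (by positivity) k
  have hf : (0 : ℝ) < k.factorial := by exact_mod_cast k.factorial_pos
  rw [div_le_iff₀ hf] at h
  have h2 := Real.rpow_le_rpow (by positivity) h hα.le
  rw [Real.mul_rpow (Real.exp_pos _).le hf.le, ← Real.exp_mul, mul_pow,
    Real.mul_rpow (by positivity) (by positivity)] at h2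
  have e1 : ((s ^ (1 / α)) ^ k) ^ α = s ^ k := by
    rw [← Real.rpow_natCast, ← Real.rpow_mul hs, ← Real.rpow_mul hs, ← Real.rpow_natCast]
    congr 1
    field_simp
  have e2 : (b ^ k) ^ α * (b ^ (-α)) ^ k = 1 := by
    rw [← Real.rpow_natCast, ← Real.rpow_natCast, ← Real.rpow_mul hb.le, ← Real.rpow_mul hb.le,
      ← Real.rpow_add hb]
    have : (k : ℝ) * α + -α * k = 0 := by ring
    rw [this, Real.rpow_zero]
  rw [e1] at h2
  have h3 : 0 ≤ (b ^ (-α)) ^ k := by positivity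
  calc s ^ k = ((b ^ k) ^ α * s ^ k) * (b ^ (-α)) ^ k := by
        linear_combination (-(s ^ k)) * e2
    _ ≤ (Real.exp (b * s ^ (1 / α) * α) * (k.factorial : ℝ) ^ α) * (b ^ (-α)) ^ k := by gcongr
    _ = _ := by
      rw [show b * s ^ (1 / α) * α = α * b * s ^ (1 / α) by ring]
      ring

/-- The exponent 3 is chosen to exceed the real dimensions 1 and 2 in which integrability is needed.
-/
theorem exp_neg_rpow_le {q : ℝ} (hq : 1 ≤ q) {b : ℝ} (hb : 0 < b) {r : ℝ} (hr : 0 ≤ r) :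
    Real.exp (-b * r ^ q) ≤ 6 * Real.exp (2 * b) / b ^ 3 * (1 + r) ^ (-3 : ℝ) := by
  have h1 : Real.exp (-b * r ^ q) ≤ Real.exp (2 * b) * Real.exp (-(b * (1 + r))) := by
    rw [← Real.exp_add]
    refine Real.exp_le_exp.2 ?_
    have := mul_le_mul_of_nonneg_left (sub_one_le_rpow hq hr) hb.le
    linarith
  have h2 := Real.pow_div_factorial_le_exp (b * (1 + r)) (by positivity) 3
  have h3 : (1 + r) ^ (-3 : ℝ) = 1 / (1 + r) ^ 3 := by
    rw [Real.rpow_neg (by positivity), one_div]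
    norm_cast
  rw [h3]
  refine h1.trans ?_
  rw [Real.exp_neg]
  have h4 : 0 < (b * (1 + r)) ^ 3 / (Nat.factorial 3 : ℝ) := by positivity
  calc Real.exp (2 * b) * (Real.exp (b * (1 + r)))⁻¹ ≤
      Real.exp (2 * b) * ((b * (1 + r)) ^ 3 / (Nat.factorial 3 : ℝ))⁻¹ := by gcongr
    _ = _ := by
      rw [show (Nat.factorial 3 : ℝ) = 6 by norm_num [Nat.factorial]]
      field_simp

theorem integrable_exp_neg_rpow {E : Type*} [NormedAddCommGroup E] [NormedSpace ℝ E]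
    [FiniteDimensional ℝ E] [MeasurableSpace E] [BorelSpace E] (μ : Measure E)
    [μ.IsAddHaarMeasure] (hE : Module.finrank ℝ E ≤ 2) {q : ℝ} (hq : 1 ≤ q) {b : ℝ} (hb : 0 < b) :
    Integrable (fun w : E => Real.exp (-b * ‖w‖ ^ q)) μ := by
  have hE' : (Module.finrank ℝ E : ℝ) < 3 := by
    have : (Module.finrank ℝ E : ℝ) ≤ 2 := by exact_mod_cast hE
    linarith
  refine ((integrable_one_add_norm (μ := μ) hE').const_mul
    (6 * Real.exp (2 * b) / b ^ 3)).mono' ?_ (Filter.Eventually.of_forall fun w => ?_)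
  · have hq0 : 0 ≤ q := by linarith
    have : Continuous fun w : E => ‖w‖ ^ q := continuous_norm.rpow_const fun _ => Or.inr hq0
    exact Continuous.aestronglyMeasurable (by fun_prop)
  · rw [Real.norm_of_nonneg (Real.exp_pos _).le]
    exact exp_neg_rpow_le hq hb (norm_nonneg w)

theorem memLp_exp_neg_rpow {p : ℝ≥0∞} (hp : 1 ≤ p) {q : ℝ} (hq : 1 ≤ q) {b : ℝ} (hb : 0 < b) :
    MemLp (fun w : ℂ => Real.exp (-b * ‖w‖ ^ q)) p volume := by
  have hq0 : 0 ≤ q := by linarith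
  have hc : Continuous fun w : ℂ => ‖w‖ ^ q := continuous_norm.rpow_const fun _ => Or.inr hq0
  have hm : AEStronglyMeasurable (fun w : ℂ => Real.exp (-b * ‖w‖ ^ q)) volume :=
    Continuous.aestronglyMeasurable (by fun_prop)
  rcases eq_or_ne p ∞ with rfl | hp'
  · refine memLp_top_of_bound hm 1 (Filter.Eventually.of_forall fun w => ?_)
    rw [Real.norm_of_nonneg (Real.exp_pos _).le, Real.exp_le_one_iff]
    have := mul_nonneg hb.le (Real.rpow_nonneg (norm_nonneg w) q)
    linarith
  · have hp0 : p ≠ 0 := (lt_of_lt_of_le one_pos hp).ne'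
    have hpr : 0 < p.toReal := ENNReal.toReal_pos hp0 hp'
    rw [← integrable_norm_rpow_iff hm hp0 hp']
    have := integrable_exp_neg_rpow (volume : Measure ℂ) (by simp) hq (mul_pos hb hpr)
    refine this.congr (Filter.Eventually.of_forall fun w => ?_)
    simp only [Real.norm_of_nonneg (Real.exp_pos _).le]
    rw [← Real.exp_mul]
    congr 1
    ring

/-- The function `c u^q` is dominated by `δ u²` up to a constant. -/
def Tame (q c δ : ℝ) : Prop := ∃ K : ℝ, ∀ u : ℝ, 0 ≤ u → c * u ^ q ≤ K + δ * u ^ 2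

theorem Tame.mono {q c c' δ : ℝ} (h : Tame q c δ) (hc : c' ≤ c) : Tame q c' δ := by
  obtain ⟨K, hK⟩ := h
  refine ⟨K, fun u hu => (mul_le_mul_of_nonneg_right hc (Real.rpow_nonneg hu q)).trans (hK u hu)⟩

/-- The case that includes the critical exponent q = 2, where the coefficient cannot be arbitrary.
It serves the inductive limit. -/
theorem tame_of_le {q c δ : ℝ} (hq : q ≤ 2) (hq0 : 0 ≤ q) (hc : 0 ≤ c) (h : c ≤ δ) :
    Tame q c δ := by
  refine ⟨c, fun u hu => ?_⟩
  rcases le_total u 1 with h1 | h1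
  · have : u ^ q ≤ 1 := Real.rpow_le_one hu h1 hq0
    nlinarith [mul_nonneg (hc.trans h) (sq_nonneg u)]
  · have : u ^ q ≤ u ^ (2 : ℝ) := Real.rpow_le_rpow_of_exponent_le h1 hq
    rw [Real.rpow_two] at this
    nlinarith [sq_nonneg u]

/-- Below the critical exponent u^q = o(u²), so every coefficient is allowed, as the projective
limit requires. -/
theorem tame_of_lt {q : ℝ} (hq : q < 2) (hq0 : 0 ≤ q) (c : ℝ) {δ : ℝ} (hδ : 0 < δ) :
    Tame q c δ := by
  suffices h : Tame q (max c 0) δ from h.mono (le_max_left _ _)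
  set c' := max c 0 with hc'
  have hc0 : 0 ≤ c' := le_max_right _ _
  have ht := tendsto_rpow_neg_atTop (sub_pos.2 hq)
  have hev := (ht.const_mul c').eventually_lt_const (u := δ) (by simpa using hδ)
  obtain ⟨R, hR⟩ := (hev.and (Filter.eventually_ge_atTop 1)).exists_forall_of_atTop
  refine ⟨c' * (max R 0) ^ q, fun u hu => ?_⟩
  rcases le_total u R with h1 | h1
  · have : u ^ q ≤ (max R 0) ^ q := Real.rpow_le_rpow hu (h1.trans (le_max_left _ _)) hq0
    have := mul_le_mul_of_nonneg_left this hc0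
    have := mul_nonneg hδ.le (sq_nonneg u)
    linarith
  · obtain ⟨h2, h3⟩ := hR u h1
    have hu0 : 0 < u := by linarith
    have e : u ^ q = u ^ (-(2 - q)) * u ^ 2 := by
      rw [← Real.rpow_natCast u 2, ← Real.rpow_add hu0]
      congr 1
      push_cast
      ring
    have h4 : 0 ≤ c' * (max R 0) ^ q := by positivity
    rw [e, ← mul_assoc]
    have := mul_le_mul_of_nonneg_right h2.le (sq_nonneg u)
    linarith

/-! ### Decay of the Bargmann transform on Gel'fand–Shilov functions -/

/-- The Gel'fand–Shilov estimates with constant `N`. -/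
structure GSBound (α A N : ℝ) (f : ℝ → ℂ) : Prop where
  smooth : ContDiff ℝ ∞ f
  bound : ∀ (k l : ℕ) (x : ℝ), |x| ^ k * ‖iteratedDeriv l f x‖ ≤
    N * A ^ (k + l) * (k.factorial : ℝ) ^ α * (l.factorial : ℝ) ^ α

theorem GSBound.nonneg {α A N : ℝ} {f : ℝ → ℂ} (h : GSBound α A N f) : 0 ≤ N := by
  have := h.bound 0 0 0
  simp only [pow_zero, one_mul, add_zero, mul_one, Nat.factorial_zero, Nat.cast_one,
    Real.one_rpow] at this
  exact (norm_nonneg _).trans this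

theorem one_le_inv {α : ℝ} (h1 : 1 / 2 ≤ α) (h2 : α ≤ 1) : 1 ≤ 1 / α := by
  rw [le_div_iff₀ (by linarith)]
  linarith

theorem inv_le_two {α : ℝ} (h1 : 1 / 2 ≤ α) : 1 / α ≤ 2 := by
  rw [div_le_iff₀ (by linarith)]
  linarith

theorem GSBound.decay {α A N : ℝ} {f : ℝ → ℂ} (h : GSBound α A N f) (h1 : 1 / 2 ≤ α)
    (h2 : α ≤ 1) (hA : 0 < A) (l : ℕ) (x : ℝ) : ‖iteratedDeriv l f x‖ ≤
      2 * (N * A ^ l * (l.factorial : ℝ) ^ α) *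
        Real.exp (-(1 / 4 * A ^ (-(1 / α))) * |x| ^ (1 / α)) := by
  have hN := h.nonneg
  have := le_exp_of_moments h1 h2 (abs_nonneg x) (norm_nonneg (iteratedDeriv l f x))
    (N := N * A ^ l * (l.factorial : ℝ) ^ α) (by positivity) hA (fun k => by
      refine (h.bound k l x).trans (le_of_eq ?_)
      rw [pow_add]
      ring)
  rw [Real.div_rpow (abs_nonneg x) hA.le] at this
  refine this.trans (le_of_eq ?_)
  rw [Real.rpow_neg hA.le]
  congr 2
  ring

theorem integrable_exp_neg_abs_rpow {q : ℝ} (hq : 1 ≤ q) {b : ℝ} (hb : 0 < b) :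
    Integrable (fun x : ℝ => Real.exp (-b * |x| ^ q)) := by
  simpa using integrable_exp_neg_rpow (volume : Measure ℝ) (by simp) hq hb

theorem GSBound.integrable {α A N : ℝ} {f : ℝ → ℂ} (h : GSBound α A N f) (h1 : 1 / 2 ≤ α)
    (h2 : α ≤ 1) (hA : 0 < A) (l : ℕ) : Integrable (iteratedDeriv l f) := by
  have hb : 0 < 1 / 4 * A ^ (-(1 / α)) := by positivity
  refine ((integrable_exp_neg_abs_rpow (one_le_inv h1 h2) hb).const_mul
    (2 * (N * A ^ l * (l.factorial : ℝ) ^ α))).mono' ?_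
    (Filter.Eventually.of_forall fun x => h.decay h1 h2 hA l x)
  exact (h.smooth.continuous_iteratedDeriv l (by exact_mod_cast le_top)).aestronglyMeasurable

theorem GSBound.bounded {α A N : ℝ} {f : ℝ → ℂ} (h : GSBound α A N f) (t : ℝ) : ‖f t‖ ≤ N := by
  simpa using h.bound 0 0 t

theorem GSBound.expBounded {α A N : ℝ} {f : ℝ → ℂ} (h : GSBound α A N f) : ExpBounded f :=
  .of_bounded h.smooth.continuous h.bounded

open FourierTransform in
-- Derivatives of f become powers of ξ, so the factorial bounds in l are moment bounds for the
-- Fourier transform. Decay in x supplies the integrability.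
theorem fourier_decay {α : ℝ} (h1 : 1 / 2 ≤ α) (h2 : α ≤ 1) {A : ℝ} (hA : 0 < A) :
    ∃ K : ℝ, 0 ≤ K ∧ ∀ (N : ℝ) (f : ℝ → ℂ), GSBound α A N f → ∀ ξ : ℝ, ‖𝓕 f ξ‖ ≤
      K * N * Real.exp (-(1 / 4 * A ^ (-(1 / α))) * |ξ| ^ (1 / α)) := by
  set b : ℝ := 1 / 4 * A ^ (-(1 / α)) with hb
  have hb0 : 0 < b := by positivity
  set J : ℝ := ∫ x : ℝ, Real.exp (-b * |x| ^ (1 / α)) with hJ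
  have hJ0 : 0 ≤ J := integral_nonneg fun x => (Real.exp_pos _).le
  refine ⟨4 * J, by positivity, fun N f h ξ => ?_⟩
  have hN := h.nonneg
  have hF : ∀ l : ℕ, |ξ| ^ l * ‖𝓕 f ξ‖ ≤ 2 * N * J * A ^ l * (l.factorial : ℝ) ^ α := by
    intro l
    have e := congrFun (Real.fourier_iteratedDeriv (N := ⊤) (n := l) h.smooth
      (fun n _ => h.integrable h1 h2 hA n) le_top) ξ
    have e2 : ‖𝓕 (iteratedDeriv l f) ξ‖ = (2 * Real.pi * |ξ|) ^ l * ‖𝓕 f ξ‖ := by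
      rw [e, norm_smul, norm_pow]
      congr 2
      rw [norm_mul, norm_mul, norm_mul, Complex.norm_I, Complex.norm_real, Complex.norm_real,
        Real.norm_of_nonneg Real.pi_pos.le, Real.norm_eq_abs]
      simp
    have e3 : ‖𝓕 (iteratedDeriv l f) ξ‖ ≤ 2 * (N * A ^ l * (l.factorial : ℝ) ^ α) * J := by
      rw [Real.fourier_eq', hJ, ← integral_const_mul]
      refine norm_integral_le_of_norm_le
        ((integrable_exp_neg_abs_rpow (one_le_inv h1 h2) hb0).const_mul _)
        (Filter.Eventually.of_forall fun x => ?_)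
      rw [norm_smul, Complex.norm_exp_ofReal_mul_I, one_mul]
      exact h.decay h1 h2 hA l x
    have e4 : |ξ| ^ l ≤ (2 * Real.pi * |ξ|) ^ l := by
      refine pow_le_pow_left₀ (abs_nonneg _) ?_ l
      have := Real.pi_gt_three
      nlinarith [abs_nonneg ξ]
    calc |ξ| ^ l * ‖𝓕 f ξ‖ ≤ (2 * Real.pi * |ξ|) ^ l * ‖𝓕 f ξ‖ := by gcongr
      _ ≤ _ := by rw [← e2]; exact e3.trans (le_of_eq (by ring))
  have := le_exp_of_moments h1 h2 (abs_nonneg ξ) (norm_nonneg _) (by positivity) hA hF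
  rw [Real.div_rpow (abs_nonneg ξ) hA.le] at this
  refine this.trans (le_of_eq ?_)
  rw [hb, Real.rpow_neg hA.le]
  rw [show 2 * (2 * N * J) = 4 * J * N by ring]
  congr 2
  ring

open FourierTransform in
-- On the Fock side the Fourier transform is a rotation by a right angle; this transfers decay from
-- Re z to Im z.
theorem fourier_bargmannKernel (z : ℂ) (t : ℝ) :
    𝓕 (fun ξ : ℝ => bargmannKernel ξ (Complex.I * z)) t = bargmannKernel t z := by
  rw [Real.fourier_real_eq_integral_exp_smul]
  have hpi : (Real.pi : ℂ) ≠ 0 := by exact_mod_cast Real.pi_pos.ne'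
  have e : ∀ ξ : ℝ, Complex.exp ((-2 * Real.pi * ξ * t : ℝ) * Complex.I) •
      bargmannKernel ξ (Complex.I * z) = ((2 : ℝ) ^ (1 / 4 : ℝ) : ℝ) *
      Complex.exp (-(Real.pi : ℂ) * ξ ^ 2 + 2 * Real.pi * Complex.I * (z - t) * ξ +
        Real.pi * z ^ 2 / 2) := by
    intro ξ
    rw [bargmannKernel, smul_eq_mul, mul_left_comm, ← Complex.exp_add]
    congr 2
    push_cast
    linear_combination (-(Real.pi : ℂ) * z ^ 2 / 2) * Complex.I_sq
  simp only [e]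
  rw [integral_const_mul, integral_cexp_quadratic (by simp [Real.pi_pos]), bargmannKernel]
  rw [neg_neg, div_self hpi, Complex.one_cpow, one_mul]
  congr 2
  have : (2 * (Real.pi : ℂ) * Complex.I * (z - t)) ^ 2 = -(4 * (Real.pi : ℂ) ^ 2 * (z - t) ^ 2) := by
    rw [mul_pow, mul_pow, Complex.I_sq]
    ring
  rw [this]
  field_simp
  ring

open FourierTransform in
theorem bargmann_fourier {f : ℝ → ℂ} (hf : Integrable f) (z : ℂ) :
    bargmann (𝓕 f) (Complex.I * z) = bargmann f z := by
  have hg : Integrable (fun ξ : ℝ => bargmannKernel ξ (Complex.I * z)) := by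
    simpa using integrable_mul_bargmannKernel (ExpBounded.const 1) (Complex.I * z)
  have h := VectorFourier.integral_fourierIntegral_smul_eq_flip (L := innerₗ ℝ)
    Real.continuous_fourierChar continuous_inner hf hg
  simp only [flip_innerₗ, smul_eq_mul] at h
  have h' : ∫ ξ, 𝓕 f ξ * bargmannKernel ξ (Complex.I * z) =
      ∫ x, f x * 𝓕 (fun ξ : ℝ => bargmannKernel ξ (Complex.I * z)) x := h
  simp only [fourier_bargmannKernel] at h'
  exact h'

theorem continuous_abs_rpow {q : ℝ} (hq : 0 ≤ q) : Continuous fun u : ℝ => |u| ^ q :=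
  continuous_abs.rpow_const fun _ => Or.inr hq

theorem integrable_exp_tame {q b δ : ℝ} (hq : 0 ≤ q) (hδ : δ < Real.pi) (h : Tame q b δ) :
    Integrable (fun u : ℝ => Real.exp (b * |u| ^ q - Real.pi * u ^ 2)) := by
  obtain ⟨K, hK⟩ := h
  refine ((integrable_exp_neg_mul_sq (sub_pos.2 hδ)).const_mul (Real.exp K)).mono' ?_
    (Filter.Eventually.of_forall fun u => ?_)
  · have := continuous_abs_rpow hq
    exact Continuous.aestronglyMeasurable (by fun_prop)
  · rw [Real.norm_of_nonneg (Real.exp_pos _).le, ← Real.exp_add]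
    refine Real.exp_le_exp.2 ?_
    have := hK |u| (abs_nonneg u)
    rw [sq_abs] at this
    linarith

/-- The weighted kernel is a Gaussian centred at Re z. Splitting |Re z|^q between |t|^q and |t - Re
z|^q moves half the decay rate of g to Re z, and the Gaussian absorbs the second piece. -/
theorem norm_bargmann_le {q b δ : ℝ} (h1 : 1 ≤ q) (h2 : q ≤ 2) (hb : 0 < b) (hδ : δ < Real.pi)
    (h : Tame q b δ) {g : ℝ → ℂ} {N : ℝ} (hg : ∀ t, ‖g t‖ ≤ N * Real.exp (-b * |t| ^ q)) (z : ℂ) :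
    ‖bargmann g z‖ * Real.exp (-(Real.pi / 2) * ‖z‖ ^ 2) ≤
      (2 : ℝ) ^ (1 / 4 : ℝ) * N * (∫ u : ℝ, Real.exp (b * |u| ^ q - Real.pi * u ^ 2)) *
        Real.exp (-(b / 2) * |z.re| ^ q) := by
  have hq : 0 ≤ q := by linarith
  have hN : 0 ≤ N := by
    by_contra hN
    have h3 := (norm_nonneg _).trans (hg 0)
    nlinarith [Real.exp_pos (-b * |(0 : ℝ)| ^ q)]
  have hint := (integrable_exp_tame hq hδ h).comp_sub_right z.re
  have hb' : ‖bargmann g z‖ ≤ ∫ t : ℝ, (2 : ℝ) ^ (1 / 4 : ℝ) * N *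
      Real.exp (-(b / 2) * |z.re| ^ q) * Real.exp (Real.pi / 2 * ‖z‖ ^ 2) *
      Real.exp (b * |t - z.re| ^ q - Real.pi * (t - z.re) ^ 2) := by
    refine norm_integral_le_of_norm_le (hint.const_mul _) (Filter.Eventually.of_forall fun t => ?_)
    rw [norm_mul, norm_bargmannKernel]
    have hw : |z.re| ^ q ≤ 2 * (|t| ^ q + |t - z.re| ^ q) := by
      refine rpow_le_two_mul h1 h2 (abs_nonneg _) (abs_nonneg _) (abs_nonneg _) ?_
      have : z.re = t - (t - z.re) := by ring
      calc |z.re| = |t - (t - z.re)| := by rw [← this]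
        _ ≤ _ := abs_sub _ _
    have he : Real.exp (-b * |t| ^ q) * Real.exp (-Real.pi * (t - z.re) ^ 2) ≤
        Real.exp (-(b / 2) * |z.re| ^ q) *
          Real.exp (b * |t - z.re| ^ q - Real.pi * (t - z.re) ^ 2) := by
      rw [← Real.exp_add, ← Real.exp_add]
      refine Real.exp_le_exp.2 ?_
      have := mul_le_mul_of_nonneg_left hw (half_pos hb).le
      linarith
    calc ‖g t‖ * ((2 : ℝ) ^ (1 / 4 : ℝ) * Real.exp (-Real.pi * (t - z.re) ^ 2) *
          Real.exp (Real.pi / 2 * ‖z‖ ^ 2))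
        ≤ (N * Real.exp (-b * |t| ^ q)) * ((2 : ℝ) ^ (1 / 4 : ℝ) *
          Real.exp (-Real.pi * (t - z.re) ^ 2) * Real.exp (Real.pi / 2 * ‖z‖ ^ 2)) := by
          gcongr
          exact hg t
      _ = (2 : ℝ) ^ (1 / 4 : ℝ) * N * Real.exp (Real.pi / 2 * ‖z‖ ^ 2) *
          (Real.exp (-b * |t| ^ q) * Real.exp (-Real.pi * (t - z.re) ^ 2)) := by ring
      _ ≤ (2 : ℝ) ^ (1 / 4 : ℝ) * N * Real.exp (Real.pi / 2 * ‖z‖ ^ 2) *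
          (Real.exp (-(b / 2) * |z.re| ^ q) *
          Real.exp (b * |t - z.re| ^ q - Real.pi * (t - z.re) ^ 2)) := by gcongr
      _ = _ := by ring
  rw [integral_const_mul, integral_sub_right_eq_self
    (fun t : ℝ => Real.exp (b * |t| ^ q - Real.pi * t ^ 2)) z.re] at hb'
  calc _ ≤ _ := mul_le_mul_of_nonneg_right hb' (Real.exp_pos _).le
    _ = (2 : ℝ) ^ (1 / 4 : ℝ) * N * (∫ u : ℝ, Real.exp (b * |u| ^ q - Real.pi * u ^ 2)) *
        Real.exp (-(b / 2) * |z.re| ^ q) * (Real.exp (Real.pi / 2 * ‖z‖ ^ 2) *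
        Real.exp (-(Real.pi / 2) * ‖z‖ ^ 2)) := by ring
    _ = _ := by rw [← Real.exp_add]; simp

/-- The larger of |Re z| and |Im z| is at least ‖z‖/2. Decay of f is used if it is the real part,
decay of the Fourier transform otherwise. -/
theorem bargmann_decay {α : ℝ} (h1 : 1 / 2 ≤ α) (h2 : α ≤ 1) {A b : ℝ} (hA : 0 < A) (hb : 0 < b)
    (hbA : b ≤ 1 / 4 * A ^ (-(1 / α))) (hT : Tame (1 / α) b (Real.pi / 2)) :
    ∃ C : ℝ, 0 ≤ C ∧ ∀ (N : ℝ) (f : ℝ → ℂ), GSBound α A N f → ∀ z : ℂ,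
      ‖bargmann f z‖ * Real.exp (-(Real.pi / 2) * ‖z‖ ^ 2) ≤
        C * N * Real.exp (-(b / 8) * ‖z‖ ^ (1 / α)) := by
  have hq1 := one_le_inv h1 h2
  have hq2 := inv_le_two h1
  have hq0 : 0 ≤ 1 / α := by linarith
  have hδ : Real.pi / 2 < Real.pi := by linarith [Real.pi_pos]
  obtain ⟨K, hK, hF⟩ := fourier_decay h1 h2 hA
  set q := 1 / α with hq
  set J := ∫ u : ℝ, Real.exp (b * |u| ^ q - Real.pi * u ^ 2) with hJ
  have hJ0 : 0 ≤ J := integral_nonneg fun u => (Real.exp_pos _).le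
  refine ⟨(2 : ℝ) ^ (1 / 4 : ℝ) * (2 + K) * J, by positivity, fun N f h z => ?_⟩
  have hN := h.nonneg
  have hexp : ∀ x : ℝ, Real.exp (-(1 / 4 * A ^ (-q)) * |x| ^ q) ≤ Real.exp (-b * |x| ^ q) := by
    intro x
    refine Real.exp_le_exp.2 ?_
    have := mul_le_mul_of_nonneg_right hbA (Real.rpow_nonneg (abs_nonneg x) q)
    linarith
  have b1 : ∀ t, ‖f t‖ ≤ (2 + K) * N * Real.exp (-b * |t| ^ q) := by
    intro t
    have := h.decay h1 h2 hA 0 t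
    simp only [iteratedDeriv_zero, pow_zero, mul_one, Nat.factorial_zero, Nat.cast_one,
      Real.one_rpow] at this
    refine this.trans ?_
    have h3 : 2 * N ≤ (2 + K) * N := by nlinarith
    exact mul_le_mul h3 (hexp t) (Real.exp_pos _).le (by positivity)
  have b2 : ∀ t, ‖FourierTransform.fourier f t‖ ≤ (2 + K) * N * Real.exp (-b * |t| ^ q) := by
    intro t
    refine (hF N f h t).trans ?_
    have h3 : K * N ≤ (2 + K) * N := by nlinarith
    exact mul_le_mul h3 (hexp t) (Real.exp_pos _).le (by positivity)
  have c1 := norm_bargmann_le hq1 hq2 hb hδ hT b1 z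
  have c2 := norm_bargmann_le hq1 hq2 hb hδ hT b2 (Complex.I * z)
  have hint : Integrable f := by simpa using h.integrable h1 h2 hA 0
  rw [bargmann_fourier hint] at c2
  simp only [norm_mul, Complex.norm_I, one_mul, Complex.I_mul_re, abs_neg] at c2
  -- ‖z‖ ≤ |s| + |s| gives ‖z‖^q ≤ 4|s|^q, hence the rate b/2 becomes b/8.
  have key : ∀ s : ℝ, ‖z‖ ≤ 2 * |s| → Real.exp (-(b / 2) * |s| ^ q) ≤
      Real.exp (-(b / 8) * ‖z‖ ^ q) := by
    intro s hs
    refine Real.exp_le_exp.2 ?_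
    have := rpow_le_two_mul hq1 hq2 (norm_nonneg z) (abs_nonneg s) (abs_nonneg s) (by linarith)
    have h4 := mul_le_mul_of_nonneg_left this (by positivity : 0 ≤ b / 8)
    linarith
  have hz := Complex.norm_le_abs_re_add_abs_im z
  rcases le_total |z.re| |z.im| with hle | hle
  · refine c2.trans ?_
    have := key z.im (by linarith)
    calc _ ≤ (2 : ℝ) ^ (1 / 4 : ℝ) * ((2 + K) * N) * J * Real.exp (-(b / 8) * ‖z‖ ^ q) := by gcongr
      _ = _ := by ring
  · refine c1.trans ?_
    have := key z.re (by linarith)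
    calc _ ≤ (2 : ℝ) ^ (1 / 4 : ℝ) * ((2 + K) * N) * J * Real.exp (-(b / 8) * ‖z‖ ^ q) := by gcongr
      _ = _ := by ring

theorem FockDecay.of_exp {q : ℝ} (hq : 1 ≤ q) {a : ℝ} (ha : 0 < a) {Φ : ℂ → ℂ} (hc : Continuous Φ)
    {M : ℝ} (h : ∀ z, ‖Φ z‖ * Real.exp (-(Real.pi / 2) * ‖z‖ ^ 2) ≤
      M * Real.exp (-a * ‖z‖ ^ q)) : FockDecay Φ := by
  have hM : 0 ≤ M := by
    by_contra hM
    have h3 : 0 ≤ ‖Φ 0‖ * Real.exp (-(Real.pi / 2) * ‖(0 : ℂ)‖ ^ 2) := by positivity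
    nlinarith [Real.exp_pos (-a * ‖(0 : ℂ)‖ ^ q), h 0]
  refine ⟨hc, ?_, M, fun z => (h z).trans ?_⟩
  · refine ((integrable_exp_neg_rpow (volume : Measure ℂ) (by simp) hq ha).const_mul M).mono'
      (Continuous.aestronglyMeasurable (by fun_prop)) (Filter.Eventually.of_forall fun z => ?_)
    rw [Real.norm_of_nonneg (by positivity)]
    exact h z
  · refine mul_le_of_le_one_right hM (Real.exp_le_one_iff.2 ?_)
    have := mul_nonneg ha.le (Real.rpow_nonneg (norm_nonneg z) q)
    linarith

/-! ### Gel'fand–Shilov estimates for the adjoint Bargmann transform -/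

theorem iteratedDeriv_comp_ofReal {G : ℂ → ℂ} (hG : Differentiable ℂ G) (m : ℕ) (s : ℝ) :
    iteratedDeriv m (fun s : ℝ => G s) s = iteratedDeriv m G s := by
  induction m generalizing s with
  | zero => simp
  | succ m ih =>
    have hd : Differentiable ℂ (iteratedDeriv m G) :=
      (hG.contDiff (n := ∞)).differentiable_iteratedDeriv m (by exact_mod_cast WithTop.coe_lt_top _)
    rw [iteratedDeriv_succ, iteratedDeriv_succ, funext ih]
    exact ((hd s).hasDerivAt.comp_ofReal).deriv

/-- The Gaussian `e^{-πs²}` as a complex valued function of a real variable. -/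
noncomputable def gaussFn (s : ℝ) : ℂ := Complex.exp (-(Real.pi : ℂ) * (s : ℂ) ^ 2)

theorem gaussFn_smooth : ContDiff ℝ ∞ gaussFn := by
  unfold gaussFn
  have : ContDiff ℝ ∞ (fun s : ℝ => (s : ℂ)) := Complex.ofRealCLM.contDiff
  fun_prop

/-- Cauchy's estimate for the entire Gaussian on the circle of radius √m about s. This radius
balances the growth e^{πm} against the gain m^{-m/2} and leaves √(m!), the critical exponent 1/2. -/
theorem norm_iteratedDeriv_gaussFn_le (m : ℕ) (s : ℝ) : ‖iteratedDeriv m gaussFn s‖ ≤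
    Real.sqrt m.factorial * Real.exp Real.pi ^ m * Real.exp (-(Real.pi / 2) * s ^ 2) := by
  rcases Nat.eq_zero_or_pos m with rfl | hm
  · simp only [iteratedDeriv_zero, Nat.factorial_zero, Nat.cast_one, Real.sqrt_one, pow_zero,
      one_mul, gaussFn]
    rw [Complex.norm_exp, ← Complex.ofReal_pow, ← Complex.ofReal_neg, ← Complex.ofReal_mul,
      Complex.ofReal_re]
    refine Real.exp_le_exp.2 ?_
    nlinarith [mul_nonneg Real.pi_pos.le (sq_nonneg s)]
  · have hd : Differentiable ℂ (fun ζ : ℂ => Complex.exp (-(Real.pi : ℂ) * ζ ^ 2)) := by fun_prop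
    have hm' : (0 : ℝ) < m := by exact_mod_cast hm
    have hr : 0 < Real.sqrt m := Real.sqrt_pos.2 hm'
    have hs : ∀ ζ ∈ Metric.sphere (s : ℂ) (Real.sqrt m),
        ‖Complex.exp (-(Real.pi : ℂ) * ζ ^ 2)‖ ≤
          Real.exp (Real.pi * m) * Real.exp (-(Real.pi / 2) * s ^ 2) := by
      intro ζ hζ
      rw [Complex.norm_exp, ← Real.exp_add]
      refine Real.exp_le_exp.2 ?_
      have h1 : ‖ζ - s‖ ^ 2 = m := by
        rw [mem_sphere_iff_norm.1 hζ, Real.sq_sqrt hm'.le]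
      rw [← Complex.normSq_eq_norm_sq, Complex.normSq_apply] at h1
      simp only [Complex.sub_re, Complex.sub_im, Complex.ofReal_re, Complex.ofReal_im,
        sub_zero] at h1
      have h2 : (-(Real.pi : ℂ) * ζ ^ 2).re = -Real.pi * (ζ.re * ζ.re - ζ.im * ζ.im) := by
        rw [sq, ← Complex.ofReal_neg, Complex.re_ofReal_mul, Complex.mul_re]
      rw [h2, ← h1]
      -- This square amounts to x² + (x - s)² ≥ s²/2 with x = Re ζ, so half of the Gaussian decay
      -- survives on the circle.
      have h3 : 0 ≤ (2 * (ζ.re - s) + s) ^ 2 := sq_nonneg _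
      nlinarith [mul_nonneg Real.pi_pos.le h3]
    have h := Complex.norm_iteratedDeriv_le_of_forall_mem_sphere_norm_le m hr hd.diffContOnCl hs
    have e : iteratedDeriv m gaussFn s =
        iteratedDeriv m (fun ζ : ℂ => Complex.exp (-(Real.pi : ℂ) * ζ ^ 2)) s :=
      iteratedDeriv_comp_ofReal hd m s
    rw [e]
    refine h.trans ?_
    have hf : (m.factorial : ℝ) ≤ (m : ℝ) ^ m := by exact_mod_cast Nat.factorial_le_pow m
    have h4 : (m.factorial : ℝ) ≤ Real.sqrt m.factorial * Real.sqrt m ^ m := by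
      calc (m.factorial : ℝ) = Real.sqrt m.factorial * Real.sqrt m.factorial :=
            (Real.mul_self_sqrt (by positivity)).symm
        _ ≤ Real.sqrt m.factorial * Real.sqrt ((m : ℝ) ^ m) := by gcongr
        _ = _ := by
          congr 1
          rw [Real.sqrt_eq_iff_mul_self_eq (by positivity) (by positivity), ← mul_pow,
            Real.mul_self_sqrt hm'.le]
    rw [div_le_iff₀ (by positivity)]
    have h5 : Real.exp Real.pi ^ m = Real.exp (Real.pi * m) := by
      rw [← Real.exp_nat_mul, mul_comm]
    rw [h5]
    calc (m.factorial : ℝ) * (Real.exp (Real.pi * m) * Real.exp (-(Real.pi / 2) * s ^ 2))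
        ≤ (Real.sqrt m.factorial * Real.sqrt m ^ m) *
          (Real.exp (Real.pi * m) * Real.exp (-(Real.pi / 2) * s ^ 2)) := by gcongr
      _ = _ := by ring

theorem iteratedDeriv_cexp_real (c : ℂ) (m : ℕ) (t : ℝ) :
    iteratedDeriv m (fun t : ℝ => Complex.exp (c * t)) t = c ^ m * Complex.exp (c * t) := by
  have hd : Differentiable ℂ (fun ζ : ℂ => Complex.exp (c * ζ)) := by fun_prop
  rw [iteratedDeriv_comp_ofReal hd, iteratedDeriv_cexp_const_mul]

/-- The time-frequency shifted Gaussian, the `t`-dependent factor of the Bargmann kernel. -/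
noncomputable def gaborFn (w : ℂ) (t : ℝ) : ℂ :=
  gaussFn (t - w.re) * Complex.exp ((-2 * Real.pi * Complex.I * w.im) * t)

theorem gaborFn_smooth (w : ℂ) : ContDiff ℝ ∞ (gaborFn w) := by
  have h1 : ContDiff ℝ ∞ (fun t : ℝ => gaussFn (t - w.re)) :=
    gaussFn_smooth.comp (contDiff_id.sub contDiff_const)
  have h2 : ContDiff ℝ ∞ (fun s : ℝ => (s : ℂ)) := Complex.ofRealCLM.contDiff
  unfold gaborFn
  fun_prop

theorem iteratedDeriv_gaborFn (w : ℂ) (l : ℕ) (t : ℝ) : iteratedDeriv l (gaborFn w) t =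
    ∑ m ∈ Finset.range (l + 1), (l.choose m : ℂ) * iteratedDeriv m gaussFn (t - w.re) *
      ((-2 * Real.pi * Complex.I * w.im) ^ (l - m) *
        Complex.exp ((-2 * Real.pi * Complex.I * w.im) * t)) := by
  have h1 : ContDiff ℝ ∞ (fun t : ℝ => gaussFn (t - w.re)) :=
    gaussFn_smooth.comp (contDiff_id.sub contDiff_const)
  have h2 : ContDiff ℝ ∞ (fun s : ℝ => (s : ℂ)) := Complex.ofRealCLM.contDiff
  have h3 : ContDiff ℝ ∞ (fun t : ℝ => Complex.exp ((-2 * Real.pi * Complex.I * w.im) * t)) := by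
    fun_prop
  have h := iteratedDeriv_mul (n := l) (x := t)
    ((h1.of_le (by exact_mod_cast le_top)).contDiffAt)
    ((h3.of_le (by exact_mod_cast le_top)).contDiffAt)
  refine Eq.trans h (Finset.sum_congr rfl fun m _ => ?_)
  rw [iteratedDeriv_cexp_real, iteratedDeriv_comp_sub_const]

theorem continuous_iteratedDeriv_gaborFn (l : ℕ) (t : ℝ) :
    Continuous fun w : ℂ => iteratedDeriv l (gaborFn w) t := by
  simp only [iteratedDeriv_gaborFn]
  have : ∀ m, Continuous (iteratedDeriv m gaussFn) := fun m =>
    gaussFn_smooth.continuous_iteratedDeriv m (by exact_mod_cast le_top)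
  fun_prop

theorem factorial_rpow_mul_le {α : ℝ} (hα : 0 ≤ α) {m l : ℕ} (h : m ≤ l) :
    (m.factorial : ℝ) ^ α * ((l - m).factorial : ℝ) ^ α ≤ (l.factorial : ℝ) ^ α := by
  rw [← Real.mul_rpow (by positivity) (by positivity)]
  refine Real.rpow_le_rpow (by positivity) ?_ hα
  exact_mod_cast Nat.le_of_dvd l.factorial_pos (Nat.factorial_mul_factorial_dvd_factorial h)

/-- By Leibniz, derivatives of the Gaussian cost B and powers of the frequency cost 2πb^{-α} plus an
exponential in ‖w‖. The binomial theorem recombines both geometric factors into one power. The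
hypothesis `hCB` isolates the only place where the inductive and projective cases need different
constants. -/
theorem norm_iteratedDeriv_gaborFn_le {α : ℝ} (hα : 0 < α) {b B CB : ℝ} (hb : 0 < b) (hB : 0 < B)
    (hCB : ∀ m : ℕ, Real.sqrt m.factorial * Real.exp Real.pi ^ m ≤
      CB * B ^ m * (m.factorial : ℝ) ^ α) (w : ℂ) (l : ℕ) (t : ℝ) :
    ‖iteratedDeriv l (gaborFn w) t‖ ≤ CB * (B + 2 * Real.pi * b ^ (-α)) ^ l *
      (l.factorial : ℝ) ^ α * Real.exp (α * b * ‖w‖ ^ (1 / α)) *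
      Real.exp (-(Real.pi / 2) * (t - w.re) ^ 2) := by
  have hC0 : 0 ≤ CB := by
    have := hCB 0
    simp at this
    linarith
  have hexp : ∀ s : ℝ, ‖Complex.exp ((-2 * Real.pi * Complex.I * w.im) * s)‖ = 1 := by
    intro s
    rw [show (-2 * Real.pi * Complex.I * w.im) * s = ((-2 * Real.pi * w.im * s : ℝ) : ℂ) *
      Complex.I by push_cast; ring, Complex.norm_exp_ofReal_mul_I]
  have hn : ‖(-2 * Real.pi * Complex.I * w.im : ℂ)‖ = 2 * Real.pi * |w.im| := by
    rw [show (-2 * Real.pi * Complex.I * w.im : ℂ) = ((-2 * Real.pi * w.im : ℝ) : ℂ) *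
      Complex.I by push_cast; ring, norm_mul, Complex.norm_I, mul_one, Complex.norm_real,
      Real.norm_eq_abs, abs_mul, abs_mul, abs_of_pos Real.pi_pos]
    norm_num
  rw [iteratedDeriv_gaborFn, add_pow, Finset.mul_sum, Finset.sum_mul, Finset.sum_mul,
    Finset.sum_mul]
  refine (norm_sum_le _ _).trans (Finset.sum_le_sum fun m hm => ?_)
  have hml : m ≤ l := Nat.lt_succ_iff.1 (Finset.mem_range.1 hm)
  rw [norm_mul, norm_mul, norm_mul, norm_pow, hn, hexp, mul_one, Complex.norm_natCast]
  have g1 := norm_iteratedDeriv_gaussFn_le m (t - w.re)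
  have g2 : ‖iteratedDeriv m gaussFn (t - w.re)‖ ≤ CB * B ^ m * (m.factorial : ℝ) ^ α *
      Real.exp (-(Real.pi / 2) * (t - w.re) ^ 2) :=
    g1.trans (mul_le_mul_of_nonneg_right (hCB m) (Real.exp_pos _).le)
  have g3 : (2 * Real.pi * |w.im|) ^ (l - m) ≤ (2 * Real.pi * b ^ (-α)) ^ (l - m) *
      ((l - m).factorial : ℝ) ^ α * Real.exp (α * b * ‖w‖ ^ (1 / α)) := by
    have h1 : |w.im| ^ (l - m) ≤ ‖w‖ ^ (l - m) :=
      pow_le_pow_left₀ (abs_nonneg _) (Complex.abs_im_le_norm w) _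
    have h2 := pow_le_factorial_mul_exp hα hb (norm_nonneg w) (l - m)
    rw [mul_pow (2 * Real.pi), mul_pow (2 * Real.pi)]
    calc (2 * Real.pi) ^ (l - m) * |w.im| ^ (l - m) ≤ (2 * Real.pi) ^ (l - m) *
        (((l - m).factorial : ℝ) ^ α * (b ^ (-α)) ^ (l - m) *
          Real.exp (α * b * ‖w‖ ^ (1 / α))) := by gcongr; exact h1.trans h2
      _ = _ := by ring
  have g4 := factorial_rpow_mul_le hα.le hml
  calc (l.choose m : ℝ) * ‖iteratedDeriv m gaussFn (t - w.re)‖ * (2 * Real.pi * |w.im|) ^ (l - m)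
      ≤ (l.choose m : ℝ) * (CB * B ^ m * (m.factorial : ℝ) ^ α *
          Real.exp (-(Real.pi / 2) * (t - w.re) ^ 2)) * ((2 * Real.pi * b ^ (-α)) ^ (l - m) *
          ((l - m).factorial : ℝ) ^ α * Real.exp (α * b * ‖w‖ ^ (1 / α))) := by gcongr
    _ = (l.choose m : ℝ) * CB * B ^ m * (2 * Real.pi * b ^ (-α)) ^ (l - m) *
          Real.exp (-(Real.pi / 2) * (t - w.re) ^ 2) * Real.exp (α * b * ‖w‖ ^ (1 / α)) *
          ((m.factorial : ℝ) ^ α * ((l - m).factorial : ℝ) ^ α) := by ring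
    _ ≤ (l.choose m : ℝ) * CB * B ^ m * (2 * Real.pi * b ^ (-α)) ^ (l - m) *
          Real.exp (-(Real.pi / 2) * (t - w.re) ^ 2) * Real.exp (α * b * ‖w‖ ^ (1 / α)) *
          (l.factorial : ℝ) ^ α := by gcongr
    _ = _ := by ring

/-- The factor of the Bargmann kernel that depends only on `w`. -/
noncomputable def adjCoeff (Φ : ℂ → ℂ) (w : ℂ) : ℂ :=
  gaussWeight w * (Φ w * (((2 : ℝ) ^ (1 / 4 : ℝ) : ℝ) *
    Complex.exp (Real.pi / 2 * ((w.re : ℂ) ^ 2 + (w.im : ℂ) ^ 2) +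
      Complex.I * Real.pi * w.re * w.im)))

theorem adjKernel_eq (Φ : ℂ → ℂ) (t : ℝ) (w : ℂ) :
    adjKernel Φ t w = adjCoeff Φ w * gaborFn w t := by
  have e : (starRingEnd ℂ) (bargmannKernel t w) = ((2 : ℝ) ^ (1 / 4 : ℝ) : ℝ) *
      Complex.exp (Real.pi / 2 * ((w.re : ℂ) ^ 2 + (w.im : ℂ) ^ 2) +
      Complex.I * Real.pi * w.re * w.im) * gaborFn w t := by
    rw [conj_bargmannKernel, bargmannKernel, gaborFn, gaussFn,
      mul_assoc (((2 : ℝ) ^ (1 / 4 : ℝ) : ℝ) : ℂ), ← Complex.exp_add,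
      ← Complex.exp_add]
    congr 2
    have hz : (starRingEnd ℂ) w = (w.re : ℂ) - (w.im : ℂ) * Complex.I := by
      apply Complex.ext <;> simp
    rw [hz]
    push_cast
    linear_combination (-(Real.pi : ℂ) * (w.im : ℂ) ^ 2 / 2) * Complex.I_sq
  rw [adjKernel, e, adjCoeff]
  ring

theorem norm_adjCoeff (Φ : ℂ → ℂ) (w : ℂ) : ‖adjCoeff Φ w‖ =
    (2 : ℝ) ^ (1 / 4 : ℝ) * (‖Φ w‖ * Real.exp (-(Real.pi / 2) * ‖w‖ ^ 2)) := by
  have e : ‖Complex.exp (Real.pi / 2 * ((w.re : ℂ) ^ 2 + (w.im : ℂ) ^ 2) +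
      Complex.I * Real.pi * w.re * w.im)‖ = Real.exp (Real.pi / 2 * ‖w‖ ^ 2) := by
    rw [show (Real.pi / 2 * ((w.re : ℂ) ^ 2 + (w.im : ℂ) ^ 2) + Complex.I * Real.pi * w.re * w.im)
      = ((Real.pi / 2 * (w.re ^ 2 + w.im ^ 2) : ℝ) : ℂ) + ((Real.pi * w.re * w.im : ℝ) : ℂ) *
      Complex.I by push_cast; ring, Complex.exp_add, norm_mul, Complex.norm_exp_ofReal_mul_I,
      mul_one, Complex.norm_exp, Complex.ofReal_re, ← Complex.normSq_eq_norm_sq,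
      Complex.normSq_apply, ← sq, ← sq]
  rw [adjCoeff, norm_mul, norm_mul, norm_mul, e, norm_gaussWeight, Complex.norm_real,
    Real.norm_of_nonneg (Real.rpow_nonneg zero_le_two _), ← exp_neg_pi_mul_exp_half]
  ring

theorem adjCoeff_continuous {Φ : ℂ → ℂ} (hΦ : Continuous Φ) : Continuous (adjCoeff Φ) := by
  unfold adjCoeff
  have := gaussWeight_smooth.continuous
  fun_prop

/-- The rate 4b is spent in three portions: b pays for the frequency powers from differentiation, 2b
for the power of t through |t|^q ≤ 2(‖w‖^q + |t - Re w|^q) with q = 1/α, and b remains for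
integrability. The piece 2b|t - Re w|^q is absorbed by the Gaussian, which is the role of `hT`. -/
theorem gsBound_bargmannAdj {α : ℝ} (h1 : 1 / 2 ≤ α) (h2 : α ≤ 1) {b B CB : ℝ} (hb : 0 < b)
    (hB : 0 < B) (hCB : ∀ m : ℕ, Real.sqrt m.factorial * Real.exp Real.pi ^ m ≤
      CB * B ^ m * (m.factorial : ℝ) ^ α) (hT : Tame (1 / α) (2 * b) (Real.pi / 2)) :
    ∃ C : ℝ, 0 ≤ C ∧ ∀ (M : ℝ) (Φ : ℂ → ℂ), 0 ≤ M → Continuous Φ →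
      (∀ w, ‖Φ w‖ * Real.exp (-(Real.pi / 2) * ‖w‖ ^ 2) ≤
        M * Real.exp (-(4 * b) * ‖w‖ ^ (1 / α))) →
      GSBound α (B + 2 * Real.pi * b ^ (-α)) (C * M) (bargmannAdj Φ) := by
  have hα : 0 < α := by linarith
  have hq1 := one_le_inv h1 h2
  have hq2 := inv_le_two h1
  have hq0 : 0 ≤ 1 / α := by linarith
  obtain ⟨K, hK⟩ := hT
  have hC0 : 0 ≤ CB := by
    have := hCB 0
    simp at this
    linarith
  have hbα : 0 < b ^ (-α) := Real.rpow_pos_of_pos hb _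
  set D := B + 2 * Real.pi * b ^ (-α) with hD
  have hD0 : 0 < D := by positivity
  set J := ∫ w : ℂ, Real.exp (-b * ‖w‖ ^ (1 / α)) with hJ
  have hJ0 : 0 ≤ J := integral_nonneg fun u => (Real.exp_pos _).le
  have hJi := integrable_exp_neg_rpow (volume : Measure ℂ) (by simp) hq1 hb
  refine ⟨(2 : ℝ) ^ (1 / 4 : ℝ) * Real.exp K * J * CB, by positivity, fun M Φ hM hΦ hdec => ?_⟩
  have hcoef : ∀ w, ‖adjCoeff Φ w‖ ≤
      (2 : ℝ) ^ (1 / 4 : ℝ) * (M * Real.exp (-(4 * b) * ‖w‖ ^ (1 / α))) := by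
    intro w
    rw [norm_adjCoeff]
    exact mul_le_mul_of_nonneg_left (hdec w) (by positivity)
  have hcc := adjCoeff_continuous hΦ
  have hgab := fun w l t => norm_iteratedDeriv_gaborFn_le hα hb hB hCB w l t
  have hprod : ∀ (l : ℕ) (t : ℝ) (w : ℂ), ‖adjCoeff Φ w * iteratedDeriv l (gaborFn w) t‖ ≤
      (2 : ℝ) ^ (1 / 4 : ℝ) * M * (CB * D ^ l * (l.factorial : ℝ) ^ α) *
        (Real.exp (-(3 * b) * ‖w‖ ^ (1 / α)) * Real.exp (-(Real.pi / 2) * (t - w.re) ^ 2)) := by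
    intro l t w
    rw [norm_mul]
    have e : Real.exp (-(4 * b) * ‖w‖ ^ (1 / α)) * Real.exp (α * b * ‖w‖ ^ (1 / α)) ≤
        Real.exp (-(3 * b) * ‖w‖ ^ (1 / α)) := by
      rw [← Real.exp_add]
      refine Real.exp_le_exp.2 ?_
      have := mul_nonneg (mul_nonneg (sub_nonneg.2 h2) hb.le)
        (Real.rpow_nonneg (norm_nonneg w) (1 / α))
      linarith
    calc _ ≤ ((2 : ℝ) ^ (1 / 4 : ℝ) * (M * Real.exp (-(4 * b) * ‖w‖ ^ (1 / α)))) *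
          (CB * D ^ l * (l.factorial : ℝ) ^ α * Real.exp (α * b * ‖w‖ ^ (1 / α)) *
            Real.exp (-(Real.pi / 2) * (t - w.re) ^ 2)) :=
          mul_le_mul (hcoef w) (hgab w l t) (norm_nonneg _) (by positivity)
      _ = (2 : ℝ) ^ (1 / 4 : ℝ) * M * (CB * D ^ l * (l.factorial : ℝ) ^ α) *
          ((Real.exp (-(4 * b) * ‖w‖ ^ (1 / α)) * Real.exp (α * b * ‖w‖ ^ (1 / α))) *
            Real.exp (-(Real.pi / 2) * (t - w.re) ^ 2)) := by ring
      _ ≤ _ := by gcongr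
  have hsimple : ∀ (l : ℕ) (t : ℝ) (w : ℂ), ‖adjCoeff Φ w * iteratedDeriv l (gaborFn w) t‖ ≤
      (2 : ℝ) ^ (1 / 4 : ℝ) * M * (CB * D ^ l * (l.factorial : ℝ) ^ α) *
        Real.exp (-b * ‖w‖ ^ (1 / α)) := by
    intro l t w
    refine (hprod l t w).trans (mul_le_mul_of_nonneg_left ?_ (by positivity))
    rw [← Real.exp_add]
    refine Real.exp_le_exp.2 ?_
    have h3 := mul_nonneg hb.le (Real.rpow_nonneg (norm_nonneg w) (1 / α))
    have h4 := mul_nonneg Real.pi_pos.le (sq_nonneg (t - w.re))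
    linarith
  have hcont : ∀ (l : ℕ) (t : ℝ), Continuous fun w => adjCoeff Φ w * iteratedDeriv l (gaborFn w) t :=
    fun l t => hcc.mul (continuous_iteratedDeriv_gaborFn l t)
  have hintl : ∀ (l : ℕ) (t : ℝ),
      Integrable fun w => adjCoeff Φ w * iteratedDeriv l (gaborFn w) t := fun l t =>
    (hJi.const_mul _).mono' (hcont l t).aestronglyMeasurable
      (Filter.Eventually.of_forall (hsimple l t))
  have hder : ∀ (l : ℕ) (t : ℝ), HasDerivAt
      (fun t => ∫ w, adjCoeff Φ w * iteratedDeriv l (gaborFn w) t)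
      (∫ w, adjCoeff Φ w * iteratedDeriv (l + 1) (gaborFn w) t) t := by
    intro l t
    refine (hasDerivAt_integral_of_dominated_loc_of_deriv_le (μ := (volume : Measure ℂ))
      (F := fun t w => adjCoeff Φ w * iteratedDeriv l (gaborFn w) t)
      (F' := fun t w => adjCoeff Φ w * iteratedDeriv (l + 1) (gaborFn w) t)
      (s := Set.univ) Filter.univ_mem
      (Filter.Eventually.of_forall fun t => (hcont l t).aestronglyMeasurable) (hintl l t)
      (hcont (l + 1) t).aestronglyMeasurable
      (Filter.Eventually.of_forall fun w t _ => hsimple (l + 1) t w) (hJi.const_mul _)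
      (Filter.Eventually.of_forall fun w t _ => ?_)).2
    refine HasDerivAt.const_mul _ ?_
    rw [iteratedDeriv_succ]
    exact (((gaborFn_smooth w).differentiable_iteratedDeriv l
      (by exact_mod_cast WithTop.coe_lt_top _)) t).hasDerivAt
  have hiter : ∀ l : ℕ, iteratedDeriv l (bargmannAdj Φ) =
      fun t => ∫ w, adjCoeff Φ w * iteratedDeriv l (gaborFn w) t := by
    intro l
    induction l with
    | zero =>
      funext t
      simp only [iteratedDeriv_zero, bargmannAdj, adjKernel_eq]
    | succ l ih =>
      rw [iteratedDeriv_succ, ih]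
      funext t
      exact (hder l t).deriv
  refine ⟨contDiff_of_differentiable_iteratedDeriv (n := ⊤) fun m _ => ?_, fun k l t => ?_⟩
  · rw [hiter]
    exact fun t => (hder m t).differentiableAt
  · rw [hiter]
    have hk := pow_le_factorial_mul_exp hα hb (abs_nonneg t) k
    have hpt : ∀ w : ℂ, |t| ^ k * ‖adjCoeff Φ w * iteratedDeriv l (gaborFn w) t‖ ≤
        (2 : ℝ) ^ (1 / 4 : ℝ) * M * (CB * D ^ l * (l.factorial : ℝ) ^ α) *
        ((k.factorial : ℝ) ^ α * D ^ k * Real.exp K) * Real.exp (-b * ‖w‖ ^ (1 / α)) := by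
      intro w
      have hw : |t| ^ (1 / α) ≤ 2 * (‖w‖ ^ (1 / α) + |t - w.re| ^ (1 / α)) := by
        refine rpow_le_two_mul hq1 hq2 (abs_nonneg _) (norm_nonneg _) (abs_nonneg _) ?_
        calc |t| = |w.re + (t - w.re)| := by congr 1; ring
          _ ≤ |w.re| + |t - w.re| := abs_add_le _ _
          _ ≤ _ := by have := Complex.abs_re_le_norm w; linarith
      have hK' := hK |t - w.re| (abs_nonneg _)
      rw [sq_abs] at hK'
      have hexp : Real.exp (α * b * |t| ^ (1 / α)) * (Real.exp (-(3 * b) * ‖w‖ ^ (1 / α)) *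
          Real.exp (-(Real.pi / 2) * (t - w.re) ^ 2)) ≤
          Real.exp K * Real.exp (-b * ‖w‖ ^ (1 / α)) := by
        rw [← Real.exp_add, ← Real.exp_add, ← Real.exp_add]
        refine Real.exp_le_exp.2 ?_
        have h3 : α * b * |t| ^ (1 / α) ≤ b * |t| ^ (1 / α) := by
          have := mul_nonneg (mul_nonneg (sub_nonneg.2 h2) hb.le)
            (Real.rpow_nonneg (abs_nonneg t) (1 / α))
          linarith
        have h4 := mul_le_mul_of_nonneg_left hw hb.le
        linarith
      have hDk : (b ^ (-α)) ^ k ≤ D ^ k := by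
        refine pow_le_pow_left₀ hbα.le ?_ k
        have := Real.pi_gt_three
        nlinarith
      calc |t| ^ k * ‖adjCoeff Φ w * iteratedDeriv l (gaborFn w) t‖
          ≤ ((k.factorial : ℝ) ^ α * (b ^ (-α)) ^ k * Real.exp (α * b * |t| ^ (1 / α))) *
            ((2 : ℝ) ^ (1 / 4 : ℝ) * M * (CB * D ^ l * (l.factorial : ℝ) ^ α) *
            (Real.exp (-(3 * b) * ‖w‖ ^ (1 / α)) *
              Real.exp (-(Real.pi / 2) * (t - w.re) ^ 2))) :=
            mul_le_mul hk (hprod l t w) (norm_nonneg _) (by positivity)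
        _ = (2 : ℝ) ^ (1 / 4 : ℝ) * M * (CB * D ^ l * (l.factorial : ℝ) ^ α) *
            ((k.factorial : ℝ) ^ α * (b ^ (-α)) ^ k) * (Real.exp (α * b * |t| ^ (1 / α)) *
            (Real.exp (-(3 * b) * ‖w‖ ^ (1 / α)) *
              Real.exp (-(Real.pi / 2) * (t - w.re) ^ 2))) := by ring
        _ ≤ (2 : ℝ) ^ (1 / 4 : ℝ) * M * (CB * D ^ l * (l.factorial : ℝ) ^ α) *
            ((k.factorial : ℝ) ^ α * D ^ k) *
            (Real.exp K * Real.exp (-b * ‖w‖ ^ (1 / α))) := by gcongr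
        _ = _ := by ring
    calc |t| ^ k * ‖∫ w, adjCoeff Φ w * iteratedDeriv l (gaborFn w) t‖
        ≤ |t| ^ k * ∫ w, ‖adjCoeff Φ w * iteratedDeriv l (gaborFn w) t‖ :=
          mul_le_mul_of_nonneg_left (norm_integral_le_integral_norm _) (by positivity)
      _ = ∫ w, |t| ^ k * ‖adjCoeff Φ w * iteratedDeriv l (gaborFn w) t‖ :=
          (integral_const_mul _ _).symm
      _ ≤ ∫ w, (2 : ℝ) ^ (1 / 4 : ℝ) * M * (CB * D ^ l * (l.factorial : ℝ) ^ α) *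
          ((k.factorial : ℝ) ^ α * D ^ k * Real.exp K) * Real.exp (-b * ‖w‖ ^ (1 / α)) :=
          integral_mono ((hintl l t).norm.const_mul _) (hJi.const_mul _) hpt
      _ = _ := by
        rw [integral_const_mul, ← hJ, pow_add]
        ring

/-- For `α > 1/2` the derivatives of the Gaussian satisfy the Beurling type estimates. -/
theorem gaussian_const_beurling {α : ℝ} (h : 1 / 2 < α) {B : ℝ} (hB : 0 < B) :
    ∃ CB : ℝ, ∀ m : ℕ, Real.sqrt m.factorial * Real.exp Real.pi ^ m ≤
      CB * B ^ m * (m.factorial : ℝ) ^ α := by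
  set ε := α - 1 / 2 with hε
  have hε0 : 0 < ε := by linarith
  -- Chosen so that s^ε = e^π/B; the surplus (m!)^ε then beats the geometric factor.
  set s := (Real.exp Real.pi / B) ^ (1 / ε) with hs
  have hs0 : 0 < s := by positivity
  refine ⟨Real.exp s ^ ε, fun m => ?_⟩
  have hf : (0 : ℝ) < m.factorial := by exact_mod_cast m.factorial_pos
  have h1 := Real.pow_div_factorial_le_exp s hs0.le m
  rw [div_le_iff₀ hf] at h1
  have h2 := Real.rpow_le_rpow (by positivity) h1 hε0.le
  rw [Real.mul_rpow (Real.exp_pos _).le hf.le] at h2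
  have h3 : (s ^ m) ^ ε = (Real.exp Real.pi / B) ^ m := by
    rw [← Real.rpow_natCast, ← Real.rpow_mul hs0.le, hs, ← Real.rpow_mul (by positivity),
      ← Real.rpow_natCast]
    congr 1
    field_simp
  rw [h3, div_pow, div_le_iff₀ (by positivity)] at h2
  have h4 : (m.factorial : ℝ) ^ α = Real.sqrt m.factorial * (m.factorial : ℝ) ^ ε := by
    rw [Real.sqrt_eq_rpow, ← Real.rpow_add hf]
    congr 1
    rw [hε]
    ring
  rw [h4]
  calc Real.sqrt m.factorial * Real.exp Real.pi ^ m
      ≤ Real.sqrt m.factorial * (Real.exp s ^ ε * (m.factorial : ℝ) ^ ε * B ^ m) := by gcongr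
    _ = _ := by ring

theorem gaussian_const_roumieu {α : ℝ} (h : 1 / 2 ≤ α) (m : ℕ) :
    Real.sqrt m.factorial * Real.exp Real.pi ^ m ≤
      1 * Real.exp Real.pi ^ m * (m.factorial : ℝ) ^ α := by
  have hf : (1 : ℝ) ≤ m.factorial := by exact_mod_cast m.factorial_pos
  rw [Real.sqrt_eq_rpow, one_mul, mul_comm]
  exact mul_le_mul_of_nonneg_left (Real.rpow_le_rpow_of_exponent_le hf h) (by positivity)

/-! ### Triviality in the critical case -/

/-- An entire function vanishing at infinity is zero, by Liouville. -/
theorem entire_eq_zero_of_decay {Φ : ℂ → ℂ} (hΦ : Differentiable ℂ Φ) {M c : ℝ} (hc : 0 < c)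
    (h : ∀ z, ‖Φ z‖ ≤ M * Real.exp (-c * ‖z‖ ^ 2)) : Φ = 0 := by
  funext z
  refine hΦ.apply_eq_of_tendsto_cocompact z ?_
  refine squeeze_zero_norm h ?_
  have h1 : Filter.Tendsto (fun z : ℂ => ‖z‖ ^ 2) (Filter.cocompact ℂ) Filter.atTop :=
    (Filter.tendsto_pow_atTop two_ne_zero).comp (tendsto_norm_cocompact_atTop (E := ℂ))
  have h2 := Real.tendsto_exp_atBot.comp (h1.const_mul_atTop_of_neg (neg_lt_zero.2 hc))
  simpa using h2.const_mul M

theorem entire_eq_zero_of_fock_decay {Φ : ℂ → ℂ} (hΦ : Differentiable ℂ Φ) {M c : ℝ}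
    (hc : Real.pi / 2 < c)
    (h : ∀ z, ‖Φ z‖ * Real.exp (-(Real.pi / 2) * ‖z‖ ^ 2) ≤ M * Real.exp (-c * ‖z‖ ^ 2)) :
    Φ = 0 := by
  refine entire_eq_zero_of_decay hΦ (M := M) (sub_pos.2 hc) fun z => ?_
  have h1 := mul_le_mul_of_nonneg_right (h z) (Real.exp_pos (Real.pi / 2 * ‖z‖ ^ 2)).le
  rw [mul_assoc, mul_assoc, ← Real.exp_add, ← Real.exp_add] at h1
  refine le_of_eq_of_le ?_ (h1.trans (le_of_eq ?_))
  · rw [show -(Real.pi / 2) * ‖z‖ ^ 2 + Real.pi / 2 * ‖z‖ ^ 2 = 0 by ring, Real.exp_zero, mul_one]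
  · congr 2; ring

theorem GSBound.gaussian_decay {N : ℝ} {f : ℝ → ℂ} (h : GSBound (1 / 2) (1 / 4) N f) (l : ℕ)
    (z : ℂ) (t : ℝ) : ‖iteratedDeriv l f t * Complex.exp (2 * Real.pi * t * z)‖ ≤
      2 * (N * (1 / 4) ^ l * (l.factorial : ℝ) ^ (1 / 2 : ℝ)) *
        Real.exp (Real.pi ^ 2 / 3 * ‖z‖ ^ 2) * Real.exp (-1 * t ^ 2) := by
  have h1 := h.decay le_rfl (by norm_num) (by norm_num) l t
  -- A = 1/4 yields decay e^{-4t²}. Of this, 3t² absorbs e^{2πtz} by completing the square, at the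
  -- cost of e^{π²‖z‖²/3}, and t² remains for integrability.
  have e : (1 / 4 : ℝ) * (1 / 4) ^ (-(1 / (1 / 2)) : ℝ) = 4 := by
    rw [show (-(1 / (1 / 2)) : ℝ) = ((-2 : ℤ) : ℝ) by norm_num, Real.rpow_intCast]
    norm_num
  rw [e, show (1 / (1 / 2) : ℝ) = ((2 : ℕ) : ℝ) by norm_num, Real.rpow_natCast, sq_abs] at h1
  have hN := h.nonneg
  have h2 : ‖Complex.exp (2 * Real.pi * t * z)‖ ≤
      Real.exp (3 * t ^ 2 + Real.pi ^ 2 / 3 * ‖z‖ ^ 2) := by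
    rw [Complex.norm_exp]
    refine Real.exp_le_exp.2 ?_
    have : (2 * (Real.pi : ℂ) * t * z).re = 2 * Real.pi * t * z.re := by
      rw [show 2 * (Real.pi : ℂ) * t * z = ((2 * Real.pi * t : ℝ) : ℂ) * z by push_cast; ring,
        Complex.re_ofReal_mul]
    rw [this]
    have h3 : z.re ^ 2 ≤ ‖z‖ ^ 2 := by
      rw [← Complex.normSq_eq_norm_sq, Complex.normSq_apply]
      nlinarith [sq_nonneg z.im]
    nlinarith [sq_nonneg (3 * t - Real.pi * z.re), mul_le_mul_of_nonneg_left h3 (sq_nonneg Real.pi)]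
  rw [norm_mul]
  refine (mul_le_mul h1 h2 (norm_nonneg _) (by positivity)).trans (le_of_eq ?_)
  rw [mul_assoc (2 * (N * (1 / 4) ^ l * (l.factorial : ℝ) ^ (1 / 2 : ℝ))),
    mul_assoc (2 * (N * (1 / 4) ^ l * (l.factorial : ℝ) ^ (1 / 2 : ℝ))), ← Real.exp_add,
    ← Real.exp_add]
  congr 2
  ring

/-- The space `Σ^{1/2}_{1/2}(ℝ)` is trivial. -/
theorem GSBound.eq_zero {N : ℝ} {f : ℝ → ℂ} (h : GSBound (1 / 2) (1 / 4) N f) : f = 0 := by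
  have hN := h.nonneg
  -- The factor e^{πt²} cancels the Gaussian in `gaussLaplace`, so that the latter becomes the
  -- Laplace transform of f itself.
  set g : ℝ → ℂ := fun t => f t * Complex.exp (Real.pi * t ^ 2) with hg
  have ig : Integrable (fun t : ℝ => Real.exp (-1 * t ^ 2)) := integrable_exp_neg_mul_sq one_pos
  set J : ℕ → ℂ → ℂ := fun l z => ∫ t, iteratedDeriv l f t * Complex.exp (2 * Real.pi * t * z)
    with hJ
  have cont : ∀ l, Continuous (iteratedDeriv l f) := fun l =>
    h.smooth.continuous_iteratedDeriv l (by exact_mod_cast le_top)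
  have integ : ∀ l z, Integrable fun t : ℝ =>
      iteratedDeriv l f t * Complex.exp (2 * Real.pi * t * z) := fun l z =>
    (ig.const_mul _).mono' (Continuous.aestronglyMeasurable (by have := cont l; fun_prop))
      (Filter.Eventually.of_forall (h.gaussian_decay l z))
  have hle : ∀ l z, ‖J l z‖ ≤ 2 * (N * (1 / 4) ^ l * (l.factorial : ℝ) ^ (1 / 2 : ℝ)) *
      Real.exp (Real.pi ^ 2 / 3 * ‖z‖ ^ 2) * ∫ t : ℝ, Real.exp (-1 * t ^ 2) := fun l z => by
    rw [← integral_const_mul]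
    exact norm_integral_le_of_norm_le (ig.const_mul _)
      (Filter.Eventually.of_forall (h.gaussian_decay l z))
  -- Integration by parts turns derivatives of f into powers of z, so the factorial bounds in l give
  -- decay of the Laplace transform.
  have hstep : ∀ l z, J (l + 1) z = -(2 * Real.pi * z) * J l z := fun l z => by
    have hu : ∀ t, HasDerivAt (iteratedDeriv l f) (iteratedDeriv (l + 1) f t) t := fun t => by
      rw [iteratedDeriv_succ]
      exact ((h.smooth.differentiable_iteratedDeriv l (by exact_mod_cast ENat.natCast_lt_top l)) t
        ).hasDerivAt
    have hv : ∀ t : ℝ, HasDerivAt (fun t : ℝ => Complex.exp (2 * Real.pi * t * z))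
        (2 * Real.pi * z * Complex.exp (2 * Real.pi * t * z)) t := fun t => by
      have h1 : HasDerivAt (fun t : ℝ => 2 * (Real.pi : ℂ) * t * z) (2 * Real.pi * z) t := by
        have := ((Complex.ofRealCLM.hasDerivAt (x := t)).const_mul (2 * (Real.pi : ℂ))).mul_const z
        simpa using this
      exact h1.cexp.congr_deriv (by ring)
    have hp := integral_mul_deriv_eq_deriv_mul_of_integrable (fun t _ => hu t) (fun t _ => hv t)
      (by
        refine ((integ l z).const_mul (2 * Real.pi * z)).congr
          (Filter.Eventually.of_forall fun t => ?_)
        simp only [Pi.mul_apply]; ring)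
      (integ (l + 1) z) (integ l z)
    simp only [hJ]
    rw [← neg_inj, ← hp, neg_mul, neg_neg, ← integral_const_mul]
    congr 1
    funext t
    ring
  have hpow : ∀ l z, ‖J l z‖ = (2 * Real.pi * ‖z‖) ^ l * ‖J 0 z‖ := fun l z => by
    induction l with
    | zero => simp
    | succ l ih =>
      rw [hstep, norm_mul, ih, norm_neg, norm_mul, norm_mul, Complex.norm_real,
        Real.norm_of_nonneg Real.pi_pos.le, Complex.norm_ofNat]
      ring
  have hgE : ExpBounded g := by
    refine .of_bounded (C := 2 * N) (by have := h.smooth.continuous; fun_prop) fun t => ?_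
    have h1 := h.gaussian_decay 0 ((t / 2 : ℝ) : ℂ) t
    have e : 2 * (Real.pi : ℂ) * t * ((t / 2 : ℝ) : ℂ) = Real.pi * t ^ 2 := by push_cast; ring
    rw [e, iteratedDeriv_zero] at h1
    refine h1.trans ?_
    simp only [pow_zero, mul_one, Nat.factorial_zero, Nat.cast_one, Real.one_rpow]
    rw [mul_assoc, ← Real.exp_add]
    refine mul_le_of_le_one_right (by positivity) (Real.exp_le_one_iff.2 ?_)
    rw [Complex.norm_real, Real.norm_eq_abs, sq_abs]
    have : Real.pi ^ 2 < 12 := by nlinarith [Real.pi_lt_d2, Real.pi_pos]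
    nlinarith [sq_nonneg t]
  have hJL : J 0 = gaussLaplace g := by
    funext z
    simp only [hJ, gaussLaplace, iteratedDeriv_zero]
    congr 1
    funext t
    rw [hg]
    simp only [mul_assoc, ← Complex.exp_add]
    congr 2
    ring
  have hd : Differentiable ℂ (gaussLaplace g) := fun z => (hasDerivAt_gaussLaplace hgE z).differentiableAt
  have hI : 0 ≤ ∫ t : ℝ, Real.exp (-1 * t ^ 2) := integral_nonneg fun t => (Real.exp_pos _).le
  have hzero : gaussLaplace g = 0 := by
    refine entire_eq_zero_of_decay hd one_pos
      (M := 2 * (2 * N * ∫ t : ℝ, Real.exp (-1 * t ^ 2))) fun z => ?_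
    -- The moments give the factor e^{-16π²‖z‖²}, which overwhelms the growth e^{π²‖z‖²/3};
    -- Liouville then applies.
    have h1 := le_exp_of_moments (α := 1 / 2) le_rfl (by norm_num)
      (s := 2 * Real.pi * ‖z‖) (y := ‖J 0 z‖) (D := 1 / 4)
      (N := 2 * N * (∫ t : ℝ, Real.exp (-1 * t ^ 2)) * Real.exp (Real.pi ^ 2 / 3 * ‖z‖ ^ 2))
      (by positivity) (norm_nonneg _) (by positivity) (by norm_num)
      (fun k => by rw [← hpow]; exact (hle k z).trans (le_of_eq (by ring)))
    rw [← hJL]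
    refine h1.trans ?_
    rw [show (1 / (1 / 2) : ℝ) = ((2 : ℕ) : ℝ) by norm_num, Real.rpow_natCast, ← mul_assoc,
      mul_assoc _ (Real.exp _) (Real.exp _), ← Real.exp_add]
    refine mul_le_mul_of_nonneg_left (Real.exp_le_exp.2 ?_) (by positivity)
    have hpi : 9 < Real.pi ^ 2 := by nlinarith [Real.pi_gt_three]
    have : (2 * Real.pi * ‖z‖ / (1 / 4)) ^ 2 = 64 * (Real.pi ^ 2 * ‖z‖ ^ 2) := by ring
    rw [this]
    nlinarith [mul_le_mul_of_nonneg_right hpi.le (sq_nonneg ‖z‖), sq_nonneg ‖z‖]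
  have hg0 := eq_zero_of_gaussLaplace_eq_zero hgE fun ξ => by rw [hzero]; rfl
  funext t
  have := congrFun hg0 t
  simpa [hg, Complex.exp_ne_zero] using this

/-! ### The Gel'fand–Shilov norms -/

theorem GSBound.of_gsNorm {α A : ℝ} (hA : 0 < A) {f : ℝ → ℂ} (hf : ContDiff ℝ ∞ f)
    (h : gsNorm α A f < ⊤) : GSBound α A (gsNorm α A f).toReal f := by
  refine ⟨hf, fun k l x => ?_⟩
  have h1 : ENNReal.ofReal (|x| ^ k * ‖iteratedDeriv l f x‖ /
      (A ^ (k + l) * (k.factorial : ℝ) ^ α * (l.factorial : ℝ) ^ α)) ≤ gsNorm α A f :=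
    le_iSup_of_le k (le_iSup_of_le l (le_iSup_of_le x le_rfl))
  have hk : (0 : ℝ) < k.factorial := by exact_mod_cast k.factorial_pos
  have hl : (0 : ℝ) < l.factorial := by exact_mod_cast l.factorial_pos
  have h2 := (ENNReal.ofReal_le_iff_le_toReal h.ne).1 h1
  rw [div_le_iff₀ (by positivity)] at h2
  linarith

theorem GSBound.gsNorm_le {α A N : ℝ} (hA : 0 < A) {f : ℝ → ℂ} (h : GSBound α A N f) :
    gsNorm α A f ≤ ENNReal.ofReal N := by
  refine iSup_le fun k => iSup_le fun l => iSup_le fun x => ENNReal.ofReal_le_ofReal ?_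
  have hk : (0 : ℝ) < k.factorial := by exact_mod_cast k.factorial_pos
  have hl : (0 : ℝ) < l.factorial := by exact_mod_cast l.factorial_pos
  rw [div_le_iff₀ (by positivity)]
  have := h.bound k l x
  linarith

/-! ### The weighted norms on the Fock side -/

/-- The norm `‖e^{a|·|^{1/α}} e^{-(π/2)|·|²} G‖_{Lᵖ(ℂ)}`. -/
noncomputable def fockNorm (p : ℝ≥0∞) (α a : ℝ) (G : ℂ → ℂ) : ℝ≥0∞ :=
  eLpNorm (fun z : ℂ => ((Real.exp (a * ‖z‖ ^ (1 / α)) *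
    Real.exp (-(Real.pi / 2) * ‖z‖ ^ 2) : ℝ) : ℂ) * G z) p volume

theorem fockNorm_mono (p : ℝ≥0∞) (α : ℝ) {a b : ℝ} (hab : a ≤ b) (G : ℂ → ℂ) :
    fockNorm p α a G ≤ fockNorm p α b G := by
  refine eLpNorm_mono fun z => ?_
  simp only [norm_mul, Complex.norm_real, Real.norm_eq_abs, Real.abs_exp]
  gcongr

theorem fockNorm_smul (p : ℝ≥0∞) (α a : ℝ) (c : ℂ) (G : ℂ → ℂ) :
    fockNorm p α a (c • G) = ENNReal.ofReal ‖c‖ * fockNorm p α a G := by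
  rw [fockNorm, fockNorm, ofReal_norm, ← eLpNorm_const_smul]
  congr 1
  funext z
  simp only [Pi.smul_apply, smul_eq_mul]
  ring

theorem rpow_le_of_mem_ball {q : ℝ} (h1 : 1 ≤ q) (h2 : q ≤ 2) {z u : ℂ}
    (hu : u ∈ Metric.ball z 1) : ‖z‖ ^ q ≤ 2 * (‖u‖ ^ q + 1) := by
  have hd : ‖z‖ ≤ ‖u‖ + 1 := by
    rw [Metric.mem_ball, dist_comm, dist_eq_norm] at hu
    have := norm_le_norm_add_norm_sub' z u
    linarith
  simpa using rpow_le_two_mul h1 h2 (norm_nonneg z) (norm_nonneg u) zero_le_one hd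

theorem volume_real_ball (z : ℂ) : volume.real (Metric.ball z 1) = Real.pi := by
  rw [Measure.real, Complex.volume_ball]
  simp

/-- Comparing weights on a unit disc reduces the rate 4a to 2a. The weight of the norm uses up a,
and the remaining e^{-a‖z‖^{1/α}} lies in every Lᵖ. -/
theorem fockNorm_creation_le {p : ℝ≥0∞} (hp : 1 ≤ p) {α : ℝ} (h1 : 1 / 2 ≤ α) (h2 : α ≤ 1)
    {a : ℝ} (ha : 0 < a) (j : ℕ) : ∃ C : ℝ, 0 ≤ C ∧ ∀ (M : ℝ) (Φ : ℂ → ℂ), 0 ≤ M →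
      Differentiable ℂ Φ → (∀ z, ‖Φ z‖ * Real.exp (-(Real.pi / 2) * ‖z‖ ^ 2) ≤
        M * Real.exp (-(4 * a) * ‖z‖ ^ (1 / α))) →
      fockNorm p α a (creation^[j] Φ) ≤ ENNReal.ofReal (C * M) := by
  obtain ⟨C, hC, h⟩ := creation_iter_le_ballMean j
  have hL := memLp_exp_neg_rpow hp (one_le_inv h1 h2) ha
  refine ⟨C * (Real.exp (4 * a) * Real.pi) *
    (eLpNorm (fun w : ℂ => Real.exp (-a * ‖w‖ ^ (1 / α))) p volume).toReal, by positivity,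
    fun M Φ hM hΦ hdec => ?_⟩
  have hball : ∀ z, ballMean Φ z ≤
      M * Real.exp (4 * a) * Real.exp (-(2 * a) * ‖z‖ ^ (1 / α)) * Real.pi := fun z => by
    rw [ballMean]
    refine (le_abs_self _).trans ?_
    have := norm_setIntegral_le_of_norm_le_const (μ := (volume : Measure ℂ))
      (s := Metric.ball z 1) (f := fun u => ‖Φ u‖ * Real.exp (-(Real.pi / 2) * ‖u‖ ^ 2))
      (C := M * Real.exp (4 * a) * Real.exp (-(2 * a) * ‖z‖ ^ (1 / α))) measure_ball_lt_top
      (fun u hu => ?_)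
    · rwa [volume_real_ball] at this
    · rw [Real.norm_of_nonneg (by positivity)]
      refine (hdec u).trans ?_
      rw [mul_assoc, ← Real.exp_add]
      refine mul_le_mul_of_nonneg_left (Real.exp_le_exp.2 ?_) hM
      have := mul_le_mul_of_nonneg_left (rpow_le_of_mem_ball (one_le_inv h1 h2) (inv_le_two h1) hu)
        (by positivity : 0 ≤ 2 * a)
      linarith
  have hpt : ∀ z : ℂ, ‖((Real.exp (a * ‖z‖ ^ (1 / α)) *
      Real.exp (-(Real.pi / 2) * ‖z‖ ^ 2) : ℝ) : ℂ) * creation^[j] Φ z‖ ≤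
      C * (Real.exp (4 * a) * Real.pi) * M * ‖Real.exp (-a * ‖z‖ ^ (1 / α))‖ := fun z => by
    rw [norm_mul, Complex.norm_real, Real.norm_of_nonneg (by positivity),
      Real.norm_of_nonneg (Real.exp_pos _).le]
    have h3 := (h Φ hΦ z).trans (mul_le_mul_of_nonneg_left (hball z) hC)
    have h4 := mul_le_mul_of_nonneg_left h3 (Real.exp_pos (a * ‖z‖ ^ (1 / α))).le
    have e : Real.exp (-a * ‖z‖ ^ (1 / α)) =
        Real.exp (a * ‖z‖ ^ (1 / α)) * Real.exp (-(2 * a) * ‖z‖ ^ (1 / α)) := by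
      rw [← Real.exp_add]; congr 1; ring
    rw [e]
    refine le_of_eq_of_le (by ring) (h4.trans (le_of_eq (by ring)))
  refine (eLpNorm_le_mul_eLpNorm_of_ae_le_mul (Filter.Eventually.of_forall hpt) p).trans
    (le_of_eq ?_)
  rw [mul_right_comm _ (ENNReal.toReal _) M, ENNReal.ofReal_mul (p := C * (Real.exp (4 * a) * Real.pi) * M)
    (by positivity), ENNReal.ofReal_toReal hL.2.ne]

/-- Hölder on a unit disc bounds the local L¹ mean by the Lᵖ norm, which turns an Lᵖ hypothesis into
a pointwise bound; recentring the weight costs half of the rate. -/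
theorem dbar_iter_le_fockNorm {p : ℝ≥0∞} (hp : 1 ≤ p) {α : ℝ} (h1 : 1 / 2 ≤ α) (h2 : α ≤ 1)
    {a : ℝ} (ha : 0 < a) (j : ℕ) : ∃ C : ℝ, 0 ≤ C ∧ ∀ σ : ℂ → ℂ, ContDiff ℝ ∞ σ →
      dbar^[j + 1] σ = 0 → fockNorm p α (2 * a) σ < ⊤ → ∀ z,
      ‖dbar^[j] σ z‖ * Real.exp (-(Real.pi / 2) * ‖z‖ ^ 2) ≤
        C * (fockNorm p α (2 * a) σ).toReal * Real.exp (-a * ‖z‖ ^ (1 / α)) := by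
  obtain ⟨C, hC, h⟩ := dbar_iter_le_ballMean j
  set e : ℝ := 1 / (1 : ℝ≥0∞).toReal - 1 / p.toReal with he
  refine ⟨C * Real.exp (2 * a) * ((ENNReal.ofReal Real.pi) ^ e).toReal, by positivity,
    fun σ hσ h0 hfin z => ?_⟩
  set v : ℂ → ℂ := fun u => ((Real.exp (2 * a * ‖u‖ ^ (1 / α)) *
    Real.exp (-(Real.pi / 2) * ‖u‖ ^ 2) : ℝ) : ℂ) * σ u with hv
  have hvc : Continuous v := by
    have := hσ.continuous
    have h3 : Continuous fun u : ℂ => ‖u‖ ^ (1 / α) :=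
      continuous_norm.rpow_const fun _ => Or.inr (zero_le_one.trans (one_le_inv h1 h2))
    fun_prop
  have hpe : 0 ≤ e := by
    have : p⁻¹ ≤ 1 := ENNReal.inv_le_one.2 hp
    have h4 := ENNReal.toReal_mono (by simp) this
    rw [ENNReal.toReal_inv] at h4
    simp only [he, ENNReal.toReal_one, one_div, inv_one] at h4 ⊢
    linarith
  have hv1 : ∫ u in Metric.ball z 1, ‖v u‖ ≤
      (fockNorm p α (2 * a) σ).toReal * ((ENNReal.ofReal Real.pi) ^ e).toReal := by
    have h5 := eLpNorm_le_eLpNorm_mul_rpow_measure_univ (μ := volume.restrict (Metric.ball z 1))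
      hp hvc.aestronglyMeasurable
    rw [Measure.restrict_apply_univ, Complex.volume_ball] at h5
    have h6 : eLpNorm v p (volume.restrict (Metric.ball z 1)) ≤ fockNorm p α (2 * a) σ :=
      eLpNorm_restrict_le _ _ _ _
    have h7 := h5.trans (mul_le_mul_left h6 _)
    rw [integral_norm_eq_lintegral_enorm hvc.aestronglyMeasurable, ← eLpNorm_one_eq_lintegral_enorm,
      ← ENNReal.toReal_mul]
    refine ENNReal.toReal_mono (ENNReal.mul_ne_top hfin.ne
      (ENNReal.rpow_ne_top_of_nonneg hpe ENNReal.ofReal_ne_top)) (h7.trans (le_of_eq ?_))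
    congr 2
    rw [ENNReal.ofReal_one, one_pow, one_mul]
    exact (ENNReal.ofReal_eq_coe_nnreal Real.pi_pos.le).symm
  have hb : ballMean σ z ≤ Real.exp (2 * a) * Real.exp (-a * ‖z‖ ^ (1 / α)) *
      ∫ u in Metric.ball z 1, ‖v u‖ := by
    rw [ballMean, ← integral_const_mul]
    refine setIntegral_mono_on (integrableOn_ball (by have := hσ.continuous; fun_prop) z 1)
      (integrableOn_ball (by fun_prop) z 1) measurableSet_ball fun u hu => ?_
    rw [hv]
    simp only [norm_mul, Complex.norm_real]
    rw [Real.norm_of_nonneg (by positivity), Real.norm_of_nonneg (by positivity)]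
    have h8 : 1 ≤ Real.exp (2 * a) * Real.exp (-a * ‖z‖ ^ (1 / α)) *
        Real.exp (2 * a * ‖u‖ ^ (1 / α)) := by
      rw [← Real.exp_add, ← Real.exp_add]
      refine Real.one_le_exp ?_
      have := mul_le_mul_of_nonneg_left (rpow_le_of_mem_ball (one_le_inv h1 h2) (inv_le_two h1) hu)
        ha.le
      linarith
    have h9 := mul_le_mul_of_nonneg_right h8
      (by positivity : 0 ≤ ‖σ u‖ * Real.exp (-(Real.pi / 2) * ‖u‖ ^ 2))
    linarith
  calc ‖dbar^[j] σ z‖ * Real.exp (-(Real.pi / 2) * ‖z‖ ^ 2) ≤ C * ballMean σ z := h σ hσ h0 z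
    _ ≤ C * (Real.exp (2 * a) * Real.exp (-a * ‖z‖ ^ (1 / α)) *
        ((fockNorm p α (2 * a) σ).toReal * ((ENNReal.ofReal Real.pi) ^ e).toReal)) := by
      gcongr
      exact hb.trans (by gcongr)
    _ = _ := by ring

/-! ### Comparison of the Gel'fand–Shilov and the Fock norms -/

/-- The constant `(-1)ʲ / √(j!)`. -/
noncomputable def creationCoeff (j : ℕ) : ℂ := (-1) ^ j / (Real.sqrt (j.factorial : ℝ) : ℂ)

theorem norm_creationCoeff (j : ℕ) : ‖creationCoeff j‖ = 1 / Real.sqrt (j.factorial : ℝ) := by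
  rw [creationCoeff, norm_div, norm_pow, norm_neg, norm_one, one_pow, Complex.norm_real,
    Real.norm_of_nonneg (Real.sqrt_nonneg _)]

/-- The added 1 makes the constant nonzero, so that the product is ⊤ when y = ⊤. -/
theorem ennreal_le_mul {x y : ℝ≥0∞} {K : ℝ} (h : y < ⊤ → x ≤ ENNReal.ofReal (K * y.toReal)) :
    x ≤ ((K.toNNReal + 1 : ℝ≥0) : ℝ≥0∞) * y := by
  by_cases hy : y = ⊤
  · rw [hy, ENNReal.mul_top (by simp)]
    exact le_top
  · have hy' := lt_top_iff_ne_top.2 hy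
    refine (h hy').trans ?_
    calc ENNReal.ofReal (K * y.toReal) ≤ ENNReal.ofReal K * ENNReal.ofReal y.toReal :=
          (ENNReal.ofReal_mul' ENNReal.toReal_nonneg).le
      _ = ((K.toNNReal : ℝ≥0) : ℝ≥0∞) * y := by rw [ENNReal.ofReal_toReal hy]; rfl
      _ ≤ _ := by
        push_cast
        exact mul_le_mul_left le_self_add _

theorem GSBound.fockDecay {α A N : ℝ} {f : ℝ → ℂ} (h : GSBound α A N f) (h1 : 1 / 2 ≤ α)
    (h2 : α ≤ 1) (hA : 0 < A) : FockDecay (bargmann f) := by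
  set b : ℝ := min (1 / 4 * A ^ (-(1 / α))) 1 with hb
  have hb0 : 0 < b := lt_min (by positivity) one_pos
  obtain ⟨C, -, hC⟩ := bargmann_decay h1 h2 hA hb0 (min_le_left _ _)
    (tame_of_le (inv_le_two h1) (zero_le_one.trans (one_le_inv h1 h2)) hb0.le
      ((min_le_right _ _).trans (by linarith [Real.pi_gt_three])))
  exact .of_exp (one_le_inv h1 h2) (by positivity) (bargmann_entire h.expBounded).continuous
    (hC N f h)

/-- Decay of Bf loses a factor 8 in the rate and creation a factor 4, whence 32a. -/
theorem fockNorm_trueBargmann_le {p : ℝ≥0∞} (hp : 1 ≤ p) {α : ℝ} (h1 : 1 / 2 ≤ α) (h2 : α ≤ 1)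
    {a A : ℝ} (ha : 0 < a) (hA : 0 < A) (hbA : 32 * a ≤ 1 / 4 * A ^ (-(1 / α)))
    (hT : Tame (1 / α) (32 * a) (Real.pi / 2)) (j : ℕ) : ∃ C : ℝ≥0, ∀ f : ℝ → ℂ, ContDiff ℝ ∞ f →
      fockNorm p α a (trueBargmann j f) ≤ C * gsNorm α A f := by
  obtain ⟨C1, hC1, H1⟩ := bargmann_decay h1 h2 hA (by positivity) hbA hT
  obtain ⟨C2, hC2, H2⟩ := fockNorm_creation_le hp h1 h2 ha j
  refine ⟨(‖creationCoeff j‖ * (C2 * C1)).toNNReal + 1, fun f hf => ennreal_le_mul fun hfin => ?_⟩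
  have hG := GSBound.of_gsNorm hA hf hfin
  have h3 := H2 (C1 * (gsNorm α A f).toReal) (bargmann f) (by positivity)
    (bargmann_entire hG.expBounded) (fun z => by
      have := H1 _ f hG z
      rwa [show 32 * a / 8 = 4 * a by ring] at this)
  rw [trueBargmann_eq hG.expBounded, ← creationCoeff, fockNorm_smul]
  refine (mul_le_mul_right h3 _).trans (le_of_eq ?_)
  rw [← ENNReal.ofReal_mul (norm_nonneg _)]
  congr 1
  ring

theorem dbar_iter_creation {Φ : ℂ → ℂ} (hΦ : Differentiable ℂ Φ) (j : ℕ) (c : ℂ) :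
    dbar^[j] (c • creation^[j] Φ) = (c * (j.factorial * (Real.sqrt Real.pi : ℂ) ^ j)) • Φ := by
  rw [dbar_iter_smul (creation_iter_smooth (smooth_of_entire hΦ) j), dbar_iter_creation_iter hΦ,
    smul_smul]

theorem dbar_iter_succ_creation {Φ : ℂ → ℂ} (hΦ : Differentiable ℂ Φ) (j : ℕ) (c : ℂ) :
    dbar^[j + 1] (c • creation^[j] Φ) = 0 := by
  rw [dbar_iter_smul (creation_iter_smooth (smooth_of_entire hΦ) j),
    dbar_iter_creation_iter_zero hΦ (Nat.lt_succ_self j), smul_zero]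

/-- ∂_{z̄}ʲ returns Φ multiplied by a scalar of modulus √(j!) π^{j/2} ≥ 1, so the factor may be
dropped. -/
theorem entire_le_fockNorm {p : ℝ≥0∞} (hp : 1 ≤ p) {α : ℝ} (h1 : 1 / 2 ≤ α) (h2 : α ≤ 1)
    {a : ℝ} (ha : 0 < a) (j : ℕ) : ∃ C : ℝ, 0 ≤ C ∧ ∀ Φ : ℂ → ℂ, Differentiable ℂ Φ →
      fockNorm p α (2 * a) (creationCoeff j • creation^[j] Φ) < ⊤ → ∀ z,
      ‖Φ z‖ * Real.exp (-(Real.pi / 2) * ‖z‖ ^ 2) ≤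
        C * (fockNorm p α (2 * a) (creationCoeff j • creation^[j] Φ)).toReal *
          Real.exp (-a * ‖z‖ ^ (1 / α)) := by
  obtain ⟨C, hC, H⟩ := dbar_iter_le_fockNorm hp h1 h2 ha j
  refine ⟨C, hC, fun Φ hΦ hfin z => ?_⟩
  have h3 := H (creationCoeff j • creation^[j] Φ)
    ((creation_iter_smooth (smooth_of_entire hΦ) j).const_smul (creationCoeff j)) (dbar_iter_succ_creation hΦ j _) hfin z
  rw [dbar_iter_creation hΦ, Pi.smul_apply, norm_smul] at h3
  refine le_trans ?_ h3
  refine mul_le_mul_of_nonneg_right (le_mul_of_one_le_left (norm_nonneg _) ?_) (Real.exp_pos _).le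
  have hf : (1 : ℝ) ≤ j.factorial := by exact_mod_cast j.factorial_pos
  rw [norm_mul, norm_creationCoeff, norm_mul, norm_pow, Complex.norm_natCast, Complex.norm_real,
    Real.norm_of_nonneg (Real.sqrt_nonneg _), ← mul_assoc]
  have e : 1 / Real.sqrt (j.factorial : ℝ) * j.factorial = Real.sqrt j.factorial := by
    rw [one_div_mul_eq_div, Real.div_sqrt]
  rw [e]
  exact one_le_mul_of_one_le_of_one_le (Real.one_le_sqrt.2 hf)
    (one_le_pow₀ (Real.one_le_sqrt.2 (by linarith [Real.pi_gt_three])))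

theorem fockDecay_of_fockNorm {p : ℝ≥0∞} (hp : 1 ≤ p) {α : ℝ} (h1 : 1 / 2 ≤ α) (h2 : α ≤ 1)
    {a : ℝ} (ha : 0 < a) (j : ℕ) {Φ : ℂ → ℂ} (hΦ : Differentiable ℂ Φ)
    (hfin : fockNorm p α a (creationCoeff j • creation^[j] Φ) < ⊤) : FockDecay Φ := by
  obtain ⟨C, -, H⟩ := entire_le_fockNorm hp h1 h2 (half_pos ha) j
  rw [mul_div_cancel₀ a two_ne_zero] at H
  exact .of_exp (one_le_inv h1 h2) (half_pos ha) hΦ.continuous (H Φ hΦ hfin)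

theorem gsBound_of_fockNorm {p : ℝ≥0∞} (hp : 1 ≤ p) {α : ℝ} (h1 : 1 / 2 ≤ α) (h2 : α ≤ 1)
    {b B CB : ℝ} (hb : 0 < b) (hB : 0 < B)
    (hCB : ∀ m : ℕ, Real.sqrt m.factorial * Real.exp Real.pi ^ m ≤
      CB * B ^ m * (m.factorial : ℝ) ^ α) (hT : Tame (1 / α) (2 * b) (Real.pi / 2)) (j : ℕ) :
    ∃ C : ℝ, ∀ Φ : ℂ → ℂ, Differentiable ℂ Φ →
      fockNorm p α (8 * b) (creationCoeff j • creation^[j] Φ) < ⊤ →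
      GSBound α (B + 2 * Real.pi * b ^ (-α))
        (C * (fockNorm p α (8 * b) (creationCoeff j • creation^[j] Φ)).toReal) (bargmannAdj Φ) := by
  obtain ⟨C1, hC1, H1⟩ := entire_le_fockNorm hp h1 h2 (mul_pos (by norm_num : (0 : ℝ) < 4) hb) j
  obtain ⟨C2, hC2, H2⟩ := gsBound_bargmannAdj h1 h2 hb hB hCB hT
  rw [show 2 * (4 * b) = 8 * b by ring] at H1
  refine ⟨C2 * C1, fun Φ hΦ hfin => ?_⟩
  rw [mul_assoc C2]
  exact H2 _ Φ (by positivity) hΦ.continuous (H1 Φ hΦ hfin)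

theorem trueBargmann_zero (j : ℕ) : trueBargmann j 0 = 0 := by
  funext z
  simp [trueBargmann, stft]

theorem fockNorm_zero (p : ℝ≥0∞) (α a : ℝ) : fockNorm p α a 0 = 0 := by
  have := fockNorm_smul p α a 0 0
  simpa using this

theorem trueBargmann_bound_roumieu {p : ℝ≥0∞} (hp : 1 ≤ p) {α : ℝ} (h1 : 1 / 2 ≤ α) (h2 : α ≤ 1)
    {A : ℝ} (hA : 0 < A) : ∃ a : ℝ, 0 < a ∧ ∀ j : ℕ, ∃ C : ℝ≥0, ∀ f : ℝ → ℂ, ContDiff ℝ ∞ f →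
      fockNorm p α a (trueBargmann j f) ≤ C * gsNorm α A f := by
  -- The cap 1 < π/2 keeps the weight below the Gaussian when 1/α = 2.
  set b : ℝ := min (1 / 4 * A ^ (-(1 / α))) 1 with hb
  have hb0 : 0 < b := lt_min (by positivity) one_pos
  have e : 32 * (b / 32) = b := by ring
  refine ⟨b / 32, by positivity, fun j => fockNorm_trueBargmann_le hp h1 h2 (by positivity) hA
    (by rw [e]; exact min_le_left _ _) ?_ j⟩
  rw [e]
  exact tame_of_le (inv_le_two h1) (zero_le_one.trans (one_le_inv h1 h2)) hb0.le
      ((min_le_right _ _).trans (by linarith [Real.pi_gt_three]))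

theorem inv_lt_two {α : ℝ} (h : 1 / 2 < α) : 1 / α < 2 := by
  rw [div_lt_iff₀ (by linarith)]
  linarith

theorem trueBargmann_bound_beurling {p : ℝ≥0∞} (hp : 1 ≤ p) {α : ℝ} (h1 : 1 / 2 ≤ α) (h2 : α ≤ 1)
    {a : ℝ} (ha : 0 < a) : ∃ A : ℝ, 0 < A ∧ ∀ j : ℕ, ∃ C : ℝ≥0, ∀ f : ℝ → ℂ, ContDiff ℝ ∞ f →
      fockNorm p α a (trueBargmann j f) ≤ C * gsNorm α A f := by
  have hα : 0 < α := by linarith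
  rcases h1.eq_or_lt with rfl | h
  -- For α = 1/2 finiteness of the norm with A = 1/4 already forces f = 0.
  · refine ⟨1 / 4, by norm_num, fun j => ⟨(0 : ℝ).toNNReal + 1, fun f hf =>
      ennreal_le_mul fun hfin => ?_⟩⟩
    rw [(GSBound.of_gsNorm (by norm_num) hf hfin).eq_zero, trueBargmann_zero, fockNorm_zero]
    exact bot_le
  -- This A solves (1/4)A^{-1/α} = 32a.
  · refine ⟨(128 * a) ^ (-α), by positivity, fun j => fockNorm_trueBargmann_le hp h1 h2 ha
      (by positivity) ?_ (tame_of_lt (inv_lt_two h) (by positivity) _ (by positivity)) j⟩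
    rw [← Real.rpow_mul (by positivity), show -α * -(1 / α) = 1 by field_simp, Real.rpow_one]
    linarith

theorem bargmannAdj_bound_roumieu {p : ℝ≥0∞} (hp : 1 ≤ p) {α : ℝ} (h1 : 1 / 2 ≤ α) (h2 : α ≤ 1)
    {a : ℝ} (ha : 0 < a) : ∃ A : ℝ, 0 < A ∧ ∀ j : ℕ, ∃ C : ℝ, ∀ Φ : ℂ → ℂ, Differentiable ℂ Φ →
      fockNorm p α a (creationCoeff j • creation^[j] Φ) < ⊤ →
      GSBound α A (C * (fockNorm p α a (creationCoeff j • creation^[j] Φ)).toReal)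
        (bargmannAdj Φ) := by
  set b : ℝ := min (a / 8) (1 / 2) with hb
  have hb0 : 0 < b := lt_min (by positivity) (by norm_num)
  have hba : 8 * b ≤ a := by linarith [min_le_left (a / 8) (1 / 2 : ℝ)]
  have hb1 : b ≤ 1 / 2 := min_le_right _ _
  refine ⟨Real.exp Real.pi + 2 * Real.pi * b ^ (-α), by positivity, fun j => ?_⟩
  obtain ⟨C, H⟩ := gsBound_of_fockNorm hp h1 h2 hb0 (Real.exp_pos _) (gaussian_const_roumieu h1)
    (tame_of_le (inv_le_two h1) (zero_le_one.trans (one_le_inv h1 h2)) (by positivity)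
      (by linarith [Real.pi_gt_three])) j
  refine ⟨|C|, fun Φ hΦ hfin => ?_⟩
  have hm := fockNorm_mono p α hba (creationCoeff j • creation^[j] Φ)
  have h3 := H Φ hΦ (hm.trans_lt hfin)
  refine ⟨h3.smooth, fun k l x => (h3.bound k l x).trans ?_⟩
  have h4 : C * (fockNorm p α (8 * b) (creationCoeff j • creation^[j] Φ)).toReal ≤
      |C| * (fockNorm p α a (creationCoeff j • creation^[j] Φ)).toReal :=
    mul_le_mul (le_abs_self C) (ENNReal.toReal_mono hfin.ne hm) ENNReal.toReal_nonneg (abs_nonneg C)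
  gcongr

theorem bargmannAdj_bound_beurling {p : ℝ≥0∞} (hp : 1 ≤ p) {α : ℝ} (h1 : 1 / 2 ≤ α) (h2 : α ≤ 1)
    {A : ℝ} (hA : 0 < A) : ∃ a : ℝ, 0 < a ∧ ∀ j : ℕ, ∃ C : ℝ, ∀ Φ : ℂ → ℂ, Differentiable ℂ Φ →
      fockNorm p α a (creationCoeff j • creation^[j] Φ) < ⊤ →
      GSBound α A (C * (fockNorm p α a (creationCoeff j • creation^[j] Φ)).toReal)
        (bargmannAdj Φ) := by
  have hα : 0 < α := by linarith
  rcases h1.eq_or_lt with rfl | h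
  -- For α = 1/2 the norm with parameter 2π gives weighted decay e^{-π|z|²}, faster than the Fock
  -- weight e^{-π|z|²/2}, so Φ = 0.
  · refine ⟨2 * Real.pi, by positivity, fun j => ⟨0, fun Φ hΦ hfin => ?_⟩⟩
    obtain ⟨C, -, H⟩ := entire_le_fockNorm hp h1 h2 Real.pi_pos j
    have h3 : Φ = 0 := by
      refine entire_eq_zero_of_fock_decay hΦ (c := Real.pi)
        (M := C * (fockNorm p (1 / 2) (2 * Real.pi) (creationCoeff j • creation^[j] Φ)).toReal) (by linarith [Real.pi_pos])
        fun z => (H Φ hΦ hfin z).trans (le_of_eq ?_)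
      rw [show (1 / (1 / 2) : ℝ) = ((2 : ℕ) : ℝ) by norm_num, Real.rpow_natCast]
    have h4 : bargmannAdj Φ = 0 := by
      funext t
      simp [h3, bargmannAdj, adjKernel]
    rw [h4, zero_mul]
    refine ⟨contDiff_const, fun k l x => ?_⟩
    have : iteratedDeriv l (0 : ℝ → ℂ) x = 0 := by
      have := iteratedDeriv_const_smul_field (n := l) (x := x) (0 : ℂ) (0 : ℝ → ℂ)
      rwa [zero_smul, zero_smul] at this
    simp [this]
  -- With this b one has 2πb^{-α} = A/2; the other half of A is the Gaussian constant B.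
  · set b : ℝ := (A / (4 * Real.pi)) ^ (-(1 / α)) with hb
    have hb0 : 0 < b := by positivity
    obtain ⟨CB, hCB⟩ := gaussian_const_beurling h (half_pos hA)
    refine ⟨8 * b, by positivity, fun j => ?_⟩
    obtain ⟨C, H⟩ := gsBound_of_fockNorm hp h1 h2 hb0 (half_pos hA) hCB
      (tame_of_lt (inv_lt_two h) (by positivity) _ (by positivity)) j
    have e : A / 2 + 2 * Real.pi * b ^ (-α) = A := by
      rw [hb, ← Real.rpow_mul (by positivity), show -(1 / α) * -α = 1 by field_simp, Real.rpow_one]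
      field_simp
      ring
    rw [e] at H
    exact ⟨C, H⟩

/-! ### Topologies generated by seminorms -/

section Topology

variable {E G : Type*} [AddCommGroup E] [Module ℂ E] [AddCommGroup G] [Module ℂ G]

theorem continuous_seminormTopology {P : Seminorm ℂ E → Prop} {Q : Seminorm ℂ G → Prop}
    (T : E →ₗ[ℂ] G) (h : ∀ q, Q q → P (q.comp T)) :
    @Continuous E G (seminormTopology P) (seminormTopology Q) T := by
  refine continuous_iInf_rng.2 fun q => ?_
  refine continuous_iInf_dom (i := ⟨q.1.comp T, h q.1 q.2⟩) ?_
  let _ : SeminormedAddCommGroup E := (q.1.comp T).toSeminormedAddCommGroup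
  let _ : SeminormedAddCommGroup G := q.1.toSeminormedAddCommGroup
  exact AddMonoidHomClass.continuous_of_bound T 1 fun x => by rw [one_mul]; rfl

theorem continuousAdd_seminormTopology (P : Seminorm ℂ E → Prop) :
    @ContinuousAdd E (seminormTopology P) _ :=
  continuousAdd_iInf fun q => by
    let _ : SeminormedAddCommGroup E := q.1.toSeminormedAddCommGroup
    infer_instance

theorem ofReal_le_mul_trans {x y z : ℝ≥0∞} {C D : ℝ≥0} (h1 : x ≤ C * y) (h2 : y ≤ D * z) :
    x ≤ (C * D : ℝ≥0) * z := by
  rw [ENNReal.coe_mul, mul_assoc]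
  exact h1.trans (mul_le_mul_right h2 _)

/-- Each step of the source is mapped boundedly into some step of the target. In the projective case
the quantifiers over source and target parameters are exchanged. -/
theorem continuous_inductiveTopology {N : ℝ → E → ℝ≥0∞} {M : ℝ → G → ℝ≥0∞} (T : E →ₗ[ℂ] G)
    (h : ∀ A : ℝ, 0 < A → ∃ a : ℝ, 0 < a ∧ ∃ C : ℝ≥0, ∀ x, M a (T x) ≤ C * N A x) :
    @Continuous E G (inductiveTopology N) (inductiveTopology M) T :=
  continuous_seminormTopology T fun q hq A hA => by
    obtain ⟨a, ha, C, hC⟩ := h A hA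
    obtain ⟨D, hD⟩ := hq a ha
    exact ⟨D * C, fun x => ofReal_le_mul_trans (hD (T x)) (hC x)⟩

theorem continuous_projectiveTopology {N : ℝ → E → ℝ≥0∞} {M : ℝ → G → ℝ≥0∞} (T : E →ₗ[ℂ] G)
    (h : ∀ a : ℝ, 0 < a → ∃ A : ℝ, 0 < A ∧ ∃ C : ℝ≥0, ∀ x, M a (T x) ≤ C * N A x) :
    @Continuous E G (projectiveTopology N) (projectiveTopology M) T :=
  continuous_seminormTopology T fun q ⟨a, ha, D, hD⟩ => by
    obtain ⟨A, hA, C, hC⟩ := h a ha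
    exact ⟨A, hA, D * C, fun x => ofReal_le_mul_trans (hD (T x)) (hC x)⟩

variable [TopologicalSpace E] [TopologicalSpace G]

/-- A linear equivalence from a finite power that is continuous in each coordinate, with continuous
coordinates of the inverse. -/
def continuousEquivOfCoord {ι : Type*} [Fintype ι] [DecidableEq ι] [ContinuousAdd G]
    (e : (ι → E) ≃ₗ[ℂ] G)
    (h1 : ∀ j, Continuous (e.toLinearMap ∘ₗ LinearMap.single ℂ (fun _ : ι => E) j))
    (h2 : ∀ j, Continuous (LinearMap.proj (R := ℂ) (φ := fun _ : ι => E) j ∘ₗ e.symm.toLinearMap)) :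
    (ι → E) ≃L[ℂ] G where
  toLinearEquiv := e
  continuous_toFun := by
    have : (e : (ι → E) → G) = fun f => ∑ j, (e.toLinearMap ∘ₗ LinearMap.single ℂ (fun _ => E) j) (f j) := by
      funext f
      simp only [LinearMap.comp_apply, ← map_sum]
      exact congrArg e (Finset.univ_sum_single f).symm
    change Continuous (e : (ι → E) → G)
    rw [this]
    exact continuous_finsetSum _ fun j _ => (h1 j).comp (continuous_apply j)
  continuous_invFun := continuous_pi h2

/-- The linear homeomorphism of the strong duals that is dual to a linear homeomorphism from a
finite power. -/
noncomputable def dualEquiv {ι : Type*} [Fintype ι] [DecidableEq ι] (e : (ι → E) ≃L[ℂ] G) :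
    (ι → StrongDual ℂ E) ≃L[ℂ] StrongDual ℂ G :=
  ContinuousLinearEquiv.equivOfInverse
    (∑ j, (ContinuousLinearMap.precomp ℂ
      ((ContinuousLinearMap.proj (R := ℂ) (φ := fun _ : ι => E) j).comp
        (e.symm : G →L[ℂ] (ι → E)))).comp
      (ContinuousLinearMap.proj (R := ℂ) (φ := fun _ : ι => StrongDual ℂ E) j))
    (ContinuousLinearMap.pi fun j => ContinuousLinearMap.precomp ℂ
      ((e : (ι → E) →L[ℂ] G).comp (ContinuousLinearMap.single ℂ (fun _ : ι => E) j)))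
    (fun T => by
      funext j
      ext x
      simp [Pi.single_apply, apply_ite])
    (fun S => by
      ext σ
      simp only [ContinuousLinearMap.comp_apply, sum_apply, ContinuousLinearMap.proj_apply,
        ContinuousLinearMap.pi_apply, ContinuousLinearMap.precomp_apply,
        ContinuousLinearEquiv.coe_coe, ContinuousLinearMap.single_apply, ← map_sum,
        Finset.univ_sum_single, ContinuousLinearEquiv.apply_symm_apply])

theorem dualEquiv_apply {ι : Type*} [Fintype ι] [DecidableEq ι] (e : (ι → E) ≃L[ℂ] G)
    (T : ι → StrongDual ℂ E) (f : ι → E) : dualEquiv e T (e f) = ∑ j, T j (f j) := by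
  simp [dualEquiv]

theorem le_dualNorm_mul {N : E → ℝ≥0∞} (hN : ∀ (c : ℂ) x, N (c • x) = ENNReal.ofReal ‖c‖ * N x)
    (T : StrongDual ℂ E) (hD : dualNorm N T ≠ ⊤) {x : E} (hx : N x ≠ ⊤) :
    ENNReal.ofReal ‖T x‖ ≤ dualNorm N T * N x := by
  set d := (dualNorm N T).toReal
  set r := (N x).toReal
  have hd : 0 ≤ d := ENNReal.toReal_nonneg
  have hr : 0 ≤ r := ENNReal.toReal_nonneg
  -- Normalizing by s > N x instead of N x covers the case N x = 0, since N need not be definite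
  -- here.
  have key : ∀ s : ℝ, r < s → ‖T x‖ ≤ d * s := fun s hs => by
    have hs0 : 0 < s := hr.trans_lt hs
    have h1 : N (((s⁻¹ : ℝ) : ℂ) • x) ≤ 1 := by
      rw [hN, Complex.norm_real, Real.norm_of_nonneg (by positivity), ← ENNReal.ofReal_toReal hx,
        ← ENNReal.ofReal_mul (by positivity), ← ENNReal.ofReal_one]
      refine ENNReal.ofReal_le_ofReal ?_
      rw [inv_mul_le_iff₀ hs0, mul_one]
      exact hs.le
    have h2 : ENNReal.ofReal ‖T (((s⁻¹ : ℝ) : ℂ) • x)‖ ≤ dualNorm N T :=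
      le_iSup₂_of_le _ h1 le_rfl
    have h3 := (ENNReal.ofReal_le_iff_le_toReal hD).1 h2
    rw [map_smul, norm_smul, Complex.norm_real, Real.norm_of_nonneg (by positivity),
      inv_mul_le_iff₀ hs0] at h3
    linarith
  rw [← ENNReal.ofReal_toReal hD, ← ENNReal.ofReal_toReal hx, ← ENNReal.ofReal_mul hd]
  refine ENNReal.ofReal_le_ofReal (le_of_forall_pos_le_add fun ε hε => ?_)
  refine (key (r + ε / (d + 1)) (by linarith [div_pos hε (by linarith : 0 < d + 1)])).trans ?_
  have : d * (ε / (d + 1)) ≤ ε := by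
    rw [mul_div_assoc', div_le_iff₀ (by linarith)]
    nlinarith
  rw [mul_add]
  exact add_le_add_right this _

/-- The dual of an ℓ¹ sum carries the maximum norm: ≤ is Hölder, and ≥ follows by testing on vectors
with one nonzero coordinate. -/
theorem dualNorm_eq_iSup {ι : Type*} [Fintype ι] [DecidableEq ι] (e : (ι → E) ≃L[ℂ] G)
    {M : G → ℝ≥0∞} {N : ι → E → ℝ≥0∞} (hM : ∀ f, M (e f) = ∑ j, N j (f j))
    (hN : ∀ j (c : ℂ) x, N j (c • x) = ENNReal.ofReal ‖c‖ * N j x)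
    (T : ι → StrongDual ℂ E) :
    dualNorm M (dualEquiv e T) = ⨆ j, dualNorm (N j) (T j) := by
  have hN0 : ∀ j, N j 0 = 0 := fun j => by simpa using hN j 0 0
  refine le_antisymm ?_ (iSup_le fun j => iSup₂_le fun x hx => ?_)
  · by_cases hD : ⨆ j, dualNorm (N j) (T j) = ⊤
    · rw [hD]; exact le_top
    refine iSup₂_le fun σ hσ => ?_
    obtain ⟨f, rfl⟩ := e.surjective σ
    rw [hM] at hσ
    rw [dualEquiv_apply]
    have hle : ∀ j, ENNReal.ofReal ‖T j (f j)‖ ≤ (⨆ j, dualNorm (N j) (T j)) * N j (f j) :=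
      fun j => by
        have h1 : dualNorm (N j) (T j) ≤ ⨆ j, dualNorm (N j) (T j) :=
          le_iSup (fun j => dualNorm (N j) (T j)) j
        have h2 : N j (f j) ≤ 1 :=
          (Finset.single_le_sum (f := fun j => N j (f j)) (fun _ _ => bot_le)
            (Finset.mem_univ j)).trans hσ
        exact (le_dualNorm_mul (hN j) (T j) (ne_top_of_le_ne_top hD h1)
          (ne_top_of_le_ne_top ENNReal.one_ne_top h2)).trans (mul_le_mul_left h1 _)
    calc ENNReal.ofReal ‖∑ j, T j (f j)‖ ≤ ENNReal.ofReal (∑ j, ‖T j (f j)‖) :=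
          ENNReal.ofReal_le_ofReal (norm_sum_le _ _)
      _ = ∑ j, ENNReal.ofReal ‖T j (f j)‖ := ENNReal.ofReal_sum_of_nonneg fun _ _ => norm_nonneg _
      _ ≤ ∑ j, (⨆ j, dualNorm (N j) (T j)) * N j (f j) := Finset.sum_le_sum fun j _ => hle j
      _ = (⨆ j, dualNorm (N j) (T j)) * ∑ j, N j (f j) := (Finset.mul_sum _ _ _).symm
      _ ≤ (⨆ j, dualNorm (N j) (T j)) * 1 := mul_le_mul_right hσ _
      _ = _ := mul_one _
  · have h1 : M (e (Pi.single j x)) ≤ 1 := by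
      rw [hM, Finset.sum_eq_single j, Pi.single_eq_same]
      · exact hx
      · intro k _ hk
        rw [Pi.single_eq_of_ne hk, hN0]
      · simp
    refine le_iSup₂_of_le _ h1 ?_
    rw [dualEquiv_apply, Finset.sum_eq_single j, Pi.single_eq_same]
    · intro k _ hk
      rw [Pi.single_eq_of_ne hk, map_zero]
    · simp

end Topology

/-! ### The true poly-Bargmann transform as a map into `L²(ℂ, dμ)` -/

theorem norm_trueBargmann (j : ℕ) (f : ℝ → ℂ) (z : ℂ) : ‖trueBargmann j f z‖ =
    Real.exp (Real.pi / 2 * ‖z‖ ^ 2) *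
      ‖stft (fun t => (hermiteFn j t : ℂ)) f z.re (-z.im)‖ := by
  have e1 : ‖Complex.exp (-Complex.I * (Real.pi : ℂ) * (z.re : ℂ) * (z.im : ℂ))‖ = 1 := by
    rw [show -Complex.I * (Real.pi : ℂ) * (z.re : ℂ) * (z.im : ℂ) =
      ((-(Real.pi * z.re * z.im) : ℝ) : ℂ) * Complex.I by push_cast; ring,
      Complex.norm_exp_ofReal_mul_I]
  have e2 : ‖Complex.exp ((Real.pi : ℂ) * ((z.re : ℂ) ^ 2 + (z.im : ℂ) ^ 2) / 2)‖ =
      Real.exp (Real.pi / 2 * ‖z‖ ^ 2) := by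
    rw [show (Real.pi : ℂ) * ((z.re : ℂ) ^ 2 + (z.im : ℂ) ^ 2) / 2 =
      ((Real.pi / 2 * (z.re ^ 2 + z.im ^ 2) : ℝ) : ℂ) by push_cast; ring, Complex.norm_exp,
      Complex.ofReal_re, ← Complex.normSq_eq_norm_sq, Complex.normSq_apply, ← sq, ← sq]
  rw [trueBargmann, norm_mul, norm_mul, e1, e2, one_mul]

/-- The prefactors of 𝓑ʲ have modulus e^{π|z|²/2}, which the weight cancels. Complex conjugation, a
measure preserving change of variables, removes the sign in V_{h_j}f(x,-ω). -/
theorem fockNorm_trueBargmann (p : ℝ≥0∞) (α a : ℝ) (j : ℕ) (f : ℝ → ℂ) :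
    fockNorm p α a (trueBargmann j f) = modNorm p α a j f := by
  have hmp : MeasurePreserving (fun z : ℂ => Complex.measurableEquivRealProd (Complex.conjLIE z)) :=
    Complex.volume_preserving_equiv_real_prod.comp Complex.conjLIE.measurePreserving
  have hemb : MeasurableEmbedding
      (fun z : ℂ => Complex.measurableEquivRealProd (Complex.conjLIE z)) :=
    Complex.measurableEquivRealProd.measurableEmbedding.comp
      Complex.conjLIE.toHomeomorph.measurableEmbedding
  rw [modNorm, ← hmp.map_eq, hemb.eLpNorm_map_measure, fockNorm]
  refine eLpNorm_congr_norm_ae (Filter.Eventually.of_forall fun z => ?_)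
  have hz : (z.re ^ 2 + (-z.im) ^ 2) ^ (1 / (2 * α)) = ‖z‖ ^ (1 / α) := by
    rw [show z.re ^ 2 + (-z.im) ^ 2 = ‖z‖ ^ (2 : ℝ) by
      rw [Real.rpow_two, ← Complex.normSq_eq_norm_sq, Complex.normSq_apply]; ring,
      ← Real.rpow_mul (norm_nonneg z)]
    congr 1
    rw [one_div, mul_inv]
    ring
  simp only [Function.comp_apply, Complex.measurableEquivRealProd_apply, Complex.conjLIE_apply,
    Complex.conj_re, Complex.conj_im, norm_mul, Complex.norm_real, norm_trueBargmann, hz]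
  rw [Real.norm_of_nonneg (Real.exp_pos _).le, Real.norm_of_nonneg (Real.exp_pos _).le]
  have : Real.exp (-(Real.pi / 2) * ‖z‖ ^ 2) * Real.exp (Real.pi / 2 * ‖z‖ ^ 2) = 1 := by
    rw [← Real.exp_add, show -(Real.pi / 2) * ‖z‖ ^ 2 + Real.pi / 2 * ‖z‖ ^ 2 = 0 by ring,
      Real.exp_zero]
  linear_combination (Real.exp (a * ‖z‖ ^ (1 / α)) *
    ‖stft (fun t => (hermiteFn j t : ℂ)) f z.re (-z.im)‖) * this

theorem trueBargmann_smul (j : ℕ) (c : ℂ) (f : ℝ → ℂ) :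
    trueBargmann j (c • f) = c • trueBargmann j f := by
  funext z
  simp only [trueBargmann, stft, Pi.smul_apply, smul_eq_mul, mul_assoc, integral_const_mul]
  ring

theorem modNorm_smul (p : ℝ≥0∞) (α a : ℝ) (j : ℕ) (c : ℂ) (f : ℝ → ℂ) :
    modNorm p α a j (c • f) = ENNReal.ofReal ‖c‖ * modNorm p α a j f := by
  rw [← fockNorm_trueBargmann, ← fockNorm_trueBargmann, trueBargmann_smul, fockNorm_smul]

theorem eLpNorm_weighted (p : ℝ≥0∞) (α a : ℝ) (j : ℕ) {σ : L2Gauss} {F : ℂ → ℂ}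
    (h : polyProj j σ =ᵐ[gaussMeasure] F) :
    eLpNorm (weighted α a j σ) p volume = fockNorm p α a F := by
  refine eLpNorm_congr_ae ?_
  filter_upwards [volume_ac.ae_le h] with z hz
  simp only [weighted, hz]

theorem FockDecay.memLp {Φ : ℂ → ℂ} (h : FockDecay Φ) : MemLp Φ 2 gaussMeasure := by
  rw [memLp_gauss_iff h.cont]
  obtain ⟨M, hM⟩ := h.bdd
  have hc := h.cont
  refine (h.int.const_mul M).mono' (Continuous.aestronglyMeasurable (by fun_prop))
    (Filter.Eventually.of_forall fun z => ?_)
  rw [Real.norm_of_nonneg (by positivity), sq]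
  exact mul_le_mul_of_nonneg_right (hM z) (by positivity)

theorem exists_gsBound {α : ℝ} {f : ℝ → ℂ} (hf : f ∈ gsRoumieuSub α) :
    ∃ A N : ℝ, 0 < A ∧ GSBound α A N f := by
  obtain ⟨hs, A, hA, h⟩ := hf
  exact ⟨A, _, hA, .of_gsNorm hA hs h⟩

theorem trueBargmann_eq_smul {α : ℝ} {f : ℝ → ℂ} (hf : f ∈ gsRoumieuSub α) (j : ℕ) :
    trueBargmann j f = creationCoeff j • creation^[j] (bargmann f) := by
  obtain ⟨A, N, hA, h⟩ := exists_gsBound hf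
  exact trueBargmann_eq h.expBounded j

theorem expBounded_of_mem {α : ℝ} {f : ℝ → ℂ} (hf : f ∈ gsRoumieuSub α) : ExpBounded f := by
  obtain ⟨A, N, hA, h⟩ := exists_gsBound hf
  exact h.expBounded

theorem fockDecay_of_mem {α : ℝ} (h1 : 1 / 2 ≤ α) (h2 : α ≤ 1) {f : ℝ → ℂ}
    (hf : f ∈ gsRoumieuSub α) : FockDecay (bargmann f) := by
  obtain ⟨A, N, hA, h⟩ := exists_gsBound hf
  exact h.fockDecay h1 h2 hA

theorem bargmann_entire_of_mem {α : ℝ} {f : ℝ → ℂ} (hf : f ∈ gsRoumieuSub α) :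
    Differentiable ℂ (bargmann f) := bargmann_entire (expBounded_of_mem hf)

theorem memLp_trueBargmann {α : ℝ} (h1 : 1 / 2 ≤ α) (h2 : α ≤ 1) {f : ℝ → ℂ}
    (hf : f ∈ gsRoumieuSub α) (j : ℕ) : MemLp (trueBargmann j f) 2 gaussMeasure := by
  rw [trueBargmann_eq_smul hf]
  exact (memLp_creation_iter (bargmann_entire_of_mem hf) (fockDecay_of_mem h1 h2 hf).memLp
    j).const_smul _

theorem trueBargmann_add {α : ℝ} {f g : ℝ → ℂ} (hf : f ∈ gsRoumieuSub α)
    (hg : g ∈ gsRoumieuSub α) (j : ℕ) :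
    trueBargmann j (f + g) = trueBargmann j f + trueBargmann j g := by
  have e : bargmann (f + g) = bargmann f + (1 : ℂ) • bargmann g := by
    funext z
    simp only [bargmann, Pi.add_apply, add_mul, one_smul]
    exact integral_add (integrable_mul_bargmannKernel (expBounded_of_mem hf) z)
      (integrable_mul_bargmannKernel (expBounded_of_mem hg) z)
  rw [trueBargmann_eq_smul (add_mem hf hg), trueBargmann_eq_smul hf, trueBargmann_eq_smul hg, e,
    creation_iter_lin (smooth_of_entire (bargmann_entire_of_mem hf))
      (smooth_of_entire (bargmann_entire_of_mem hg)), one_smul, smul_add]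

/-- The true poly-Bargmann transform of order `j` as a linear map into `L²(ℂ, dμ)`. -/
noncomputable def trueBargmannL2 {α : ℝ} (h1 : 1 / 2 ≤ α) (h2 : α ≤ 1) (j : ℕ) :
    gsRoumieuSub α →ₗ[ℂ] L2Gauss where
  toFun f := (memLp_trueBargmann h1 h2 f.2 j).toLp _
  map_add' f g := by
    rw [← MemLp.toLp_add]
    exact MemLp.toLp_congr _ _ (Filter.EventuallyEq.of_eq (trueBargmann_add f.2 g.2 j))
  map_smul' c f := by
    rw [RingHom.id_apply, ← MemLp.toLp_const_smul]
    exact MemLp.toLp_congr _ _ (Filter.EventuallyEq.of_eq (trueBargmann_smul j c f))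

/-- The bounds for the adjoint transform, applied to Φ = Bf, whose adjoint transform is f. -/
theorem gsNorm_le_modNorm {α A a : ℝ} (h1 : 1 / 2 ≤ α) (h2 : α ≤ 1) {p : ℝ≥0∞} (hA : 0 < A) {j : ℕ} {C : ℝ}
    (H : ∀ Φ : ℂ → ℂ, Differentiable ℂ Φ →
      fockNorm p α a (creationCoeff j • creation^[j] Φ) < ⊤ →
      GSBound α A (C * (fockNorm p α a (creationCoeff j • creation^[j] Φ)).toReal)
        (bargmannAdj Φ)) (f : gsRoumieuSub α) :
    gsNorm α A f ≤ ((C.toNNReal + 1 : ℝ≥0) : ℝ≥0∞) * modNorm p α a j f := by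
  refine ennreal_le_mul fun hfin => ?_
  have h3 := H _ (bargmann_entire_of_mem f.2)
  rw [← trueBargmann_eq_smul f.2, fockNorm_trueBargmann,
    bargmannAdj_bargmann (expBounded_of_mem f.2) (fockDecay_of_mem h1 h2 f.2)] at h3
  exact (h3 hfin).gsNorm_le hA

section

variable {α : ℝ} (h1 : 1 / 2 ≤ α) (h2 : α ≤ 1)

theorem trueBargmannL2_ae (j : ℕ) (f : gsRoumieuSub α) :
    trueBargmannL2 h1 h2 j f =ᵐ[gaussMeasure] trueBargmann j f :=
  MemLp.coeFn_toLp (memLp_trueBargmann h1 h2 f.2 j)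

/-- The sign (-1)ʲ, absent from the definition of `trueFock`, is absorbed into the entire function.
-/
theorem trueFock_of_ae {j : ℕ} {F : L2Gauss} {Φ : ℂ → ℂ} (hΦ : Differentiable ℂ Φ)
    (hL : MemLp Φ 2 gaussMeasure) (h : F =ᵐ[gaussMeasure] creationCoeff j • creation^[j] Φ) :
    F ∈ trueFock j := by
  refine ⟨((-1 : ℂ) ^ j) • Φ, hΦ.const_smul _, hL.const_smul _, h.trans ?_⟩
  rw [creation_iter_smul (smooth_of_entire hΦ), smul_smul, creationCoeff, div_eq_mul_one_div,
    mul_comm]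

theorem trueFock_exists {j : ℕ} {F : L2Gauss} (hF : F ∈ trueFock j) : ∃ Φ : ℂ → ℂ,
    Differentiable ℂ Φ ∧ F =ᵐ[gaussMeasure] creationCoeff j • creation^[j] Φ := by
  obtain ⟨Φ, hΦ, -, h⟩ := hF
  refine ⟨((-1 : ℂ) ^ j) • Φ, hΦ.const_smul _, h.trans ?_⟩
  rw [creation_iter_smul (smooth_of_entire hΦ), smul_smul, creationCoeff, div_mul_eq_mul_div,
    ← mul_pow, neg_one_mul, neg_neg, one_pow]

theorem trueBargmannL2_mem (j : ℕ) (f : gsRoumieuSub α) : trueBargmannL2 h1 h2 j f ∈ trueFock j :=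
  trueFock_of_ae (bargmann_entire_of_mem f.2) (fockDecay_of_mem h1 h2 f.2).memLp
    ((trueBargmannL2_ae h1 h2 j f).trans (Filter.EventuallyEq.of_eq (trueBargmann_eq_smul f.2 j)))

/-- Inversion of the true poly-Bargmann transform. -/
theorem bargmannAdj_eq_of_ae {j : ℕ} {f : gsRoumieuSub α} {Φ : ℂ → ℂ} (hΦ : Differentiable ℂ Φ)
    (h : trueBargmannL2 h1 h2 j f =ᵐ[gaussMeasure] creationCoeff j • creation^[j] Φ) :
    bargmannAdj Φ = f := by
  have hB := bargmann_entire_of_mem f.2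
  have e1 : creationCoeff j • creation^[j] (bargmann f) =ᵐ[volume]
      creationCoeff j • creation^[j] Φ := by
    rw [← trueBargmann_eq_smul f.2]
    exact volume_ac.ae_le ((trueBargmannL2_ae h1 h2 j f).symm.trans h)
  have e2 := (Continuous.ae_eq_iff_eq volume
    ((creation_iter_smooth (smooth_of_entire hB) j).continuous.const_smul _)
    ((creation_iter_smooth (smooth_of_entire hΦ) j).continuous.const_smul _)).1 e1
  -- Applying ∂_{z̄}ʲ cancels the creation operators up to a nonzero scalar, so Bf = Φ.
  have e3 := congrArg (dbar^[j]) e2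
  rw [dbar_iter_creation hB, dbar_iter_creation hΦ] at e3
  have hc : creationCoeff j * (j.factorial * (Real.sqrt Real.pi : ℂ) ^ j) ≠ 0 := by
    have h3 : creationCoeff j ≠ 0 := by
      rw [← norm_ne_zero_iff, norm_creationCoeff]
      have : (0 : ℝ) < j.factorial := by exact_mod_cast j.factorial_pos
      positivity
    exact mul_ne_zero h3 (mul_ne_zero (by exact_mod_cast j.factorial_ne_zero)
      (pow_ne_zero _ sqrt_pi_ne))
  rw [← smul_right_injective _ hc e3]
  exact bargmannAdj_bargmann (expBounded_of_mem f.2) (fockDecay_of_mem h1 h2 f.2)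

theorem inner_trueBargmannL2 (j : ℕ) (f g : gsRoumieuSub α) :
    inner ℂ (trueBargmannL2 h1 h2 j f) (trueBargmannL2 h1 h2 j g) =
      ∫ t : ℝ, (starRingEnd ℂ) ((f : ℝ → ℂ) t) * (g : ℝ → ℂ) t := by
  obtain ⟨A, N, hA, hf⟩ := exists_gsBound f.2
  rw [inner_toLp _ _ (trueBargmannL2_ae h1 h2 j f) (trueBargmannL2_ae h1 h2 j g),
    trueBargmann_eq_smul f.2, trueBargmann_eq_smul g.2, gaussInner_smul_right,
    gaussInner_smul_left, gaussInner_creation_iter (bargmann_entire_of_mem f.2)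
    (fockDecay_of_mem h1 h2 f.2).memLp (bargmann_entire_of_mem g.2)
    (fockDecay_of_mem h1 h2 g.2).memLp, if_pos rfl,
    gaussInner_bargmann_bargmann hf.smooth.continuous hf.bounded (expBounded_of_mem g.2)
    (fockDecay_of_mem h1 h2 g.2), ← mul_assoc, ← mul_assoc, Complex.mul_conj,
    Complex.normSq_eq_norm_sq, norm_creationCoeff]
  have h3 : (0 : ℝ) < j.factorial := by exact_mod_cast j.factorial_pos
  rw [div_pow, Real.sq_sqrt h3.le, one_pow, ← Complex.ofReal_natCast, ← Complex.ofReal_mul,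
    one_div_mul_cancel h3.ne', Complex.ofReal_one, one_mul]

/-! ### The vector-valued poly-Bargmann transform -/

/-- The vector-valued poly-Bargmann transform as a linear map into `L²(ℂ, dμ)`. -/
noncomputable def polyBargmannL2 (n : ℕ) : (Fin (n + 1) → gsRoumieuSub α) →ₗ[ℂ] L2Gauss :=
  ∑ j : Fin (n + 1), trueBargmannL2 h1 h2 (j : ℕ) ∘ₗ LinearMap.proj j

variable {n : ℕ}

theorem polyBargmannL2_apply (f : Fin (n + 1) → gsRoumieuSub α) :
    polyBargmannL2 h1 h2 n f = ∑ j : Fin (n + 1), trueBargmannL2 h1 h2 j (f j) := by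
  simp [polyBargmannL2]

theorem polyBargmannL2_ae (f : Fin (n + 1) → gsRoumieuSub α) :
    polyBargmannL2 h1 h2 n f =ᵐ[gaussMeasure] polyBargmann n (fun j => (f j : ℝ → ℂ)) := by
  rw [polyBargmannL2_apply]
  refine (Lp.coeFn_finsetSum _ _).trans ?_
  have : ∀ᵐ z ∂gaussMeasure, ∀ j : Fin (n + 1),
      trueBargmannL2 h1 h2 j (f j) z = trueBargmann j (f j) z :=
    ae_all_iff.2 fun j => trueBargmannL2_ae h1 h2 j (f j)
  filter_upwards [this] with z hz
  simp only [Finset.sum_apply, polyBargmann, hz]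

theorem polyProj_polyBargmannL2 (f : Fin (n + 1) → gsRoumieuSub α) (j : Fin (n + 1)) :
    polyProj j (polyBargmannL2 h1 h2 n f) = trueBargmannL2 h1 h2 j (f j) := by
  rw [polyBargmannL2_apply]
  exact polyProj_sum (fun k => trueBargmannL2_mem h1 h2 k (f k)) j

theorem polyNorm_polyBargmannL2 (p : ℝ≥0∞) (a : ℝ) (f : Fin (n + 1) → gsRoumieuSub α) :
    polyNorm n p α a (polyBargmannL2 h1 h2 n f) =
      ∑ j : Fin (n + 1), modNorm p α a j (f j : ℝ → ℂ) := by
  refine Finset.sum_congr rfl fun j _ => ?_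
  rw [eLpNorm_weighted p α a j (F := trueBargmann j (f j)), fockNorm_trueBargmann]
  rw [polyProj_polyBargmannL2]
  exact trueBargmannL2_ae h1 h2 j (f j)

theorem inner_polyBargmannL2 (f g : Fin (n + 1) → gsRoumieuSub α) :
    inner ℂ (polyBargmannL2 h1 h2 n f) (polyBargmannL2 h1 h2 n g) =
      ∑ j, ∫ t : ℝ, (starRingEnd ℂ) ((f j : ℝ → ℂ) t) * (g j : ℝ → ℂ) t := by
  rw [polyBargmannL2_apply, polyBargmannL2_apply, sum_inner]
  refine Finset.sum_congr rfl fun j _ => ?_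
  rw [inner_sum, Finset.sum_eq_single j, inner_trueBargmannL2]
  · intro k _ hk
    exact trueFock_orthogonal (fun h => hk (Fin.ext h.symm)) (trueBargmannL2_mem h1 h2 j (f j))
      (trueBargmannL2_mem h1 h2 k (g k))
  · simp

/-- The projection Pʲ isolates the j-th component, which determines f_j by the inversion formula. -/
theorem polyBargmannL2_injective : Function.Injective (polyBargmannL2 (α := α) h1 h2 n) := by
  intro f g h
  funext j
  have e : trueBargmannL2 h1 h2 j (f j) = trueBargmannL2 h1 h2 j (g j) := by
    rw [← polyProj_polyBargmannL2, h, polyProj_polyBargmannL2]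
  have h3 : trueBargmannL2 h1 h2 j (g j) =ᵐ[gaussMeasure]
      creationCoeff j • creation^[j] (bargmann (g j)) := by
    rw [← trueBargmann_eq_smul (g j).2]
    exact trueBargmannL2_ae h1 h2 j (g j)
  have hd := bargmann_entire_of_mem (g j).2
  apply Subtype.ext
  rw [← bargmannAdj_eq_of_ae h1 h2 hd h3, ← bargmannAdj_eq_of_ae h1 h2 hd (e ▸ h3)]

theorem trueBargmannL2_mem_weightedSpace (p : ℝ≥0∞) (a : ℝ) (j : Fin (n + 1)) (f : gsRoumieuSub α)
    (hfin : fockNorm p α a (trueBargmann j f) < ⊤) :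
    trueBargmannL2 h1 h2 j f ∈ weightedSpace n p α a := by
  have hd := bargmann_entire_of_mem f.2
  refine ⟨⟨trueBargmann j f, ?_, ?_, trueBargmannL2_ae h1 h2 j f⟩, fun k =>
    ⟨weighted_aesm _ _ _ _, ?_⟩⟩
  · rw [trueBargmann_eq_smul f.2]
    exact (creation_iter_smooth (smooth_of_entire hd) j).const_smul (creationCoeff j)
  · rw [trueBargmann_eq_smul f.2, dbar_iter_smul (creation_iter_smooth (smooth_of_entire hd) j),
      dbar_iter_creation_iter_zero hd j.2, smul_zero]
  · by_cases hjk : (k : ℕ) = j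
    · rw [hjk, eLpNorm_weighted p α a j (F := trueBargmann j f)]
      · exact hfin
      · rw [polyProj_self (trueBargmannL2_mem h1 h2 j f)]
        exact trueBargmannL2_ae h1 h2 j f
    · rw [eLpNorm_weighted p α a k (F := 0), fockNorm_zero]
      · exact ENNReal.zero_lt_top
      · rw [polyProj_of_ne hjk (trueBargmannL2_mem h1 h2 j f)]
        exact Lp.coeFn_zero _ _ _

theorem polyBargmannL2_mem_roumieu {p : ℝ≥0∞} (hp : 1 ≤ p) (f : Fin (n + 1) → gsRoumieuSub α) :
    polyBargmannL2 h1 h2 n f ∈ polyRoumieuSub n p α := by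
  rw [polyBargmannL2_apply]
  refine sum_mem fun j _ => ?_
  obtain ⟨hs, A, hA, hfin⟩ := (f j).2
  obtain ⟨a, ha, H⟩ := trueBargmann_bound_roumieu hp h1 h2 hA
  obtain ⟨C, hC⟩ := H j
  exact ⟨a, ha, trueBargmannL2_mem_weightedSpace h1 h2 p a j (f j)
    ((hC _ hs).trans_lt (ENNReal.mul_lt_top ENNReal.coe_lt_top hfin))⟩

theorem polyBargmannL2_mem_beurling {p : ℝ≥0∞} (hp : 1 ≤ p) (f : Fin (n + 1) → gsRoumieuSub α)
    (hf : ∀ j, (f j : ℝ → ℂ) ∈ gsBeurlingSub α) :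
    polyBargmannL2 h1 h2 n f ∈ polyBeurlingSub n p α := by
  rw [polyBargmannL2_apply]
  refine sum_mem fun j _ a ha => ?_
  obtain ⟨hs, hfin⟩ := hf j
  obtain ⟨A, hA, H⟩ := trueBargmann_bound_beurling hp h1 h2 ha
  obtain ⟨C, hC⟩ := H j
  exact trueBargmannL2_mem_weightedSpace h1 h2 p a j (f j)
    ((hC _ hs).trans_lt (ENNReal.mul_lt_top ENNReal.coe_lt_top (hfin A hA)))

/-- Every element of `𝒢^{α}_n` is the poly-Bargmann transform of Gel'fand–Shilov functions; bounds
for all true polyanalytic components translate into bounds for these functions. -/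
theorem exists_polyBargmannL2_eq {p : ℝ≥0∞} (hp : 1 ≤ p) {σ : L2Gauss}
    (hσ : σ ∈ polyRoumieuSub n p α) : ∃ f, polyBargmannL2 (α := α) h1 h2 n f = σ := by
  obtain ⟨a, ha, hpF, hw⟩ := hσ
  obtain ⟨F, hF, rfl⟩ := polyFock_decompose n σ hpF
  choose Φ hΦ hae using fun j => trueFock_exists (hF j)
  have hfin : ∀ j : Fin (n + 1), fockNorm p α a (creationCoeff j • creation^[j] (Φ j)) < ⊤ :=
    fun j => by
      rw [← eLpNorm_weighted p α a j (σ := ∑ j, F j) (by rw [polyProj_sum hF]; exact hae j)]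
      exact (hw j).2
  obtain ⟨A, hA, H⟩ := bargmannAdj_bound_roumieu hp h1 h2 ha
  have hmem : ∀ j, bargmannAdj (Φ j) ∈ gsRoumieuSub α := fun j => by
    obtain ⟨C, hC⟩ := H j
    have h3 := hC (Φ j) (hΦ j) (hfin j)
    exact ⟨h3.smooth, A, hA, (h3.gsNorm_le hA).trans_lt ENNReal.ofReal_lt_top⟩
  refine ⟨fun j => ⟨_, hmem j⟩, ?_⟩
  rw [polyBargmannL2_apply]
  refine Finset.sum_congr rfl fun j _ => ?_
  refine Lp.ext ((trueBargmannL2_ae h1 h2 j _).trans (Filter.EventuallyEq.trans ?_ (hae j).symm))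
  rw [trueBargmann_eq_smul (hmem j), bargmann_bargmannAdj (hΦ j)
    (fockDecay_of_fockNorm hp h1 h2 ha j (hΦ j) (hfin j))]

theorem modNorm_le_polyNorm {p : ℝ≥0∞} {a : ℝ} (f : Fin (n + 1) → gsRoumieuSub α)
    (j : Fin (n + 1)) :
    modNorm p α a j (f j : ℝ → ℂ) ≤ polyNorm n p α a (polyBargmannL2 h1 h2 n f) := by
  rw [polyNorm_polyBargmannL2]
  exact Finset.single_le_sum (f := fun j : Fin (n + 1) => modNorm p α a j (f j : ℝ → ℂ))
    (fun _ _ => bot_le) (Finset.mem_univ j)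

end

/-! ### The linear homeomorphisms -/

theorem modNorm_zero (p : ℝ≥0∞) (α a : ℝ) (j : ℕ) : modNorm p α a j 0 = 0 := by
  simpa using modNorm_smul p α a j 0 0

theorem sum_modNorm_single {n : ℕ} {S : Type*} [Zero S] (F : S → ℝ → ℂ) (hF : F 0 = 0)
    (p : ℝ≥0∞) (α a : ℝ) (j : Fin (n + 1)) (x : S) :
    ∑ k : Fin (n + 1), modNorm p α a k (F ((Pi.single j x : Fin (n + 1) → S) k)) =
      modNorm p α a j (F x) := by
  rw [Finset.sum_eq_single j, Pi.single_eq_same]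
  · intro k _ hk
    rw [Pi.single_eq_of_ne hk, hF, modNorm_zero]
  · simp

theorem polyNorm_lt_top {n : ℕ} {p : ℝ≥0∞} {α a : ℝ} {σ : L2Gauss}
    (h : σ ∈ weightedSpace n p α a) : polyNorm n p α a σ < ⊤ :=
  ENNReal.sum_lt_top.2 fun j _ => (h.2 j).2

theorem gsBeurlingSub_le (α : ℝ) : gsBeurlingSub α ≤ gsRoumieuSub α :=
  fun _ hf => ⟨hf.1, 1, one_pos, hf.2 1 one_pos⟩

theorem polyBeurlingSub_le (n : ℕ) (p : ℝ≥0∞) (α : ℝ) :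
    polyBeurlingSub n p α ≤ polyRoumieuSub n p α :=
  fun _ hσ => ⟨1, one_pos, hσ 1 one_pos⟩

section

variable {α : ℝ} (h1 : 1 / 2 ≤ α) (h2 : α ≤ 1) (n : ℕ) {p : ℝ≥0∞} (hp : 1 ≤ p)

/-- The vector-valued poly-Bargmann transform on `𝒮^α_α(ℝ)ⁿ⁺¹`, as a linear equivalence. -/
noncomputable def roumieuLinearEquiv :
    (Fin (n + 1) → gsRoumieuSub α) ≃ₗ[ℂ] polyRoumieuSub n p α :=
  LinearEquiv.ofBijective
    ((polyBargmannL2 h1 h2 n).codRestrict _ (polyBargmannL2_mem_roumieu h1 h2 hp))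
    ⟨fun f g h => polyBargmannL2_injective h1 h2 (congrArg Subtype.val h), fun σ => by
      obtain ⟨f, hf⟩ := exists_polyBargmannL2_eq h1 h2 hp σ.2
      exact ⟨f, Subtype.ext hf⟩⟩

/-- The inclusion of `Σ^α_α(ℝ)ⁿ⁺¹` into `𝒮^α_α(ℝ)ⁿ⁺¹`. -/
def beurlingInclusion (α : ℝ) (n : ℕ) :
    (Fin (n + 1) → gsBeurlingSub α) →ₗ[ℂ] (Fin (n + 1) → gsRoumieuSub α) :=
  LinearMap.pi fun j => Submodule.inclusion (gsBeurlingSub_le α) ∘ₗ LinearMap.proj j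

/-- The vector-valued poly-Bargmann transform on `Σ^α_α(ℝ)ⁿ⁺¹`, as a linear equivalence. -/
noncomputable def beurlingLinearEquiv :
    (Fin (n + 1) → gsBeurlingSub α) ≃ₗ[ℂ] polyBeurlingSub n p α :=
  LinearEquiv.ofBijective
    ((polyBargmannL2 h1 h2 n ∘ₗ beurlingInclusion α n).codRestrict _
      fun f => polyBargmannL2_mem_beurling h1 h2 hp _ fun j => (f j).2)
    ⟨fun f g h => by
      have h3 := polyBargmannL2_injective h1 h2 (congrArg Subtype.val h)
      funext j
      exact Submodule.inclusion_injective (gsBeurlingSub_le α) (congrFun h3 j),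
    fun σ => by
      -- The preimage is first found in the larger space 𝒮^α_α. Finiteness of all weighted norms of
      -- σ then places its components in Σ^α_α.
      obtain ⟨f, hf⟩ := exists_polyBargmannL2_eq h1 h2 hp (polyBeurlingSub_le n p α σ.2)
      have hmem : ∀ j, (f j : ℝ → ℂ) ∈ gsBeurlingSub α := fun j =>
        ⟨(f j).2.1, fun A hA => by
          obtain ⟨a, ha, H⟩ := bargmannAdj_bound_beurling hp h1 h2 hA
          obtain ⟨C, hC⟩ := H j
          refine (gsNorm_le_modNorm h1 h2 hA hC (f j)).trans_lt
            (ENNReal.mul_lt_top ENNReal.coe_lt_top ((modNorm_le_polyNorm h1 h2 f j).trans_lt ?_))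
          rw [hf]
          exact polyNorm_lt_top (σ.2 a ha)⟩
      exact ⟨fun j => ⟨_, hmem j⟩, Subtype.ext hf⟩⟩

/-- The vector-valued poly-Bargmann transform as a linear homeomorphism of `𝒮^α_α(ℝ)ⁿ⁺¹` onto
`𝒢^{α}_n`. -/
noncomputable def roumieuEquiv : (Fin (n + 1) → GSRoumieu α) ≃L[ℂ] PolyRoumieu n p α :=
  letI e : (Fin (n + 1) → GSRoumieu α) ≃ₗ[ℂ] PolyRoumieu n p α := roumieuLinearEquiv h1 h2 n hp
  haveI : ContinuousAdd (PolyRoumieu n p α) := continuousAdd_seminormTopology _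
  haveI hN : ∀ a f, polyNorm n p α a (e f).toL2 =
      ∑ j : Fin (n + 1), modNorm p α a j (f j).toFun := fun a f =>
    polyNorm_polyBargmannL2 h1 h2 p a f
  continuousEquivOfCoord e
    (fun j => continuous_inductiveTopology _ fun A hA => by
      obtain ⟨a, ha, H⟩ := trueBargmann_bound_roumieu hp h1 h2 hA
      obtain ⟨C, hC⟩ := H j
      refine ⟨a, ha, C, fun x => ?_⟩
      refine (hN a (Pi.single j x)).trans_le ?_
      rw [sum_modNorm_single GSRoumieu.toFun rfl, ← fockNorm_trueBargmann]
      exact hC _ x.2.1)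
    (fun j => continuous_inductiveTopology _ fun a ha => by
      obtain ⟨A, hA, H⟩ := bargmannAdj_bound_roumieu hp h1 h2 ha
      obtain ⟨C, hC⟩ := H j
      refine ⟨A, hA, C.toNNReal + 1, fun σ => ?_⟩
      obtain ⟨f, rfl⟩ := e.surjective σ
      simp only [LinearMap.comp_apply, LinearEquiv.coe_coe, e.symm_apply_apply,
        LinearMap.proj_apply]
      exact (gsNorm_le_modNorm h1 h2 hA hC (f j)).trans
        (mul_le_mul_right (modNorm_le_polyNorm h1 h2 f j) _))

/-- The vector-valued poly-Bargmann transform as a linear homeomorphism of `Σ^α_α(ℝ)ⁿ⁺¹` onto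
`𝒢^{(α)}_n`. -/
noncomputable def beurlingEquiv : (Fin (n + 1) → GSBeurling α) ≃L[ℂ] PolyBeurling n p α :=
  letI e : (Fin (n + 1) → GSBeurling α) ≃ₗ[ℂ] PolyBeurling n p α := beurlingLinearEquiv h1 h2 n hp
  haveI : ContinuousAdd (PolyBeurling n p α) := continuousAdd_seminormTopology _
  haveI hN : ∀ a f, polyNorm n p α a (e f).toL2 =
      ∑ j : Fin (n + 1), modNorm p α a j (f j).toFun := fun a f =>
    polyNorm_polyBargmannL2 h1 h2 p a (beurlingInclusion α n f)
  continuousEquivOfCoord e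
    (fun j => continuous_projectiveTopology _ fun a ha => by
      obtain ⟨A, hA, H⟩ := trueBargmann_bound_beurling hp h1 h2 ha
      obtain ⟨C, hC⟩ := H j
      refine ⟨A, hA, C, fun x => ?_⟩
      refine (hN a (Pi.single j x)).trans_le ?_
      rw [sum_modNorm_single GSBeurling.toFun rfl, ← fockNorm_trueBargmann]
      exact hC _ x.2.1)
    (fun j => continuous_projectiveTopology _ fun A hA => by
      obtain ⟨a, ha, H⟩ := bargmannAdj_bound_beurling hp h1 h2 hA
      obtain ⟨C, hC⟩ := H j
      refine ⟨a, ha, C.toNNReal + 1, fun σ => ?_⟩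
      obtain ⟨f, rfl⟩ := e.surjective σ
      simp only [LinearMap.comp_apply, LinearEquiv.coe_coe, e.symm_apply_apply,
        LinearMap.proj_apply]
      exact (gsNorm_le_modNorm h1 h2 hA hC (beurlingInclusion α n f j)).trans
        (mul_le_mul_right (modNorm_le_polyNorm h1 h2 (beurlingInclusion α n f) j) _))

end

end PolyGS

/-! ### The two cases of the proposition, with the dual homeomorphisms -/

theorem proposition4p2 (n : ℕ) (p : ENNReal) (hp : 1 ≤ p) (α : ℝ) (hα : 1 / 2 ≤ α)
    (hα' : α ≤ 1) :
    (∃ (e : (Fin (n + 1) → GSRoumieu α) ≃L[ℂ] PolyRoumieu n p α)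
        (e' : (Fin (n + 1) → StrongDual ℂ (GSRoumieu α)) ≃L[ℂ] StrongDual ℂ (PolyRoumieu n p α)),
      (∀ f, (e f).toL2 =ᵐ[gaussMeasure] polyBargmann n (fun j => (f j).toFun)) ∧
      (∀ f g, inner ℂ (e f).toL2 (e g).toL2 =
        ∑ j, ∫ t : ℝ, (starRingEnd ℂ) ((f j).toFun t) * (g j).toFun t) ∧
      (∀ a : ℝ, 0 < a → ∀ f,
        polyNorm n p α a (e f).toL2 = ∑ j : Fin (n + 1), modNorm p α a j (f j).toFun) ∧
      (∀ T f, e' T (e f) = ∑ j, T j (f j)) ∧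
      (∀ a : ℝ, 0 < a → ∀ T,
        dualNorm (fun σ : PolyRoumieu n p α => polyNorm n p α a σ.toL2) (e' T) =
          ⨆ j : Fin (n + 1), dualNorm (fun f : GSRoumieu α => modNorm p α a j f.toFun) (T j))) ∧
    (∃ (e : (Fin (n + 1) → GSBeurling α) ≃L[ℂ] PolyBeurling n p α)
        (e' : (Fin (n + 1) → StrongDual ℂ (GSBeurling α)) ≃L[ℂ] StrongDual ℂ (PolyBeurling n p α)),
      (∀ f, (e f).toL2 =ᵐ[gaussMeasure] polyBargmann n (fun j => (f j).toFun)) ∧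
      (∀ f g, inner ℂ (e f).toL2 (e g).toL2 =
        ∑ j, ∫ t : ℝ, (starRingEnd ℂ) ((f j).toFun t) * (g j).toFun t) ∧
      (∀ a : ℝ, 0 < a → ∀ f,
        polyNorm n p α a (e f).toL2 = ∑ j : Fin (n + 1), modNorm p α a j (f j).toFun) ∧
      (∀ T f, e' T (e f) = ∑ j, T j (f j)) ∧
      (∀ a : ℝ, 0 < a → ∀ T,
        dualNorm (fun σ : PolyBeurling n p α => polyNorm n p α a σ.toL2) (e' T) =
          ⨆ j : Fin (n + 1), dualNorm (fun f : GSBeurling α => modNorm p α a j f.toFun) (T j))) := by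
  refine ⟨⟨roumieuEquiv hα hα' n hp, dualEquiv _,
      fun f => polyBargmannL2_ae hα hα' f, fun f g => inner_polyBargmannL2 hα hα' f g,
      fun a _ f => polyNorm_polyBargmannL2 hα hα' p a f, dualEquiv_apply _,
      fun a _ T => dualNorm_eq_iSup (roumieuEquiv hα hα' n hp)
        (N := fun (j : Fin (n + 1)) (f : GSRoumieu α) => modNorm p α a j f.toFun)
        (fun f => polyNorm_polyBargmannL2 hα hα' p a f)
        (fun j c x => modNorm_smul p α a j c x.toFun) T⟩,
    ⟨beurlingEquiv hα hα' n hp, dualEquiv _,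
      fun f => polyBargmannL2_ae hα hα' (beurlingInclusion α n f),
      fun f g => inner_polyBargmannL2 hα hα' (beurlingInclusion α n f) (beurlingInclusion α n g),
      fun a _ f => polyNorm_polyBargmannL2 hα hα' p a (beurlingInclusion α n f), dualEquiv_apply _,
      fun a _ T => dualNorm_eq_iSup (beurlingEquiv hα hα' n hp)
        (N := fun (j : Fin (n + 1)) (f : GSBeurling α) => modNorm p α a j f.toFun)
        (fun f => polyNorm_polyBargmannL2 hα hα' p a (beurlingInclusion α n f))
        (fun j c x => modNorm_smul p α a j c x.toFun) T⟩⟩
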